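/- Let $\Gamma$ be a countable discrete group and $\Lambda<\Gamma$ an amenable subgroup which is singular in $\Gamma$: there is a non-empty compact Hausdorff space $X$ with a continuous action of $\Gamma$ such that $g\cdot\mu\perp\mu$ for every $\Lambda$-invariant regular Borel probability measure $\mu$ on $X$ and every $g\in\Gamma\setminus\Lambda$. Then the following hold. (1) Let $Q$ be a finite von Neumann algebra with separable predual and with a faithful normal tracial state $\tau$, and suppose that $Q$ is amenable. For every $\tau$-preserving action of $\Gamma$ on $Q$ by $*$-automorphisms, $Q\rtimes\Lambda$ is maximal amenable inside $Q\rtimes\Gamma$; that is, $Q\rtimes\Lambda$ is amenable, and every amenable von Neumann algebra $A$ with $Q\rtimes\Lambda\subset A\subset Q\rtimes\Gamma$ equals $Q\rtimes\Lambda$. (2) In particular, the group von Neumann algebra $L\Lambda$ is maximal amenable inside $L\Gamma$. (3) For every essentially free measure-preserving action of $\Gamma$ on a standard probability space $(Y,\nu)$, the orbit equivalence relation $\mathcal R(\Lambda\curvearrowright Y)$ is maximal hyperfinite inside $\mathcal R(\Gamma\curvearrowright Y)$, modulo $\nu$-null sets; that is, $\mathcal R(\Lambda\curvearrowright Y)$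 is hyperfinite, and every hyperfinite Borel equivalence relation $\mathcal S$ with $\mathcal R(\Lambda\curvearrowright Y)\subset\mathcal S\subset\mathcal R(\Gamma\curvearrowright Y)$ almost everywhere agrees with $\mathcal R(\Lambda\curvearrowright Y)$ almost everywhere. Here a von Neumann algebra $A\subset B(K)$ with a faithful normal tracial state $\tau$ is called amenable if there is a state $\varphi$ on $B(K)$ with $\varphi|_A=\tau$ and $\varphi(xT)=\varphi(Tx)$ for all $x\in A$, $T\in B(K)$ (on $A\subset Q\rtimes\Gamma$ one takes the restriction of the canonical trace). A Borel equivalence relation is hyperfinite if, up to a null set, it is the union of an increasing sequence of Borel equivalence relations with finite classes. -/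

import Mathlib

open scoped ENNReal MeasureTheory

/-! ### Amenable groups and singular subgroups -/

/-- A discrete group is amenable if `ℓ^∞(G)` carries a left-invariant mean. -/
def IsAmenableGroup (G : Type*) [Group G] : Prop :=
  ∃ m : lp (fun _ : G => ℝ) ∞ →ₗ[ℝ] ℝ,
    (∀ f, (∀ x, 0 ≤ f x) → 0 ≤ m f) ∧
    (∀ f, (∀ x, f x = 1) → m f = 1) ∧
    ∀ (g : G) (f f' : lp (fun _ : G => ℝ) ∞), (∀ x, f' x = f (g⁻¹ * x)) → m f' = m f

/-- `Λ` is an amenable subgroup of `Γ` which is singular with respect to the compact `Γ`-space `X`: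
every `Λ`-invariant (regular) Borel probability measure `μ` on `X` is singular to all its
translates `g · μ`, `g ∉ Λ`. -/
structure IsSingularSubgroup {Γ : Type*} [Group Γ] (Λ : Subgroup Γ) (X : Type*)
    [TopologicalSpace X] [MeasurableSpace X] [MulAction Γ X] : Prop where
  amenable : IsAmenableGroup Λ
  singular : ∀ μ : MeasureTheory.Measure X, MeasureTheory.IsProbabilityMeasure μ → μ.Regular →
    (∀ h ∈ Λ, μ.map (fun x => h • x) = μ) →
    ∀ g ∉ Λ, μ.map (fun x => g • x) ⟂ₘ μ

/-! ### Finite von Neumann algebras and amenability -/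

section Hilbert

variable {H : Type*} [NormedAddCommGroup H] [InnerProductSpace ℂ H] [CompleteSpace H]

/-- The von Neumann algebra generated by a set of bounded operators (the bicommutant of the
set together with the adjoints of its elements). -/
noncomputable def vonNeumannGenerated (S : Set (H →L[ℂ] H)) : VonNeumannAlgebra H where
  toStarSubalgebra :=
    StarSubalgebra.centralizer ℂ (StarSubalgebra.centralizer ℂ S : Set (H →L[ℂ] H))
  centralizer_centralizer' := by
    simp

/-- `Q` is a finite von Neumann algebra in its standard representation: writing
`τ(x) = ⟪Ω, x Ω⟫`, the (normal) state `τ` is a faithful trace on `Q`, and `Ω` is cyclic for `Q`.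
Thus `H = L²(Q, τ)` with `Ω = 1̂`, and every von Neumann algebra with a faithful normal tracial
state is of this form, through its GNS representation. -/
structure IsTracialStandardForm (Q : VonNeumannAlgebra H) (Ω : H) : Prop where
  norm_eq_one : ‖Ω‖ = 1
  trace : ∀ x ∈ Q, ∀ y ∈ Q, inner ℂ Ω ((x * y) Ω) = inner ℂ Ω ((y * x) Ω)
  faithful : ∀ x ∈ Q, inner ℂ Ω ((star x * x) Ω) = 0 → x = 0
  cyclic : Dense {v : H | ∃ x ∈ Q, v = x Ω}

/-- Amenability of a von Neumann algebra `A` on `H` on which `τ(x) = ⟪Ω, x Ω⟫` is a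
faithful (normal) trace: there is an `A`-central state on `B(H)` which extends `τ`. -/
def IsAmenableVN (A : VonNeumannAlgebra H) (Ω : H) : Prop :=
  ∃ φ : (H →L[ℂ] H) →ₗ[ℂ] ℂ,
    (∀ T, 0 ≤ (φ (star T * T)).re ∧ (φ (star T * T)).im = 0) ∧ φ 1 = 1 ∧
    (∀ x ∈ A, φ x = inner ℂ Ω (x Ω)) ∧
    ∀ x ∈ A, ∀ T, φ (x * T) = φ (T * x)

/-- `N` is maximal amenable inside `M`, where `τ(x) = ⟪Ω, x Ω⟫` is a faithful trace on `M`: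
`N` is an amenable von Neumann subalgebra of `M`, and there is no larger one. -/
structure IsMaximalAmenableIn (N M : VonNeumannAlgebra H) (Ω : H) : Prop where
  le : N ≤ M
  amenable : IsAmenableVN N Ω
  maximal : ∀ A : VonNeumannAlgebra H, N ≤ A → A ≤ M → IsAmenableVN A Ω → A = N

theorem VonNeumannAlgebra.norm_starAlgEquiv_le (Q : VonNeumannAlgebra H)
    (σ : Q.toStarSubalgebra ≃⋆ₐ[ℂ] Q.toStarSubalgebra) (x : Q.toStarSubalgebra) :
    ‖(σ x : H →L[ℂ] H)‖ ≤ ‖(x : H →L[ℂ] H)‖ := by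
  have : IsClosed (Q.toStarSubalgebra : Set (H →L[ℂ] H)) := by
    have h : (Q.toStarSubalgebra : Set (H →L[ℂ] H)) =
        Set.centralizer (Set.centralizer (Q : Set (H →L[ℂ] H))) := by simp
    rw [h]
    exact Set.isClosed_centralizer _
  exact NonUnitalStarAlgHom.norm_apply_le σ x

/-! ### Crossed products -/

/-- A trace preserving action of a discrete group `Γ` on `(Q, τ)`, where `τ(x) = ⟪Ω, x Ω⟫`. -/
structure TracePreservingAction (Γ : Type*) [Group Γ] (Q : VonNeumannAlgebra H) (Ω : H) where
  /-- the action by `*`-automorphisms -/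
  aut : Γ →* (Q.toStarSubalgebra ≃⋆ₐ[ℂ] Q.toStarSubalgebra)
  trace_aut : ∀ (g : Γ) (x : Q.toStarSubalgebra),
    inner ℂ Ω ((aut g x : H →L[ℂ] H) Ω) = inner ℂ Ω ((x : H →L[ℂ] H) Ω)

variable {Γ : Type*}

theorem summable_norm_sq_ell2 {Γ H : Type*} [NormedAddCommGroup H] (ξ : lp (fun _ : Γ => H) 2) : Summable fun g => ‖ξ g‖ ^ 2 := by
  have := (lp.memℓp ξ).summable (by norm_num)
  simpa using this

theorem norm_sq_ell2 {Γ H : Type*} [NormedAddCommGroup H] (ξ : lp (fun _ : Γ => H) 2) : ‖ξ‖ ^ 2 = ∑' g, ‖ξ g‖ ^ 2 := by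
  have := lp.norm_rpow_eq_tsum (p := 2) (by norm_num) ξ
  simpa using this

theorem memℓp_two_of_summable_sq {Γ H : Type*} [NormedAddCommGroup H] {f : Γ → H} (h : Summable fun g => ‖f g‖ ^ 2) :
    Memℓp f 2 := memℓp_gen (by simpa using h)

/-- The diagonal operator `(T ξ)(g) = T_g (ξ g)` on `ℓ²(Γ, H)`, for a bounded family `T`. -/
noncomputable def ell2Diagonal (T : Γ → H →L[ℂ] H) (C : ℝ) (hT : ∀ g, ‖T g‖ ≤ C) :
    lp (fun _ : Γ => H) 2 →L[ℂ] lp (fun _ : Γ => H) 2 :=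
  have key : ∀ (ξ : lp (fun _ : Γ => H) 2) (g : Γ), ‖T g (ξ g)‖ ^ 2 ≤ C ^ 2 * ‖ξ g‖ ^ 2 := by
    intro ξ g
    rw [← mul_pow]
    exact pow_le_pow_left₀ (norm_nonneg _) ((T g).le_of_opNorm_le (hT g) _) 2
  have summ : ∀ ξ : lp (fun _ : Γ => H) 2, Summable fun g => ‖T g (ξ g)‖ ^ 2 := fun ξ =>
    Summable.of_nonneg_of_le (fun _ => by positivity) (key ξ)
      ((summable_norm_sq_ell2 ξ).mul_left (C ^ 2))
  LinearMap.mkContinuous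
    { toFun := fun ξ => ⟨fun g => T g (ξ g), memℓp_two_of_summable_sq (summ ξ)⟩
      map_add' := fun ξ η => by ext g; simp; rfl
      map_smul' := fun c ξ => by ext g; simp }
    |C| (fun ξ => by
      refine abs_le_of_sq_le_sq' ?_ (by positivity) |>.2
      rw [norm_sq_ell2, mul_pow, sq_abs, norm_sq_ell2, ← tsum_mul_left]
      exact (summ ξ).tsum_le_tsum (key ξ) ((summable_norm_sq_ell2 ξ).mul_left _))

variable [Group Γ]

/-- Left translation `(λ_h ξ)(g) = ξ (h⁻¹ g)` on `ℓ²(Γ, H)`. -/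
noncomputable def ell2Translation (H : Type*) [NormedAddCommGroup H] [InnerProductSpace ℂ H]
    [CompleteSpace H] (h : Γ) :
    lp (fun _ : Γ => H) 2 →L[ℂ] lp (fun _ : Γ => H) 2 :=
  LinearMap.mkContinuous
    { toFun := fun ξ => ⟨fun g => ξ (h⁻¹ * g), memℓp_two_of_summable_sq
        ((Equiv.mulLeft h⁻¹).summable_iff (f := fun g => ‖ξ g‖ ^ 2) |>.2
          (summable_norm_sq_ell2 ξ))⟩
      map_add' := fun ξ η => by ext g; simp; rfl
      map_smul' := fun c ξ => by ext g; simp }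
    1 (fun ξ => by
      rw [one_mul]
      refine abs_le_of_sq_le_sq' ?_ (by positivity) |>.2
      rw [norm_sq_ell2, norm_sq_ell2]
      exact ((Equiv.mulLeft h⁻¹).tsum_eq (fun g => ‖ξ g‖ ^ 2)).le)

/-- The representation `(π(x) ξ)(g) = σ_{g⁻¹}(x) (ξ g)` of `Q` on `ℓ²(Γ, H)`. -/
noncomputable def TracePreservingAction.rep {Q : VonNeumannAlgebra H} {Ω : H}
    (σ : TracePreservingAction Γ Q Ω) (x : Q.toStarSubalgebra) :
    lp (fun _ : Γ => H) 2 →L[ℂ] lp (fun _ : Γ => H) 2 :=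
  ell2Diagonal (fun g => (σ.aut g⁻¹ x : H →L[ℂ] H)) ‖(x : H →L[ℂ] H)‖
    (fun g => Q.norm_starAlgEquiv_le (σ.aut g⁻¹) x)

/-- The crossed product `Q ⋊ Λ` by a subgroup `Λ` of `Γ`, as a von Neumann algebra on
`L²(Q) ⊗ ℓ²(Γ) = ℓ²(Γ, L²(Q))`: it is generated by `π(Q)` and `{λ_h : h ∈ Λ}`.
For `Λ = ⊤` this is `Q ⋊ Γ`. -/
noncomputable def TracePreservingAction.crossedProduct {Q : VonNeumannAlgebra H} {Ω : H}
    (σ : TracePreservingAction Γ Q Ω) (Λ : Subgroup Γ) :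
    VonNeumannAlgebra (lp (fun _ : Γ => H) 2) :=
  vonNeumannGenerated (Set.range σ.rep ∪ {T | ∃ h ∈ Λ, T = ell2Translation H h})

open Classical in
/-- The vector `δ_e ⊗ Ω`, which implements the canonical trace of the crossed product. -/
noncomputable def ell2Unit (Γ : Type*) [Group Γ] (Ω : H) : lp (fun _ : Γ => H) 2 :=
  lp.single 2 (1 : Γ) Ω

/-- The von Neumann algebra generated by `{λ_h : h ∈ Λ}` on `ℓ²(Γ)`: this is `LΛ`, seen
inside `LΓ`. For `Λ = ⊤` it is `LΓ`. -/
noncomputable def groupVN (Λ : Subgroup Γ) : VonNeumannAlgebra (lp (fun _ : Γ => ℂ) 2) :=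
  vonNeumannGenerated {T | ∃ h ∈ Λ, T = ell2Translation ℂ h}

end Hilbert

/-! ### Orbit equivalence relations -/

section Relations

variable {Y : Type*} [MeasurableSpace Y]

/-- The graph of the equivalence relation is a measurable subset of `Y × Y`. -/
def IsMeasurableRel (S : Setoid Y) : Prop :=
  MeasurableSet {p : Y × Y | S p.1 p.2}

/-- `S` is hyperfinite (modulo `ν`): for almost every `x`, the class of `x` is the increasing union
of its classes for a sequence of measurable equivalence relations with finite classes. -/
def IsHyperfiniteRel (S : Setoid Y) (ν : MeasureTheory.Measure Y) : Prop :=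
  ∃ F : ℕ → Setoid Y,
    (∀ n, IsMeasurableRel (F n)) ∧
    (∀ n x, {y | F n x y}.Finite) ∧
    (∀ n x y, F n x y → F (n + 1) x y) ∧
    ∀ᵐ x ∂ν, ∀ y, S x y ↔ ∃ n, F n x y

/-- `S` is maximal hyperfinite inside `R`: it is a hyperfinite measurable subrelation of `R`, and
every hyperfinite measurable subrelation of `R` containing `S` coincides with `S`,
all modulo `ν`-null sets. -/
structure IsMaximalHyperfiniteIn (S R : Setoid Y) (ν : MeasureTheory.Measure Y) : Prop where
  measurable : IsMeasurableRel S
  le : ∀ᵐ x ∂ν, ∀ y, S x y → R x y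
  hyperfinite : IsHyperfiniteRel S ν
  maximal : ∀ T : Setoid Y, IsMeasurableRel T →
    (∀ᵐ x ∂ν, ∀ y, S x y → T x y) → (∀ᵐ x ∂ν, ∀ y, T x y → R x y) →
    IsHyperfiniteRel T ν → ∀ᵐ x ∂ν, ∀ y, T x y ↔ S x y

end Relations

/-! Part (1). Let `A` be amenable between N = Q ⋊ Λ and M = Q ⋊ Γ, and let φ be an `A`-central state
on the bounded operators of ℓ²(Γ, H) which restricts to the trace τ on all of M. Fix x₀ ∈ X and let
f ∈ C(X) act as multiplication by g ↦ f(g x₀). Conjugation by λ_g then induces the action of Γ on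
C(X), so φ restricts to a state on C(X) that is Λ-invariant, because λ_h ∈ `A` for h ∈ Λ. For g ∉ Λ
singularity provides 0 ≤ f ≤ 1 with φ(1 - f) and φ(f(g·)) both below ε. For y = π(q)λ_g and x ∈ `A`,
the relation f y = y f(g·) and centrality give φ(yx) = φ((1 - f)yx) + φ(xy f(g·)), and
Cauchy-Schwarz makes both terms O(√ε). Hence τ(yx) = 0 (`central_state_eq_zero`): the coefficients
of x off Λ vanish, and x ∈ N (`mem_of_support`).

Amenability prescribes the state on `A` only. It is extended by composing with a map Ψ that sends M
into `A` and preserves the trace (`exists_bimodule_map`), of the form Ψ(T) = W*(T ⊗ 1)W for an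
`A`-linear isometry W from the Hilbert space into countably many copies of the closure of `A` Ω. The
same map, for N in place of `A`, proves `mem_of_support`. N itself is amenable: compress to the
coordinate of the identity, apply the central state of Q, and average over Λ. Part (2) is the case Q
= ℂ.

Part (3) repeats the argument for relations. If finite relations F_n increase to a relation
containing the Λ-orbits, averaging f(g⁻¹ x₀) over the g with g y in the F_n-class of y and
integrating over y gives states on C(X) whose ultralimit is Λ-invariant. A function separating this
limit from its g-translate forces {y : F_n y (g y)} to be null for g ∉ Λ
(`IsSingularSubgroup.measure_eq_zero`). Hyperfiniteness of the Λ-orbits is the Ornstein–Weiss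
theorem, proved by exhausting Y with truncated Følner tiles. -/

set_option linter.unusedSectionVars false

/-! ### Amplifications, states on B(K) and polar decomposition. -/

section OperatorAlgebras

/-- A continuous linear map `W` with `W ∘ f = g`, for `f` with dense range and `‖g‖ ≤ C ‖f‖`. -/
theorem exists_extension_of_bound {V E F : Type*} [AddCommGroup V] [Module ℂ V]
    [NormedAddCommGroup E] [NormedSpace ℂ E] [NormedAddCommGroup F] [NormedSpace ℂ F]
    [CompleteSpace F] (f : V →ₗ[ℂ] E) (g : V →ₗ[ℂ] F) (hf : DenseRange f) (C : ℝ)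
    (h : ∀ v, ‖g v‖ ≤ C * ‖f v‖) : ∃ W : E →L[ℂ] F, ∀ v, W (f v) = g v :=
  ⟨g.extendOfNorm f, fun v => g.extendOfNorm_eq hf ⟨C, h⟩ v⟩

section Diagonal

variable {ι K : Type*} [NormedAddCommGroup K] [InnerProductSpace ℂ K]

theorem ell2Diagonal_apply (T : ι → K →L[ℂ] K) (C : ℝ) (hT : ∀ g, ‖T g‖ ≤ C)
    (ξ : lp (fun _ : ι => K) 2) (g : ι) : ell2Diagonal T C hT ξ g = T g (ξ g) := rfl

/-- The operator acting by `T` in every coordinate. -/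
noncomputable def ell2Const (ι : Type*) (T : K →L[ℂ] K) :
    lp (fun _ : ι => K) 2 →L[ℂ] lp (fun _ : ι => K) 2 :=
  ell2Diagonal (fun _ => T) ‖T‖ (fun _ => le_rfl)

@[simp] theorem ell2Const_apply (T : K →L[ℂ] K) (ξ : lp (fun _ : ι => K) 2) (i : ι) :
    ell2Const ι T ξ i = T (ξ i) := rfl

/-- The weights let an arbitrary countable family be rescaled into one bounded column. Bounding the
squared weights crudely by (1/2)^i already gives a convergent series, with sum 2. -/
theorem summable_sq_weighted {T : ℕ → K →L[ℂ] K} (hT : ∀ i, ‖T i‖ ≤ (1 / 2) ^ i) (v : K) :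
    (Summable fun i => ‖T i v‖ ^ 2) ∧ ∑' i, ‖T i v‖ ^ 2 ≤ 2 * ‖v‖ ^ 2 := by
  have hb : ∀ i, ‖T i v‖ ^ 2 ≤ (1 / 2) ^ i * ‖v‖ ^ 2 := fun i => by
    have h1 : ‖T i v‖ ≤ (1 / 2) ^ i * ‖v‖ := (T i).le_of_opNorm_le (hT i) v
    have h2 : ((1 / 2 : ℝ) ^ i) ≤ 1 := pow_le_one₀ (by norm_num) (by norm_num)
    have h3 : (0 : ℝ) ≤ (1 / 2) ^ i := by positivity
    calc ‖T i v‖ ^ 2 ≤ ((1 / 2) ^ i * ‖v‖) ^ 2 := by gcongr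
      _ = ((1 / 2) ^ i) * (1 / 2) ^ i * ‖v‖ ^ 2 := by ring
      _ ≤ ((1 / 2) ^ i) * 1 * ‖v‖ ^ 2 := by gcongr
      _ = _ := by ring
  have hs : Summable fun i : ℕ => (1 / 2 : ℝ) ^ i * ‖v‖ ^ 2 := summable_geometric_two.mul_right _
  refine ⟨Summable.of_nonneg_of_le (fun _ => by positivity) hb hs, ?_⟩
  refine (Summable.tsum_le_tsum hb
    (Summable.of_nonneg_of_le (fun _ => by positivity) hb hs) hs).trans ?_
  rw [tsum_mul_right, tsum_geometric_two]

/-- The operator `v ↦ (T i v)_i` into `ℓ²(ℕ, K)`. -/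
noncomputable def columnOperator (T : ℕ → K →L[ℂ] K) (hT : ∀ i, ‖T i‖ ≤ (1 / 2) ^ i) :
    K →L[ℂ] lp (fun _ : ℕ => K) 2 :=
  LinearMap.mkContinuous
    { toFun := fun v => ⟨fun i => T i v, memℓp_two_of_summable_sq (summable_sq_weighted hT v).1⟩
      map_add' := fun v w => by ext i; simp; rfl
      map_smul' := fun c v => by ext i; simp }
    2 (fun v => by
      refine abs_le_of_sq_le_sq' ?_ (by positivity) |>.2
      rw [norm_sq_ell2]
      refine (summable_sq_weighted hT v).2.trans ?_
      rw [mul_pow]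
      nlinarith [sq_nonneg ‖v‖])

@[simp] theorem columnOperator_apply (T : ℕ → K →L[ℂ] K) (hT : ∀ i, ‖T i‖ ≤ (1 / 2) ^ i)
    (v : K) (i : ℕ) : columnOperator T hT v i = T i v := rfl

theorem ell2Const_add (S T : K →L[ℂ] K) :
    ell2Const ι (S + T) = ell2Const ι S + ell2Const ι T := by
  ext ξ i; simp

theorem ell2Const_smul (c : ℂ) (T : K →L[ℂ] K) :
    ell2Const ι (c • T) = c • ell2Const ι T := by
  ext ξ i; simp

theorem ell2Const_mul (S T : K →L[ℂ] K) :
    ell2Const ι (S * T) = ell2Const ι S * ell2Const ι T := by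
  ext ξ i; simp

@[simp] theorem ell2Const_one : ell2Const ι (1 : K →L[ℂ] K) = 1 := by
  ext ξ i; simp

end Diagonal

variable {K : Type*} [NormedAddCommGroup K] [InnerProductSpace ℂ K] [CompleteSpace K]

/-- A state on `B(K)`: a positive unital linear functional. -/
structure IsOperatorState (φ : (K →L[ℂ] K) →ₗ[ℂ] ℂ) : Prop where
  nonneg : ∀ T, 0 ≤ (φ (star T * T)).re ∧ (φ (star T * T)).im = 0
  map_one : φ 1 = 1

namespace IsOperatorState

variable {φ : (K →L[ℂ] K) →ₗ[ℂ] ℂ}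

/-- Polarisation: φ is real on S*S for S = 1 + T, which compares imaginary parts, and for S = 1 +
iT, which compares real parts. -/
theorem map_star (hφ : IsOperatorState φ) (T : K →L[ℂ] K) : φ (star T) = starRingEnd ℂ (φ T) := by
  have h1 := (hφ.nonneg (1 + T)).2
  have h2 := (hφ.nonneg (1 + Complex.I • T)).2
  have h0 := (hφ.nonneg T).2
  simp only [star_add, star_one, mul_add, add_mul, one_mul, mul_one, map_add, hφ.map_one,
    Complex.add_im, Complex.one_im, h0, star_smul, Complex.star_def, Complex.conj_I, smul_mul_assoc,
    mul_smul_comm, map_smul, smul_eq_mul, Complex.mul_im, Complex.mul_re, Complex.neg_re,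
    Complex.neg_im, Complex.I_re, Complex.I_im] at h1 h2
  apply Complex.ext
  · simp; linarith
  · simp; linarith

/-- Cauchy-Schwarz. -/
theorem norm_sq_le (hφ : IsOperatorState φ) (S T : K →L[ℂ] K) :
    ‖φ (star S * T)‖ ^ 2 ≤ (φ (star S * S)).re * (φ (star T * T)).re := by
  let c : PreInnerProductSpace.Core ℂ (K →L[ℂ] K) :=
    { inner := fun S T => φ (star S * T)
      conj_inner_symm := fun S T => by
        rw [← hφ.map_star]; simp
      re_inner_nonneg := fun T => (hφ.nonneg T).1
      add_left := fun S T U => by simp [add_mul]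
      smul_left := fun S T r => by simp }
  have := @InnerProductSpace.Core.inner_mul_inner_self_le ℂ (K →L[ℂ] K) _ _ _ c S T
  have h2 : ‖φ (star T * S)‖ = ‖φ (star S * T)‖ := by
    rw [← RCLike.norm_conj, ← hφ.map_star]; simp
  change ‖φ (star S * T)‖ * ‖φ (star T * S)‖ ≤ (φ (star S * S)).re * (φ (star T * T)).re at this
  rw [h2] at this
  nlinarith

theorem norm_mul_sq_le (hφ : IsOperatorState φ) (S T : K →L[ℂ] K) :
    ‖φ (S * T)‖ ^ 2 ≤ (φ (S * star S)).re * (φ (star T * T)).re := by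
  simpa using hφ.norm_sq_le (star S) T

theorem re_nonneg_of_nonneg (hφ : IsOperatorState φ) {T : K →L[ℂ] K} (hT : 0 ≤ T) :
    0 ≤ (φ T).re := by
  obtain ⟨S, rfl⟩ := CStarAlgebra.nonneg_iff_eq_star_mul_self.1 hT
  exact (hφ.nonneg S).1

theorem re_star_mul_self_le (hφ : IsOperatorState φ) (T : K →L[ℂ] K) :
    (φ (star T * T)).re ≤ ‖T‖ ^ 2 := by
  have h : star T * T ≤ algebraMap ℝ _ (‖T‖ ^ 2) := by
    have := CStarAlgebra.star_mul_le_algebraMap_norm_sq (a := T)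
    simpa using this
  have := hφ.re_nonneg_of_nonneg (sub_nonneg.2 h)
  rw [map_sub, Algebra.algebraMap_eq_smul_one, ← Complex.coe_smul, map_smul, hφ.map_one] at this
  simp at this
  have h2 : ((‖T‖ : ℂ) ^ 2).re = ‖T‖ ^ 2 := by norm_cast
  linarith

theorem norm_le (hφ : IsOperatorState φ) (T : K →L[ℂ] K) : ‖φ T‖ ≤ ‖T‖ := by
  have h := hφ.norm_sq_le 1 T
  have := hφ.re_star_mul_self_le T
  simp [hφ.map_one] at h
  exact abs_le_of_sq_le_sq' (by linarith) (norm_nonneg _) |>.2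

end IsOperatorState

theorem inner_star_apply (T : K →L[ℂ] K) (x y : K) :
    inner ℂ (star T x) y = inner ℂ x (T y) := by
  rw [ContinuousLinearMap.star_eq_adjoint, ContinuousLinearMap.adjoint_inner_left]

theorem inner_apply_star (T : K →L[ℂ] K) (x y : K) :
    inner ℂ x (star T y) = inner ℂ (T x) y := by
  rw [ContinuousLinearMap.star_eq_adjoint, ContinuousLinearMap.adjoint_inner_right]

theorem inner_ell2Const {ι : Type*} (T : K →L[ℂ] K) (ξ η : lp (fun _ : ι => K) 2) :
    inner ℂ (ell2Const ι T ξ) η = inner ℂ ξ (ell2Const ι (star T) η) := by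
  rw [lp.inner_eq_tsum, lp.inner_eq_tsum]
  congr 1; ext i
  simp [inner_apply_star]

theorem star_ell2Const {ι : Type*} (T : K →L[ℂ] K) :
    star (ell2Const ι T) = ell2Const ι (star T) := by
  ext1 x
  refine ext_inner_right ℂ fun y => ?_
  rw [inner_star_apply, inner_ell2Const, star_star]

/-- Polar decomposition of an injective operator: there is an isometry `W` with
`W ∘ |S| = S`, and it intertwines every pair `(a, b)` which `S` intertwines along with its adjoint
pair. -/
theorem exists_isometry_polar {L : Type*} [NormedAddCommGroup L] [InnerProductSpace ℂ L]
    [CompleteSpace L] (S : K →L[ℂ] L) (hS : Function.Injective S) :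
    ∃ W : K →L[ℂ] L, ∃ P : K →L[ℂ] K, DenseRange P ∧ (∀ v, W (P v) = S v) ∧
      (∀ v, ‖W v‖ = ‖v‖) ∧
      ∀ (a : K →L[ℂ] K) (b : L →L[ℂ] L), (∀ v, S (a v) = b (S v)) →
        (∀ v, S (star a v) = star b (S v)) → ∀ v, W (a v) = b (W v) := by
  set D : K →L[ℂ] K := (ContinuousLinearMap.adjoint S).comp S with hD
  have hD0 : 0 ≤ D := by
    rw [ContinuousLinearMap.nonneg_iff_isPositive]
    exact ContinuousLinearMap.isPositive_adjoint_comp_self S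
  set P := CFC.sqrt D with hP
  have hPsa : star P = P := (IsSelfAdjoint.of_nonneg (CFC.sqrt_nonneg D)).star_eq
  have hPP : P * P = D := CFC.sqrt_mul_sqrt_self D hD0
  have hnorm : ∀ v, ‖P v‖ = ‖S v‖ := by
    intro v
    have h1 : inner ℂ (P v) (P v) = inner ℂ (S v) (S v) := by
      have : inner ℂ (P v) (P v) = inner ℂ v (P (P v)) := by
        conv_lhs => rw [← hPsa]
        rw [inner_star_apply, hPsa]
      rw [this, ← mul_apply_eq_comp, hPP, hD, ContinuousLinearMap.comp_apply,
        ContinuousLinearMap.adjoint_inner_right]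
    rw [inner_self_eq_norm_sq_to_K, inner_self_eq_norm_sq_to_K] at h1
    have h2 : ‖P v‖ ^ 2 = ‖S v‖ ^ 2 := by exact_mod_cast h1
    exact (sq_eq_sq₀ (norm_nonneg _) (norm_nonneg _)).1 h2
  have hdense : DenseRange P := by
    have hr : (LinearMap.range (P : K →ₗ[ℂ] K)).topologicalClosure = ⊤ := by
      rw [Submodule.topologicalClosure_eq_top_iff, Submodule.eq_bot_iff]
      intro v hv
      rw [Submodule.mem_orthogonal] at hv
      have h1 : P v = 0 := by
        have := hv (P (P v)) ⟨P v, rfl⟩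
        rw [← inner_self_eq_zero (𝕜 := ℂ)]
        rw [← this]
        conv_rhs => rw [← hPsa]
        rw [inner_star_apply, hPsa]
      have h2 : ‖S v‖ = 0 := by rw [← hnorm, h1, norm_zero]
      exact hS (by rw [norm_eq_zero.1 h2, map_zero])
    have := (Submodule.dense_iff_topologicalClosure_eq_top).2 hr
    simpa [DenseRange, LinearMap.coe_range] using this
  obtain ⟨W, hW⟩ := exists_extension_of_bound (P : K →ₗ[ℂ] K) (S : K →ₗ[ℂ] L) hdense 1
    (fun v => by simp [hnorm])
  have hW' : ∀ v, W (P v) = S v := hW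
  refine ⟨W, P, hdense, hW, ?_, ?_⟩
  · intro v
    refine hdense.induction_on (p := fun v => ‖W v‖ = ‖v‖) v
      (isClosed_eq (by fun_prop) (by fun_prop)) ?_
    intro a
    rw [hW', hnorm]
  · intro a b hab hab' v
    -- The relation for (a, b) moves a through S and the one for the adjoints moves it through S*;
    -- so a commutes with S*S and hence with its square root.
    have hc : Commute D a := by
      ext v
      refine ext_inner_left ℂ fun w => ?_
      simp only [mul_apply_eq_comp, hD, ContinuousLinearMap.comp_apply]
      rw [ContinuousLinearMap.adjoint_inner_right, hab]
      have : inner ℂ w (a (ContinuousLinearMap.adjoint S (S v))) =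
          inner ℂ (star a w) (ContinuousLinearMap.adjoint S (S v)) := by
        rw [ContinuousLinearMap.star_eq_adjoint, ContinuousLinearMap.adjoint_inner_left]
      rw [this, ContinuousLinearMap.adjoint_inner_right, hab', ContinuousLinearMap.star_eq_adjoint,
        ContinuousLinearMap.adjoint_inner_left]
    have hPa : Commute P a := hc.cfcₙ_nnreal NNReal.sqrt
    refine hdense.induction_on (p := fun v => W (a v) = b (W v)) v
      (isClosed_eq (by fun_prop) (by fun_prop)) ?_
    intro v
    have : a (P v) = P (a v) := by
      rw [← mul_apply_eq_comp, ← mul_apply_eq_comp, hPa.eq]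
    rw [this, hW', hab, hW']

end OperatorAlgebras

/-! ### Trace preserving bimodule maps onto a subalgebra. -/

section OperatorAlgebras

variable {K : Type*} [NormedAddCommGroup K] [InnerProductSpace ℂ K] [CompleteSpace K]

/-- The orthogonal projection onto the closure of `A Ω`. -/
theorem VonNeumannAlgebra.exists_cyclicProjection (A : VonNeumannAlgebra K) (Ω : K) :
    ∃ e : K →L[ℂ] K, star e = e ∧ e * e = e ∧ (∀ a ∈ A, e * a = a * e) ∧ (∀ a ∈ A, e (a Ω) = a Ω) ∧
      ∀ v, (∀ a ∈ A, inner ℂ (a Ω) v = 0) → e v = 0 := by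
  set U : Submodule ℂ K := (A.toStarSubalgebra.toSubalgebra.toSubmodule.map
    ((ContinuousLinearMap.apply ℂ K Ω : (K →L[ℂ] K) →L[ℂ] K) : (K →L[ℂ] K) →ₗ[ℂ] K)).topologicalClosure
    with hU
  have hmem : ∀ a ∈ A, a Ω ∈ U := fun a ha =>
    Submodule.le_topologicalClosure _ ⟨a, ha, rfl⟩
  have : CompleteSpace U := (Submodule.isClosed_topologicalClosure _).completeSpace_coe
  have horth : ∀ v, (∀ a ∈ A, inner ℂ (a Ω) v = 0) → v ∈ Uᗮ := by
    intro v hv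
    rw [hU, Submodule.orthogonal_closure, Submodule.mem_orthogonal]
    rintro _ ⟨a, ha, rfl⟩
    exact hv a ha
  have hinv : ∀ a ∈ A, ∀ v ∈ U, a v ∈ U := by
    intro a ha v hv
    have h1 : Set.MapsTo a (A.toStarSubalgebra.toSubalgebra.toSubmodule.map
      ((ContinuousLinearMap.apply ℂ K Ω : (K →L[ℂ] K) →L[ℂ] K) : (K →L[ℂ] K) →ₗ[ℂ] K) : Set K)
      (A.toStarSubalgebra.toSubalgebra.toSubmodule.map
      ((ContinuousLinearMap.apply ℂ K Ω : (K →L[ℂ] K) →L[ℂ] K) : (K →L[ℂ] K) →ₗ[ℂ] K) : Set K) := by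
      rintro _ ⟨b, hb, rfl⟩
      exact ⟨a * b, A.toStarSubalgebra.mul_mem ha hb, rfl⟩
    exact h1.closure a.continuous hv
  have hinvo : ∀ a ∈ A, ∀ v ∈ Uᗮ, a v ∈ Uᗮ := by
    intro a ha v hv
    rw [Submodule.mem_orthogonal] at hv ⊢
    intro u hu
    rw [← inner_star_apply]
    exact hv _ (hinv _ (star_mem ha) u hu)
  refine ⟨U.starProjection, ?_, ?_, ?_, ?_, ?_⟩
  · exact isSelfAdjoint_starProjection U
  · exact U.isIdempotentElem_starProjection
  · intro a ha
    ext v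
    have h1 : v = U.starProjection v + (v - U.starProjection v) := by abel
    have h2 : v - U.starProjection v ∈ Uᗮ := Submodule.sub_starProjection_mem_orthogonal v
    have h3 : U.starProjection v ∈ U := Submodule.starProjection_apply_mem U v
    simp only [mul_apply_eq_comp]
    conv_lhs => rw [h1, map_add, map_add,
      Submodule.starProjection_eq_self_iff.2 (hinv a ha _ h3),
      (Submodule.starProjection_apply_eq_zero_iff U).2 (hinvo a ha _ h2), add_zero]
  · intro a ha
    exact Submodule.starProjection_eq_self_iff.2 (hmem a ha)
  · intro v hv
    exact (Submodule.starProjection_apply_eq_zero_iff U).2 (horth v hv)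

/-- `τ(x) = ⟪Ω, x Ω⟫` is a trace on `M`. -/
def IsTracialVector (M : VonNeumannAlgebra K) (Ω : K) : Prop :=
  ∀ x ∈ M, ∀ y ∈ M, inner ℂ Ω ((x * y) Ω) = inner ℂ Ω ((y * x) Ω)

theorem IsTracialVector.inner_eq {M : VonNeumannAlgebra K} {Ω : K} (h : IsTracialVector M Ω)
    {x y : K →L[ℂ] K} (hx : x ∈ M) (hy : y ∈ M) :
    inner ℂ (x Ω) (y Ω) = inner ℂ (star y Ω) (star x Ω) := by
  have := h _ (star_mem hx) _ hy
  rwa [mul_apply_eq_comp, mul_apply_eq_comp, inner_apply_star x Ω, ← inner_star_apply y Ω] at this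

theorem IsTracialVector.norm_star {M : VonNeumannAlgebra K} {Ω : K} (h : IsTracialVector M Ω)
    {x : K →L[ℂ] K} (hx : x ∈ M) : ‖star x Ω‖ = ‖x Ω‖ := by
  have := h.inner_eq hx hx
  rw [inner_self_eq_norm_sq_to_K, inner_self_eq_norm_sq_to_K] at this
  have h2 : ‖x Ω‖ ^ 2 = ‖star x Ω‖ ^ 2 := by exact_mod_cast this
  exact ((sq_eq_sq₀ (norm_nonneg _) (norm_nonneg _)).1 h2).symm

/-- For `t` in the commutant of `A` with `t = e t e`, where `e` is the projection onto the closure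
of `A Ω`, we have `⟪t* Ω, z Ω⟫ = ⟪z* Ω, t Ω⟫` for all `z ∈ M`. -/
theorem IsTracialVector.inner_commutant {A M : VonNeumannAlgebra K} {Ω : K}
    (hM : IsTracialVector M Ω) (hAM : A ≤ M) {e t : K →L[ℂ] K}
    (het : e * t = t) (hte : t * e = t) (hse : star e = e)
    (he0 : ∀ v, (∀ a ∈ A, inner ℂ (a Ω) v = 0) → e v = 0)
    (ht : ∀ a ∈ A, t * a = a * t) {z : K →L[ℂ] K} (hz : z ∈ M) :
    inner ℂ (star t Ω) (z Ω) = inner ℂ (star z Ω) (t Ω) := by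
  set V := A.toStarSubalgebra.toSubalgebra.toSubmodule.map
    ((ContinuousLinearMap.apply ℂ K Ω : (K →L[ℂ] K) →L[ℂ] K) : (K →L[ℂ] K) →ₗ[ℂ] K) with hV
  have hcl : ∀ v, e v = v → v ∈ V.topologicalClosure := by
    intro v hv
    rw [← Submodule.orthogonal_orthogonal_eq_closure, Submodule.mem_orthogonal]
    intro u hu
    rw [Submodule.mem_orthogonal] at hu
    have : e u = 0 := he0 u fun a ha => hu _ ⟨a, ha, rfl⟩
    rw [← hv, ← inner_star_apply, hse, this, inner_zero_left]
  have h1 : t Ω ∈ closure (V : Set K) := hcl _ (by rw [← mul_apply_eq_comp, het])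
  have hest : e * star t = star t := by
    have := congrArg star hte
    rwa [star_mul, hse] at this
  obtain ⟨u, hu, hlim⟩ := mem_closure_iff_seq_limit.1 h1
  choose a ha hau using hu
  have haM : ∀ n, a n ∈ M := fun n => hAM (ha n)
  have hau' : ∀ n, a n Ω = u n := hau
  -- Traciality makes x Ω ↦ x* Ω isometric on M Ω, so convergence of `a n` Ω entails that of the
  -- adjoints.
  have hcau : CauchySeq fun n => star (a n) Ω := by
    have := hlim.cauchySeq
    rw [Metric.cauchySeq_iff] at this ⊢
    intro ε hε
    obtain ⟨N, hN⟩ := this ε hε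
    refine ⟨N, fun m hm n hn => ?_⟩
    have := hN m hm n hn
    rw [dist_eq_norm] at this ⊢
    have h3 : star (a m) Ω - star (a n) Ω = star (a m - a n) Ω := by simp
    rw [h3, hM.norm_star (sub_mem (haM m) (haM n))]
    simpa [hau'] using this
  obtain ⟨η, hη⟩ := cauchySeq_tendsto_of_complete hcau
  have hηe : η ∈ V.topologicalClosure :=
    mem_closure_of_tendsto hη (Filter.Eventually.of_forall fun n =>
      ⟨_, star_mem (S := VonNeumannAlgebra K) (ha n), rfl⟩)
  -- Both vectors lie in the closure of `A` Ω, so it is enough to compare them against b Ω with b ∈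
  -- `A`; there t can be moved past b.
  have hη' : η = star t Ω := by
    have hd : η - star t Ω ∈ V.topologicalClosure :=
      sub_mem hηe (hcl _ (by rw [← mul_apply_eq_comp, hest]))
    have hd2 : η - star t Ω ∈ V.topologicalClosureᗮ := by
      rw [Submodule.orthogonal_closure, Submodule.mem_orthogonal]
      rintro _ ⟨b, hb, rfl⟩
      change inner ℂ (b Ω) _ = 0
      rw [inner_sub_right, sub_eq_zero]
      refine tendsto_nhds_unique ((tendsto_const_nhds (x := b Ω)).inner hη) ?_
      have : inner ℂ (b Ω) (star t Ω) = inner ℂ (t Ω) (star b Ω) := by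
        rw [inner_apply_star, ← mul_apply_eq_comp, ht b hb, mul_apply_eq_comp, inner_apply_star]
      rw [this]
      have h4 : ∀ n, inner ℂ (b Ω) (star (a n) Ω) = inner ℂ (u n) (star b Ω) := by
        intro n
        rw [hM.inner_eq (hAM hb) (star_mem (haM n)), star_star, hau']
      simp_rw [h4]
      exact hlim.inner (tendsto_const_nhds (x := star b Ω))
    have := Submodule.inner_left_of_mem_orthogonal hd hd2
    rw [inner_self_eq_zero] at this
    exact sub_eq_zero.1 this
  rw [← hη']
  refine tendsto_nhds_unique (hη.inner (tendsto_const_nhds (x := z Ω))) ?_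
  have : ∀ n, inner ℂ (star (a n) Ω) (z Ω) = inner ℂ (star z Ω) (u n) := by
    intro n
    rw [← hau', hM.inner_eq (star_mem (haM n)) hz, star_star]
  simp_rw [this]
  exact (tendsto_const_nhds (x := star z Ω)).inner hlim

/-- Compressions by the projection `e` onto the closure of `A Ω`: those of elements of the
commutant of `A` commute with those of elements of `M`. -/
theorem IsTracialVector.commute_compression {A M : VonNeumannAlgebra K} {Ω : K}
    (hM : IsTracialVector M Ω) (hAM : A ≤ M) {e t : K →L[ℂ] K}
    (het : e * t = t) (hte : t * e = t) (hse : star e = e) (hee : e * e = e)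
    (he1 : ∀ a ∈ A, e (a Ω) = a Ω)
    (he0 : ∀ v, (∀ a ∈ A, inner ℂ (a Ω) v = 0) → e v = 0)
    (ht : ∀ a ∈ A, t * a = a * t) {x : K →L[ℂ] K} (hx : x ∈ M) :
    t * (e * x * e) = e * x * e * t := by
  have het' : ∀ v, e (t v) = t v := fun v => by rw [← mul_apply_eq_comp, het]
  have hte' : ∀ v, t (e v) = t v := fun v => by rw [← mul_apply_eq_comp, hte]
  have hta : ∀ a ∈ A, ∀ v, t (a v) = a (t v) := fun a ha v => by
    rw [← mul_apply_eq_comp, ht a ha, mul_apply_eq_comp]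
  have hsta : ∀ a ∈ A, ∀ v, star t (a v) = a (star t v) := fun a ha v => by
    have := congrArg star (ht (star a) (star_mem ha))
    rw [star_mul, star_mul, star_star] at this
    rw [← mul_apply_eq_comp, ← this, mul_apply_eq_comp]
  -- This is `inner_commutant` for z = b* x a, since t and t* both commute with `A`.
  have key : ∀ a ∈ A, ∀ b ∈ A, inner ℂ (b Ω) (t (x (a Ω))) = inner ℂ (b Ω) (x (t (a Ω))) := by
    intro a ha b hb
    have h1 := hM.inner_commutant hAM het hte hse he0 ht
      (mul_mem (mul_mem (star_mem (hAM hb)) hx) (hAM ha))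
    rw [mul_apply_eq_comp, mul_apply_eq_comp, inner_apply_star, inner_star_apply,
      mul_apply_eq_comp, mul_apply_eq_comp, inner_apply_star, ← hsta b hb, inner_star_apply] at h1
    rw [h1, hta a ha]
  have h2 : ∀ a ∈ A, e (t (x (a Ω))) = e (x (t (a Ω))) := by
    intro a ha
    rw [← sub_eq_zero, ← map_sub]
    refine he0 _ fun b hb => ?_
    rw [inner_sub_right, key a ha b hb, sub_self]
  have h3 : ∀ v, e (star (t * (e * x * e) - e * x * e * t) v) = 0 := by
    intro v
    refine he0 _ fun a ha => ?_
    rw [inner_apply_star]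
    simp only [mul_apply_eq_comp, sub_apply, he1 a ha, hte', het']
    rw [← het', h2 a ha, sub_self, inner_zero_left]
  have h4 : e * star (t * (e * x * e) - e * x * e * t) = 0 := by
    ext v; simpa using h3 v
  have h5 := congrArg star h4
  rw [star_mul, star_star, hse, star_zero, sub_mul] at h5
  rw [← sub_eq_zero, ← h5]
  simp only [mul_assoc, hee, hte]

/-- The completely positive map `T ↦ W* (T ⊗ 1) W`. -/
noncomputable def amplifiedCompression (W : K →L[ℂ] lp (fun _ : ℕ => K) 2) :
    (K →L[ℂ] K) →ₗ[ℂ] (K →L[ℂ] K) where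
  toFun T := (ContinuousLinearMap.adjoint W).comp ((ell2Const ℕ T).comp W)
  map_add' S T := by ext v; simp [ell2Const_add]
  map_smul' c T := by ext v; simp [ell2Const_smul]

theorem amplifiedCompression_apply (W : K →L[ℂ] lp (fun _ : ℕ => K) 2) (T : K →L[ℂ] K) (v : K) :
    amplifiedCompression W T v = ContinuousLinearMap.adjoint W (ell2Const ℕ T (W v)) := rfl

/-- A conditional expectation of `B(K)` onto `A` is not available in general; but there is a
unital completely positive `A`-bimodular map of `B(K)` which maps `M` into `A` and preserves the
trace `⟪Ω, · Ω⟫` on `M`. -/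
theorem exists_bimodule_map (A M : VonNeumannAlgebra K) (hAM : A ≤ M) (Ω : K)
    (hM : IsTracialVector M Ω) (s : ℕ → K →L[ℂ] K) (hs : ∀ i, s i ∈ M.commutant)
    (htot : ∀ ξ, (∀ i, inner ℂ (s i Ω) ξ = 0) → ξ = 0) :
    ∃ Ψ : (K →L[ℂ] K) →ₗ[ℂ] (K →L[ℂ] K),
      (∀ T, 0 ≤ Ψ (star T * T)) ∧ Ψ 1 = 1 ∧
      (∀ a ∈ A, ∀ T, Ψ (a * T) = a * Ψ T ∧ Ψ (T * a) = Ψ T * a) ∧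
      ∀ x ∈ M, Ψ x ∈ A ∧ ∀ b ∈ A, inner ℂ (b Ω) (Ψ x Ω) = inner ℂ (b Ω) (x Ω) := by
  obtain ⟨e, hse, hee, hea, he1, he0⟩ := A.exists_cyclicProjection Ω
  have hsA : ∀ i, ∀ a ∈ A, s i * a = a * s i := fun i a ha =>
    ((VonNeumannAlgebra.mem_commutant_iff.1 (hs i)) a (hAM ha)).symm
  have hssA : ∀ i, ∀ a ∈ A, star (s i) * a = a * star (s i) := fun i a ha =>
    ((VonNeumannAlgebra.mem_commutant_iff.1 (star_mem (hs i))) a (hAM ha)).symm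
  -- Nonzero weights make the column of the e sᵢ* bounded without changing its kernel. That kernel
  -- is trivial: e sᵢ* v = 0 and e Ω = Ω give ⟪sᵢ Ω, v⟫ = 0, and the sᵢ Ω are total.
  let c : ℕ → ℂ := fun i => (((1 / 2) ^ i / (‖e * star (s i)‖ + 1) : ℝ) : ℂ)
  have hc : ∀ i, c i ≠ 0 := fun i => by
    simp only [c]; norm_cast; positivity
  let T : ℕ → K →L[ℂ] K := fun i => c i • (e * star (s i))
  have hT : ∀ i, ‖T i‖ ≤ (1 / 2) ^ i := by
    intro i
    simp only [T, c, norm_smul, Complex.norm_real, Real.norm_eq_abs]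
    rw [abs_of_nonneg (by positivity), div_mul_eq_mul_div, div_le_iff₀ (by positivity)]
    gcongr
    linarith
  set S := columnOperator T hT with hS
  have hTA : ∀ a ∈ A, ∀ i v, T i (a v) = a (T i v) := by
    intro a ha i v
    have : T i * a = a * T i := by
      simp only [T, smul_mul_assoc, mul_smul_comm, mul_assoc, hssA i a ha]
      rw [← mul_assoc, hea a ha, mul_assoc]
    rw [← mul_apply_eq_comp, this, mul_apply_eq_comp]
  have heT : ∀ i v, e (T i v) = T i v := by
    intro i v
    have : e * T i = T i := by simp only [T, mul_smul_comm, ← mul_assoc, hee]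
    rw [← mul_apply_eq_comp, this]
  have hinj : Function.Injective S := by
    rw [injective_iff_map_eq_zero]
    intro v hv
    refine htot v fun i => ?_
    have h1 : T i v = 0 := by
      have := congrArg (fun ξ : lp (fun _ : ℕ => K) 2 => ξ i) hv
      simpa [hS] using this
    have h2 : e (star (s i) v) = 0 := by
      simpa [T, hc i] using h1
    have h3 : e Ω = Ω := by simpa using he1 1 (one_mem A)
    calc inner ℂ (s i Ω) v = inner ℂ Ω (star (s i) v) := (inner_apply_star _ _ _).symm
      _ = inner ℂ (e Ω) (star (s i) v) := by rw [h3]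
      _ = 0 := by rw [← hse, inner_star_apply, h2, inner_zero_right]
  obtain ⟨W, P, hP, hWP, hWn, hW⟩ := exists_isometry_polar S hinj
  have hWA : ∀ a ∈ A, ∀ v, W (a v) = ell2Const ℕ a (W v) := by
    intro a ha
    refine hW a (ell2Const ℕ a) ?_ ?_
    · intro v; ext i; simp [hS, hTA a ha]
    · intro v; ext i; simp [hS, star_ell2Const, hTA _ (star_mem ha)]
  have heW : ∀ v, ell2Const ℕ e (W v) = W v := by
    intro v
    refine hP.induction_on (p := fun v => ell2Const ℕ e (W v) = W v) v
      (isClosed_eq (by fun_prop) (by fun_prop)) ?_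
    intro v
    rw [hWP]; ext i; simp [hS, heT]
  have hWW : ∀ v, ContinuousLinearMap.adjoint W (W v) = v := by
    have := (ContinuousLinearMap.norm_map_iff_adjoint_comp_self W).1 hWn
    intro v
    rw [← ContinuousLinearMap.comp_apply, this]; rfl
  have hWadj : ∀ a ∈ A, ∀ ζ, ContinuousLinearMap.adjoint W (ell2Const ℕ a ζ) =
      a (ContinuousLinearMap.adjoint W ζ) := by
    intro a ha ζ
    refine ext_inner_left ℂ fun v => ?_
    rw [ContinuousLinearMap.adjoint_inner_right, ← inner_star_apply a,
      ContinuousLinearMap.adjoint_inner_right, hWA _ (star_mem ha), ← star_ell2Const,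
      inner_star_apply]
  -- The coordinates of W t e commute with `A` and are fixed by e on both sides, so
  -- `commute_compression` moves e x e through each of them; W*W = 1 then removes W. For t = 1 this
  -- says Ψ(x) e = e x e.
  have hmain : ∀ x ∈ M, ∀ t : K →L[ℂ] K, (∀ a ∈ A, t * a = a * t) →
      amplifiedCompression W x * t * e = t * (e * x * e) := by
    intro x hx t ht
    have hadj : ∀ ζ, ContinuousLinearMap.adjoint W ζ =
        ContinuousLinearMap.adjoint W (ell2Const ℕ e ζ) := by
      intro ζ
      refine ext_inner_left ℂ fun v => ?_
      rw [ContinuousLinearMap.adjoint_inner_right, ContinuousLinearMap.adjoint_inner_right,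
        ← inner_star_apply (ell2Const ℕ e), star_ell2Const, hse, heW]
    let u : ℕ → K →L[ℂ] K := fun i => (lp.evalCLM ℂ (fun _ : ℕ => K) 2 i).comp (W.comp (t * e))
    have hu : ∀ i v, u i v = W (t (e v)) i := fun _ _ => rfl
    have heu : ∀ i, e * u i = u i := fun i => by
      ext v
      have := congrArg (fun ξ : lp (fun _ : ℕ => K) 2 => ξ i) (heW (t (e v)))
      simpa [hu] using this
    have hue : ∀ i, u i * e = u i := fun i => by
      ext v
      rw [mul_apply_eq_comp, hu, hu, ← mul_apply_eq_comp e, hee]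
    have huA : ∀ i, ∀ a ∈ A, u i * a = a * u i := fun i a ha => by
      ext v
      simp only [mul_apply_eq_comp, hu]
      rw [← mul_apply_eq_comp e, hea a ha, mul_apply_eq_comp, ← mul_apply_eq_comp t, ht a ha,
        mul_apply_eq_comp, hWA a ha, ell2Const_apply]
    ext v
    simp only [mul_apply_eq_comp, amplifiedCompression_apply]
    rw [hadj, ← hWW (t (e (x (e v))))]
    congr 1
    ext i
    have h1 := congrArg (fun f : K →L[ℂ] K => f v)
      (hM.commute_compression hAM (heu i) (hue i) hse hee he1 he0 (huA i) hx)
    simp only [mul_apply_eq_comp, hu] at h1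
    have h2 := congrArg (fun ξ : lp (fun _ : ℕ => K) 2 => ξ i) (heW (t (e v)))
    simp only [ell2Const_apply] at h2 ⊢
    rw [h2, ← mul_apply_eq_comp e, hee] at h1
    exact h1.symm
  refine ⟨amplifiedCompression W, ?_, ?_, ?_, ?_⟩
  · intro T
    rw [ContinuousLinearMap.nonneg_iff_isPositive]
    have : amplifiedCompression W (star T * T) =
        (ContinuousLinearMap.adjoint ((ell2Const ℕ T).comp W)).comp ((ell2Const ℕ T).comp W) := by
      ext v
      rw [amplifiedCompression_apply, ell2Const_mul, ← star_ell2Const, mul_apply_eq_comp,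
        ContinuousLinearMap.star_eq_adjoint, ContinuousLinearMap.adjoint_comp]
      rfl
    rw [this]
    exact ContinuousLinearMap.isPositive_adjoint_comp_self _
  · ext v
    simp [amplifiedCompression_apply, hWW]
  · intro a ha T
    constructor
    · ext v
      simp [amplifiedCompression_apply, ell2Const_mul, hWadj a ha]
    · ext v
      simp [amplifiedCompression_apply, ell2Const_mul, hWA a ha]
  · intro x hx
    have h1 : amplifiedCompression W x * e = e * x * e := by
      simpa using hmain x hx 1 (by simp)
    refine ⟨?_, ?_⟩
    · rw [← A.commutant_commutant, VonNeumannAlgebra.mem_commutant_iff]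
      intro t ht
      rw [VonNeumannAlgebra.mem_commutant_iff] at ht
      -- By `hmain` for sᵢ and for t sᵢ, both sides are t sᵢ (e x e) applied to Ω. Agreement on the
      -- total vectors sᵢ Ω shows that Ψ(x) commutes with the commutant of `A`, so the bicommutant
      -- theorem puts it in `A`.
      have h2 : ∀ i, (t * amplifiedCompression W x) (s i Ω) =
          (amplifiedCompression W x * t) (s i Ω) := by
        intro i
        have h3 := hmain x hx (s i) (hsA i)
        have h4 := hmain x hx (t * s i) (fun a ha => by
          rw [mul_assoc, hsA i a ha, ← mul_assoc, ← ht a ha, mul_assoc])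
        have h5 : t * amplifiedCompression W x * s i * e =
              amplifiedCompression W x * t * s i * e := by
          rw [mul_assoc, mul_assoc, ← mul_assoc _ (s i), h3, mul_assoc _ t, h4, mul_assoc t]
        have h6 : e Ω = Ω := by simpa using he1 1 (one_mem A)
        have h7 := congrArg (fun f : K →L[ℂ] K => f Ω) h5
        simpa [h6] using h7
      have h8 : star (t * amplifiedCompression W x - amplifiedCompression W x * t) = 0 := by
        ext v
        refine htot _ fun i => ?_
        rw [inner_apply_star, sub_apply, h2 i, sub_self, inner_zero_left]
      rwa [star_eq_zero, sub_eq_zero] at h8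
    · intro b hb
      have h6 : e Ω = Ω := by simpa using he1 1 (one_mem A)
      have h7 := congrArg (fun f : K →L[ℂ] K => f Ω) h1
      simp only [mul_apply_eq_comp, h6] at h7
      rw [h7, ← inner_star_apply, hse, he1 b hb]

end OperatorAlgebras

/-! ### Generated von Neumann algebras and a criterion for traces. -/

section OperatorAlgebras

variable {K : Type*} [NormedAddCommGroup K] [InnerProductSpace ℂ K] [CompleteSpace K]

/-- For a set closed under adjoints, commuting with the adjoints is automatic, and only plain
commutation remains in the bicommutant. -/
theorem mem_vonNeumannGenerated_iff {S : Set (K →L[ℂ] K)} (hS : ∀ s ∈ S, star s ∈ S)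
    {x : K →L[ℂ] K} :
    x ∈ vonNeumannGenerated S ↔ ∀ t : K →L[ℂ] K, (∀ s ∈ S, s * t = t * s) → t * x = x * t := by
  have h1 : ∀ t : K →L[ℂ] K, (∀ s ∈ S, s * t = t * s) → ∀ s ∈ S, s * star t = star t * s := by
    intro t ht s hs
    have := congrArg star (ht _ (hS s hs))
    rw [star_mul, star_mul, star_star] at this
    exact this.symm
  have h2 : ∀ t : K →L[ℂ] K, t ∈ StarSubalgebra.centralizer ℂ S ↔ ∀ s ∈ S, s * t = t * s := by
    intro t
    rw [StarSubalgebra.mem_centralizer_iff]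
    exact ⟨fun h s hs => (h s hs).1, fun h s hs => ⟨h s hs, h _ (hS s hs)⟩⟩
  change x ∈ StarSubalgebra.centralizer ℂ (StarSubalgebra.centralizer ℂ S : Set (K →L[ℂ] K)) ↔ _
  rw [StarSubalgebra.mem_centralizer_iff]
  exact ⟨fun h t ht => (h t ((h2 t).2 ht)).1, fun h t ht =>
    ⟨h t ((h2 t).1 ht), h _ (h1 t ((h2 t).1 ht))⟩⟩

theorem subset_vonNeumannGenerated {S : Set (K →L[ℂ] K)} (hS : ∀ s ∈ S, star s ∈ S)
    {x : K →L[ℂ] K} (hx : x ∈ S) : x ∈ vonNeumannGenerated S :=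
  (mem_vonNeumannGenerated_iff hS).2 fun _ ht => (ht x hx).symm

theorem vonNeumannGenerated_mono {S T : Set (K →L[ℂ] K)} (hS : ∀ s ∈ S, star s ∈ S)
    (hT : ∀ s ∈ T, star s ∈ T) (h : S ⊆ T) : vonNeumannGenerated S ≤ vonNeumannGenerated T :=
  fun _ hx => (mem_vonNeumannGenerated_iff hT).2 fun t ht =>
    (mem_vonNeumannGenerated_iff hS).1 hx t fun s hs => ht s (h hs)

/-- To check that `⟪Ω, · Ω⟫` is a trace it is enough to look at a set of elements which maps `Ω`
to a total set. -/
theorem isTracialVector_of_total {M : VonNeumannAlgebra K} {Ω : K} {G : Set (K →L[ℂ] K)}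
    (hG : ∀ y ∈ G, y ∈ M)
    (htr : ∀ x ∈ M, ∀ y ∈ G, inner ℂ Ω ((x * y) Ω) = inner ℂ Ω ((y * x) Ω))
    (htot : ∀ ξ, (∀ y ∈ G, inner ℂ (y Ω) ξ = 0) → ξ = 0) : IsTracialVector M Ω := by
  set V := (Submodule.span ℂ G).map
    ((ContinuousLinearMap.apply ℂ K Ω : (K →L[ℂ] K) →L[ℂ] K) : (K →L[ℂ] K) →ₗ[ℂ] K) with hV
  have hVd : Dense (V : Set K) := by
    rw [Submodule.dense_iff_topologicalClosure_eq_top, Submodule.topologicalClosure_eq_top_iff,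
      Submodule.eq_bot_iff]
    intro v hv
    rw [Submodule.mem_orthogonal] at hv
    exact htot v fun y hy => hv _ ⟨y, Submodule.subset_span hy, rfl⟩
  have hspan : ∀ y ∈ Submodule.span ℂ G, y ∈ M ∧
      ∀ x ∈ M, inner ℂ Ω ((x * y) Ω) = inner ℂ Ω ((y * x) Ω) := by
    intro y hy
    refine Submodule.span_induction (p := fun y _ => y ∈ M ∧
      ∀ x ∈ M, inner ℂ Ω ((x * y) Ω) = inner ℂ Ω ((y * x) Ω)) ?_ ?_ ?_ ?_ hy
    · exact fun y hy => ⟨hG y hy, fun x hx => htr x hx y hy⟩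
    · exact ⟨zero_mem _, by simp⟩
    · rintro y z - - ⟨hy, hy'⟩ ⟨hz, hz'⟩
      refine ⟨add_mem hy hz, fun x hx => ?_⟩
      rw [mul_add, add_mul, add_apply, add_apply, inner_add_right, inner_add_right, hy' x hx,
        hz' x hx]
    · rintro c y - ⟨hy, hy'⟩
      refine ⟨M.toStarSubalgebra.smul_mem hy c, fun x hx => ?_⟩
      rw [mul_smul_comm, smul_mul_assoc, smul_apply, smul_apply, inner_smul_right,
        inner_smul_right, hy' x hx]
  -- The norm of w* Ω is computed by duality against the dense vectors y Ω with y in the span of G.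
  -- This avoids norm-bounded approximation of w itself. Applied to w and w*, it gives equality.
  have hle : ∀ w ∈ M, ‖star w Ω‖ ≤ ‖w Ω‖ := by
    intro w hw
    have h1 : ∀ v : K, ‖(inner ℂ v (star w Ω) : ℂ)‖ ≤ ‖w Ω‖ * ‖v‖ := by
      intro v
      refine hVd.induction (P := fun v => ‖(inner ℂ v (star w Ω) : ℂ)‖ ≤ ‖w Ω‖ * ‖v‖) ?_
        (isClosed_le (by fun_prop) (by fun_prop)) v
      rintro _ ⟨y, hy, rfl⟩
      change ‖(inner ℂ (y Ω) (star w Ω) : ℂ)‖ ≤ ‖w Ω‖ * ‖y Ω‖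
      obtain ⟨hyM, hyt⟩ := hspan y hy
      have h2 : ‖star y Ω‖ = ‖y Ω‖ := by
        have := hyt _ (star_mem hyM)
        rw [mul_apply_eq_comp, mul_apply_eq_comp, inner_apply_star, ← inner_star_apply y Ω,
          inner_self_eq_norm_sq_to_K, inner_self_eq_norm_sq_to_K] at this
        have h3 : ‖y Ω‖ ^ 2 = ‖star y Ω‖ ^ 2 := by exact_mod_cast this
        exact ((sq_eq_sq₀ (norm_nonneg _) (norm_nonneg _)).1 h3).symm
      have h4 : (inner ℂ (y Ω) (star w Ω) : ℂ) = inner ℂ (w Ω) (star y Ω) := by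
        rw [inner_apply_star, inner_apply_star, ← inner_conj_symm, ← inner_conj_symm (y (w Ω))]
        exact congrArg _ (hyt w hw)
      rw [h4, ← h2]
      exact norm_inner_le_norm _ _
    have h2 := h1 (star w Ω)
    rw [inner_self_eq_norm_sq_to_K] at h2
    have h3 : ‖star w Ω‖ ^ 2 ≤ ‖w Ω‖ * ‖star w Ω‖ := by
      have : ‖((‖star w Ω‖ : ℂ)) ^ 2‖ = ‖star w Ω‖ ^ 2 := by simp
      rw [← this]; exact h2
    by_contra hcon
    push Not at hcon
    nlinarith [norm_nonneg (w Ω)]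
  have hself : ∀ w ∈ M, (inner ℂ Ω ((star w * w) Ω) : ℂ) = inner ℂ Ω ((w * star w) Ω) := by
    intro w hw
    have h1 : ‖w Ω‖ = ‖star w Ω‖ :=
      le_antisymm (by simpa using hle _ (star_mem hw)) (hle w hw)
    rw [mul_apply_eq_comp, mul_apply_eq_comp, inner_apply_star, ← inner_star_apply w Ω,
      inner_self_eq_norm_sq_to_K, inner_self_eq_norm_sq_to_K, h1]
  intro x hx z hz
  -- Polarisation: the trace identity for w*w and ww* is used at z + x* and z + i x*.
  have e1 := hself (z + star x) (add_mem hz (star_mem hx))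
  have e2 := hself (z + Complex.I • star x)
    (add_mem hz (M.toStarSubalgebra.smul_mem (star_mem hx) _))
  have e3 := hself z hz
  have e4 := hself (star x) (star_mem hx)
  simp only [star_add, star_star, star_smul, Complex.star_def, Complex.conj_I, mul_add, add_mul,
    mul_smul_comm, smul_mul_assoc, add_apply, smul_apply, inner_add_right, inner_smul_right]
    at e1 e2 e3 e4
  have hI : Complex.I * Complex.I = -1 := Complex.I_mul_I
  have hI0 : Complex.I ≠ 0 := Complex.I_ne_zero
  have e5 : Complex.I * (inner ℂ Ω ((star z * star x) Ω) - inner ℂ Ω ((star x * star z) Ω)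
      - inner ℂ Ω ((x * z) Ω) + inner ℂ Ω ((z * x) Ω)) = 0 := by
    linear_combination e2 - e3 + (Complex.I * Complex.I) * e4
  have e6 := (mul_eq_zero.1 e5).resolve_left hI0
  linear_combination (e1 - e3 - e4 - e6) / 2

end OperatorAlgebras

/-! ### Translations on ℓ²(Γ, H). -/

section CrossedProduct

variable {Γ H : Type*} [NormedAddCommGroup H] [InnerProductSpace ℂ H]

open Classical in
/-- The vector `δ_g ⊗ v`. -/
noncomputable def ell2Single (g : Γ) (v : H) : lp (fun _ : Γ => H) 2 := lp.single 2 g v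

open Classical in
theorem ell2Single_apply (g k : Γ) (v : H) : ell2Single g v k = if k = g then v else 0 := by
  simp only [ell2Single, lp.single_apply, Pi.single_apply]

@[simp] theorem ell2Single_apply_self (g : Γ) (v : H) : ell2Single g v g = v := by
  simp [ell2Single_apply]

theorem inner_ell2Single_left (g : Γ) (v : H) (ξ : lp (fun _ : Γ => H) 2) :
    inner ℂ (ell2Single g v) ξ = inner ℂ v (ξ g) := by
  classical exact lp.inner_single_left (𝕜 := ℂ) (G := fun _ : Γ => H) g v ξ

@[simp] theorem ell2Const_single (T : H →L[ℂ] H) (g : Γ) (v : H) :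
    ell2Const Γ T (ell2Single g v) = ell2Single g (T v) := by
  ext k
  rw [ell2Const_apply, ell2Single_apply, ell2Single_apply]
  split_ifs <;> simp

variable [Group Γ]

theorem ell2Unit_eq [CompleteSpace H] (Ω : H) : ell2Unit Γ Ω = ell2Single 1 Ω := rfl

/-- Right translation `(R_h ξ)(g) = ξ (g h)` on `ℓ²(Γ, H)`. -/
noncomputable def ell2RightTranslation (H : Type*) [NormedAddCommGroup H] [InnerProductSpace ℂ H]
    (h : Γ) : lp (fun _ : Γ => H) 2 →L[ℂ] lp (fun _ : Γ => H) 2 :=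
  LinearMap.mkContinuous
    { toFun := fun ξ => ⟨fun g => ξ (g * h), memℓp_two_of_summable_sq
        ((Equiv.mulRight h).summable_iff (f := fun g => ‖ξ g‖ ^ 2) |>.2
          (summable_norm_sq_ell2 ξ))⟩
      map_add' := fun ξ η => by ext g; simp; rfl
      map_smul' := fun c ξ => by ext g; simp }
    1 (fun ξ => by
      rw [one_mul]
      refine abs_le_of_sq_le_sq' ?_ (by positivity) |>.2
      rw [norm_sq_ell2, norm_sq_ell2]
      exact ((Equiv.mulRight h).tsum_eq (fun g => ‖ξ g‖ ^ 2)).le)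

@[simp] theorem ell2RightTranslation_apply (h : Γ) (ξ : lp (fun _ : Γ => H) 2) (g : Γ) :
    ell2RightTranslation H h ξ g = ξ (g * h) := rfl

@[simp] theorem ell2RightTranslation_single (h g : Γ) (v : H) :
    ell2RightTranslation H h (ell2Single g v) = ell2Single (g * h⁻¹) v := by
  ext k
  rw [ell2RightTranslation_apply, ell2Single_apply, ell2Single_apply]
  have := eq_mul_inv_iff_mul_eq (a := k) (b := g) (c := h)
  split_ifs <;> tauto

variable [CompleteSpace H]

@[simp] theorem ell2Translation_apply (h : Γ) (ξ : lp (fun _ : Γ => H) 2) (g : Γ) :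
    ell2Translation H h ξ g = ξ (h⁻¹ * g) := rfl

@[simp] theorem ell2Translation_single (h g : Γ) (v : H) :
    ell2Translation H h (ell2Single g v) = ell2Single (h * g) v := by
  ext k
  rw [ell2Translation_apply, ell2Single_apply, ell2Single_apply]
  have := inv_mul_eq_iff_eq_mul (a := h) (b := k) (c := g)
  split_ifs <;> tauto

theorem ell2Translation_mul (g h : Γ) :
    ell2Translation H (g * h) = ell2Translation H g * ell2Translation H h := by
  ext ξ k; simp [mul_assoc]

@[simp] theorem ell2Translation_one : ell2Translation H (1 : Γ) = 1 := by
  ext ξ k; simp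

theorem star_ell2Translation (h : Γ) : star (ell2Translation H h) = ell2Translation H h⁻¹ := by
  ext1 ξ
  refine ext_inner_right ℂ fun η => ?_
  rw [inner_star_apply, lp.inner_eq_tsum, lp.inner_eq_tsum,
    ← (Equiv.mulLeft h).tsum_eq (fun g => inner ℂ (ξ g) (ell2Translation H h η g))]
  simp

theorem inner_ell2RightTranslation (h : Γ) (ξ η : lp (fun _ : Γ => H) 2) :
    inner ℂ (ell2RightTranslation H h ξ) η = inner ℂ ξ (ell2RightTranslation H h⁻¹ η) := by
  rw [lp.inner_eq_tsum, lp.inner_eq_tsum,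
    ← (Equiv.mulRight h).tsum_eq (fun g => inner ℂ (ξ g) (ell2RightTranslation H h⁻¹ η g))]
  simp

theorem star_ell2RightTranslation (h : Γ) :
    star (ell2RightTranslation H h) = ell2RightTranslation H h⁻¹ := by
  ext1 ξ
  refine ext_inner_right ℂ fun η => ?_
  rw [inner_star_apply, inner_ell2RightTranslation, inv_inv]

end CrossedProduct

/-! ### The trace and the commutant of the crossed product. -/

section CrossedProduct

variable {Γ H : Type*} [NormedAddCommGroup H] [InnerProductSpace ℂ H] [CompleteSpace H] [Group Γ]
  {Q : VonNeumannAlgebra H} {Ω : H}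

namespace IsTracialStandardForm

theorem isTracialVector (hQ : IsTracialStandardForm Q Ω) : IsTracialVector Q Ω := hQ.trace

/-- The linear map `x ↦ x Ω`. -/
noncomputable def _root_.VonNeumannAlgebra.orbitMap (Q : VonNeumannAlgebra H) (Ω : H) :
    Q.toStarSubalgebra →ₗ[ℂ] H where
  toFun x := (x : H →L[ℂ] H) Ω
  map_add' x y := by simp
  map_smul' c x := by simp

@[simp] theorem _root_.VonNeumannAlgebra.orbitMap_apply (x : Q.toStarSubalgebra) :
    Q.orbitMap Ω x = (x : H →L[ℂ] H) Ω := rfl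

theorem denseRange (hQ : IsTracialStandardForm Q Ω) : DenseRange (Q.orbitMap Ω) := by
  refine hQ.cyclic.mono ?_
  rintro _ ⟨x, hx, rfl⟩
  exact ⟨⟨x, hx⟩, rfl⟩

theorem ext_of_apply (hQ : IsTracialStandardForm Q Ω) {E : Type*} [TopologicalSpace E] [T2Space E]
    {f g : H → E} (hf : Continuous f) (hg : Continuous g)
    (h : ∀ x ∈ Q, f (x Ω) = g (x Ω)) (v : H) : f v = g v :=
  hQ.denseRange.induction_on (p := fun v => f v = g v) v (isClosed_eq hf hg) fun x => h x x.2

theorem eq_zero_of_inner (hQ : IsTracialStandardForm Q Ω) {v : H}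
    (h : ∀ x ∈ Q, inner ℂ (x Ω) v = 0) : v = 0 := by
  have := hQ.ext_of_apply (f := fun w => (inner ℂ w v : ℂ)) (g := fun _ => 0) (by fun_prop)
    (by fun_prop) h v
  exact inner_self_eq_zero.1 this

/-- Right multiplication by an element of `Q`. -/
theorem exists_right_mul (hQ : IsTracialStandardForm Q Ω) {p : H →L[ℂ] H} (hp : p ∈ Q) :
    ∃ t ∈ Q.commutant, t Ω = p Ω ∧ star t Ω = star p Ω := by
  have key : ∀ p ∈ Q, ∃ t : H →L[ℂ] H, ∀ x ∈ Q, t (x Ω) = x (p Ω) := by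
    intro p hp
    -- Right multiplication is bounded because adjoints turn it into left multiplication: ‖x p Ω‖ =
    -- ‖p* x* Ω‖ ≤ ‖p*‖ ‖x* Ω‖ = ‖p*‖ ‖x Ω‖.
    obtain ⟨t, ht⟩ := exists_extension_of_bound (Q.orbitMap Ω)
      ((Q.orbitMap (p Ω))) hQ.denseRange ‖star p‖ (fun x => by
        have h1 : ‖(star (x * p) : H →L[ℂ] H) Ω‖ = ‖((x : H →L[ℂ] H) * p) Ω‖ :=
          hQ.isTracialVector.norm_star (mul_mem x.2 hp)
        have h2 : ‖star (x : H →L[ℂ] H) Ω‖ = ‖(x : H →L[ℂ] H) Ω‖ :=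
          hQ.isTracialVector.norm_star x.2
        simp only [VonNeumannAlgebra.orbitMap_apply]
        rw [← mul_apply_eq_comp, ← h1, ← h2, star_mul, mul_apply_eq_comp]
        exact ContinuousLinearMap.le_opNorm _ _)
    exact ⟨t, fun x hx => ht ⟨x, hx⟩⟩
  obtain ⟨t, ht⟩ := key p hp
  obtain ⟨u, hu⟩ := key (star p) (star_mem hp)
  have htΩ : t Ω = p Ω := by simpa using ht 1 (one_mem Q)
  have huΩ : u Ω = star p Ω := by simpa using hu 1 (one_mem Q)
  have hut : star t = u := by
    ext v
    refine hQ.ext_of_apply (f := (star t : H →L[ℂ] H)) (g := u) (by fun_prop) (by fun_prop) ?_ v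
    intro x hx
    rw [← sub_eq_zero]
    refine hQ.eq_zero_of_inner fun y hy => ?_
    rw [inner_sub_right, sub_eq_zero, inner_apply_star, ht y hy, hu x hx]
    have := hQ.isTracialVector.inner_eq hp (mul_mem (star_mem hy) hx)
    rwa [mul_apply_eq_comp, star_mul, star_star, mul_apply_eq_comp, inner_star_apply,
      inner_apply_star] at this
  refine ⟨t, ?_, htΩ, by rw [hut, huΩ]⟩
  rw [VonNeumannAlgebra.mem_commutant_iff]
  intro y hy
  ext v
  refine hQ.ext_of_apply (f := y * t) (g := t * y) (by fun_prop) (by fun_prop) ?_ v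
  intro x hx
  have := ht _ (mul_mem hy hx)
  rw [mul_apply_eq_comp, mul_apply_eq_comp] at this
  rw [mul_apply_eq_comp, mul_apply_eq_comp, ht x hx, this]

end IsTracialStandardForm

namespace TracePreservingAction

variable (σ : TracePreservingAction Γ Q Ω)

theorem rep_apply (x : Q.toStarSubalgebra) (ξ : lp (fun _ : Γ => H) 2) (g : Γ) :
    σ.rep x ξ g = (σ.aut g⁻¹ x : H →L[ℂ] H) (ξ g) := rfl

theorem rep_single (x : Q.toStarSubalgebra) (g : Γ) (v : H) :
    σ.rep x (ell2Single g v) = ell2Single g ((σ.aut g⁻¹ x : H →L[ℂ] H) v) := by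
  ext k
  rw [rep_apply, ell2Single_apply, ell2Single_apply]
  split_ifs with h
  · rw [h]
  · simp

theorem star_rep (x : Q.toStarSubalgebra) : star (σ.rep x) = σ.rep (star x) := by
  ext1 ξ
  refine ext_inner_right ℂ fun η => ?_
  rw [inner_star_apply, lp.inner_eq_tsum, lp.inner_eq_tsum]
  congr 1; ext g
  rw [rep_apply, rep_apply, map_star, ← inner_star_apply]
  rfl

/-- The twist by g⁻¹ in the coordinate g is what makes left translation implement the action: λ_h
π(y) λ_h⁻¹ = π(σ_h(y)). -/
theorem rep_mul_translation (x : Q.toStarSubalgebra) (h : Γ) :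
    σ.rep x * ell2Translation H h = ell2Translation H h * σ.rep (σ.aut h⁻¹ x) := by
  ext ξ g
  simp only [mul_apply_eq_comp, rep_apply, ell2Translation_apply]
  have : σ.aut g⁻¹ x = σ.aut (h⁻¹ * g)⁻¹ (σ.aut h⁻¹ x) := by
    rw [← StarAlgEquiv.mul_apply, ← map_mul]
    congr 2
    group
  rw [this]

/-- The generators of the crossed product. -/
def generators (Λ : Subgroup Γ) : Set (lp (fun _ : Γ => H) 2 →L[ℂ] lp (fun _ : Γ => H) 2) :=
  Set.range σ.rep ∪ {T | ∃ h ∈ Λ, T = ell2Translation H h}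

theorem star_mem_generators (Λ : Subgroup Γ) : ∀ s ∈ σ.generators Λ, star s ∈ σ.generators Λ := by
  rintro s (⟨x, rfl⟩ | ⟨h, hh, rfl⟩)
  · exact Or.inl ⟨star x, (σ.star_rep x).symm⟩
  · exact Or.inr ⟨h⁻¹, inv_mem hh, star_ell2Translation h⟩

variable {Λ : Subgroup Γ}

theorem crossedProduct_mono {Λ' : Subgroup Γ} (h : Λ ≤ Λ') :
    σ.crossedProduct Λ ≤ σ.crossedProduct Λ' :=
  vonNeumannGenerated_mono (σ.star_mem_generators Λ) (σ.star_mem_generators Λ')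
    (Set.union_subset_union_right _ fun _ ⟨g, hg, hT⟩ => ⟨g, h hg, hT⟩)

theorem rep_mem (x : Q.toStarSubalgebra) : σ.rep x ∈ σ.crossedProduct Λ :=
  subset_vonNeumannGenerated (σ.star_mem_generators Λ) (Or.inl ⟨x, rfl⟩)

theorem translation_mem {h : Γ} (hh : h ∈ Λ) : ell2Translation H h ∈ σ.crossedProduct Λ :=
  subset_vonNeumannGenerated (σ.star_mem_generators Λ) (Or.inr ⟨h, hh, rfl⟩)

theorem mem_commutant {t : lp (fun _ : Γ => H) 2 →L[ℂ] lp (fun _ : Γ => H) 2}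
    (h1 : ∀ x, σ.rep x * t = t * σ.rep x)
    (h2 : ∀ h ∈ Λ, ell2Translation H h * t = t * ell2Translation H h) :
    t ∈ (σ.crossedProduct Λ).commutant := by
  rw [VonNeumannAlgebra.mem_commutant_iff]
  intro x hx
  refine ((mem_vonNeumannGenerated_iff (σ.star_mem_generators Λ)).1 hx t ?_).symm
  rintro s (⟨x, rfl⟩ | ⟨h, hh, rfl⟩)
  · exact h1 x
  · exact h2 h hh

theorem ell2Const_mem_commutant {t : H →L[ℂ] H} (ht : t ∈ Q.commutant) :
    ell2Const Γ t ∈ (σ.crossedProduct Λ).commutant := by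
  rw [VonNeumannAlgebra.mem_commutant_iff] at ht
  refine σ.mem_commutant ?_ ?_
  · intro x
    ext ξ g
    simp only [mul_apply_eq_comp, rep_apply, ell2Const_apply]
    rw [← mul_apply_eq_comp, ht _ (σ.aut g⁻¹ x).2, mul_apply_eq_comp]
  · intro h _
    ext ξ g
    simp

theorem inner_aut (x y : Q.toStarSubalgebra) (h : Γ) :
    inner ℂ ((σ.aut h x : H →L[ℂ] H) Ω) ((y : H →L[ℂ] H) Ω) =
      inner ℂ ((x : H →L[ℂ] H) Ω) ((σ.aut h⁻¹ y : H →L[ℂ] H) Ω) := by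
  have h1 := σ.trace_aut h (star x * σ.aut h⁻¹ y)
  have h2 : σ.aut h (σ.aut h⁻¹ y) = y := by
    rw [← StarAlgEquiv.mul_apply, ← map_mul]; simp
  rw [map_mul, map_star, h2] at h1
  simpa [inner_apply_star] using h1

/-- The unitary on `L²(Q)` implementing an automorphism. -/
theorem exists_implementing (hQ : IsTracialStandardForm Q Ω) (h : Γ) :
    ∃ U : H →L[ℂ] H, ∀ x : Q.toStarSubalgebra,
      U ((x : H →L[ℂ] H) Ω) = (σ.aut h x : H →L[ℂ] H) Ω := by
  refine exists_extension_of_bound (Q.orbitMap Ω)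
    ((Q.orbitMap Ω).comp (σ.aut h : Q.toStarSubalgebra →ₗ[ℂ] Q.toStarSubalgebra)) hQ.denseRange 1 ?_
  intro x
  have h1 := σ.inner_aut x (σ.aut h x) h
  have h2 : σ.aut h⁻¹ (σ.aut h x) = x := by
    rw [← StarAlgEquiv.mul_apply, ← map_mul]; simp
  rw [h2, inner_self_eq_norm_sq_to_K, inner_self_eq_norm_sq_to_K] at h1
  have h3 : ‖(σ.aut h x : H →L[ℂ] H) Ω‖ ^ 2 = ‖(x : H →L[ℂ] H) Ω‖ ^ 2 := by exact_mod_cast h1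
  have h4 := (sq_eq_sq₀ (norm_nonneg _) (norm_nonneg _)).1 h3
  rw [one_mul]
  exact h4.le

/-- Right translations in the commutant of the crossed product. -/
theorem exists_right_translation (hQ : IsTracialStandardForm Q Ω) (g : Γ) :
    ∃ t ∈ (σ.crossedProduct Λ).commutant, t (ell2Unit Γ Ω) = ell2Single g Ω ∧
      star t (ell2Unit Γ Ω) = ell2Single g⁻¹ Ω := by
  obtain ⟨U, hU⟩ := σ.exists_implementing hQ g⁻¹
  obtain ⟨V, hV⟩ := σ.exists_implementing hQ g
  have hUΩ : U Ω = Ω := by simpa using hU 1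
  have hVΩ : V Ω = Ω := by simpa using hV 1
  have hUV : star U = V := by
    ext v
    refine hQ.ext_of_apply (f := (star U : H →L[ℂ] H)) (g := V) (by fun_prop) (by fun_prop) ?_ v
    intro x hx
    rw [← sub_eq_zero]
    refine hQ.eq_zero_of_inner fun y hy => ?_
    have := σ.inner_aut ⟨y, hy⟩ ⟨x, hx⟩ g⁻¹
    rw [inv_inv, ← hU, ← hV] at this
    rw [inner_sub_right, sub_eq_zero, inner_apply_star]
    exact this
  -- Right translation alone need not commute with π(Q), since it changes the coordinate and so the
  -- twist; `U`, which implements σ_{g⁻¹}, restores the twist.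
  refine ⟨ell2Const Γ U * ell2RightTranslation H g⁻¹, σ.mem_commutant ?_ ?_, ?_, ?_⟩
  · intro x
    ext ξ k
    simp only [mul_apply_eq_comp, rep_apply, ell2Const_apply, ell2RightTranslation_apply]
    refine hQ.ext_of_apply (f := fun v => (σ.aut k⁻¹ x : H →L[ℂ] H) (U v))
      (g := fun v => U ((σ.aut (k * g⁻¹)⁻¹ x : H →L[ℂ] H) v)) (by fun_prop) (by fun_prop) ?_ _
    intro y hy
    have h1 := hU ⟨y, hy⟩
    have h2 := hU (σ.aut (k * g⁻¹)⁻¹ x * ⟨y, hy⟩)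
    have h3 : σ.aut g⁻¹ (σ.aut (k * g⁻¹)⁻¹ x) = σ.aut k⁻¹ x := by
      rw [← StarAlgEquiv.mul_apply, ← map_mul]; simp
    rw [map_mul, h3] at h2
    simp only at h1 h2 ⊢
    rw [h1]
    exact h2.symm
  · intro h _
    ext ξ k
    simp [mul_assoc]
  · rw [ell2Unit_eq, mul_apply_eq_comp, ell2RightTranslation_single, ell2Const_single, hUΩ]
    simp
  · rw [ell2Unit_eq, star_mul, star_ell2Const, star_ell2RightTranslation, hUV, mul_apply_eq_comp,
      ell2Const_single, ell2RightTranslation_single, hVΩ]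
    simp

theorem inner_unit (T : lp (fun _ : Γ => H) 2) : inner ℂ (ell2Unit Γ Ω) T = inner ℂ Ω (T 1) := by
  rw [ell2Unit_eq, inner_ell2Single_left]

/-- Writing Ω for the unit vector, each y = π(q) or λ_g has a mirror t in the commutant with tΩ = yΩ
and t*Ω = y*Ω. Then ⟪Ω, xyΩ⟫ = ⟪Ω, txΩ⟫ = ⟪y*Ω, xΩ⟫ = ⟪Ω, yxΩ⟫. The property passes to the products
π(q)λ_g, which map Ω to a total set. -/
theorem isTracialVector_crossedProduct (hQ : IsTracialStandardForm Q Ω) :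
    IsTracialVector (σ.crossedProduct (⊤ : Subgroup Γ)) (ell2Unit Γ Ω) := by
  set M := σ.crossedProduct (⊤ : Subgroup Γ) with hM
  have hgen : ∀ y ∈ M, (∃ t ∈ M.commutant, t (ell2Unit Γ Ω) = y (ell2Unit Γ Ω) ∧
      star t (ell2Unit Γ Ω) = star y (ell2Unit Γ Ω)) → ∀ x ∈ M,
      inner ℂ (ell2Unit Γ Ω) ((x * y) (ell2Unit Γ Ω)) =
        inner ℂ (ell2Unit Γ Ω) ((y * x) (ell2Unit Γ Ω)) := by
    rintro y hy ⟨t, ht, h1, h2⟩ x hx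
    rw [VonNeumannAlgebra.mem_commutant_iff] at ht
    rw [mul_apply_eq_comp, ← h1, ← mul_apply_eq_comp, ht x hx, mul_apply_eq_comp,
      ← inner_star_apply, h2, inner_star_apply, mul_apply_eq_comp]
  have hrep : ∀ q : Q.toStarSubalgebra, ∀ x ∈ M,
      inner ℂ (ell2Unit Γ Ω) ((x * σ.rep q) (ell2Unit Γ Ω)) =
        inner ℂ (ell2Unit Γ Ω) ((σ.rep q * x) (ell2Unit Γ Ω)) := by
    intro q
    refine hgen _ (σ.rep_mem q) ?_
    obtain ⟨t, ht, h1, h2⟩ := hQ.exists_right_mul q.2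
    refine ⟨ell2Const Γ t, σ.ell2Const_mem_commutant ht, ?_, ?_⟩
    · rw [ell2Unit_eq, ell2Const_single, rep_single, h1]; simp
    · rw [ell2Unit_eq, star_ell2Const, ell2Const_single, star_rep, rep_single, h2]; simp
  have htra : ∀ g : Γ, ∀ x ∈ M,
      inner ℂ (ell2Unit Γ Ω) ((x * ell2Translation H g) (ell2Unit Γ Ω)) =
        inner ℂ (ell2Unit Γ Ω) ((ell2Translation H g * x) (ell2Unit Γ Ω)) := by
    intro g
    refine hgen _ (σ.translation_mem trivial) ?_
    obtain ⟨t, ht, h1, h2⟩ := σ.exists_right_translation hQ (Λ := ⊤) g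
    refine ⟨t, ht, ?_, ?_⟩
    · rw [h1, ell2Unit_eq, ell2Translation_single, mul_one]
    · rw [h2, star_ell2Translation, ell2Unit_eq, ell2Translation_single, mul_one]
  refine isTracialVector_of_total
    (G := {y | ∃ (q : Q.toStarSubalgebra) (g : Γ), y = σ.rep q * ell2Translation H g}) ?_ ?_ ?_
  · rintro _ ⟨q, g, rfl⟩
    exact mul_mem (σ.rep_mem q) (σ.translation_mem trivial)
  · rintro x hx _ ⟨q, g, rfl⟩
    rw [← mul_assoc, htra g _ (mul_mem hx (σ.rep_mem q)), ← mul_assoc,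
      hrep q _ (mul_mem (σ.translation_mem trivial) hx), mul_assoc]
  · intro ξ hξ
    ext g
    refine hQ.eq_zero_of_inner fun x hx => ?_
    have := hξ _ ⟨σ.aut g ⟨x, hx⟩, g, rfl⟩
    rw [mul_apply_eq_comp, ell2Unit_eq, ell2Translation_single, mul_one, rep_single,
      inner_ell2Single_left] at this
    have h2 : σ.aut g⁻¹ (σ.aut g ⟨x, hx⟩) = ⟨x, hx⟩ := by
      rw [← StarAlgEquiv.mul_apply, ← map_mul]; simp
    rwa [h2] at this

/-- The commutant of the crossed product has countably many elements which map the unit vector to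
a total set. -/
theorem exists_total_commutant [Countable Γ] [TopologicalSpace.SeparableSpace H]
    (hQ : IsTracialStandardForm Q Ω) :
    ∃ s : ℕ → lp (fun _ : Γ => H) 2 →L[ℂ] lp (fun _ : Γ => H) 2,
      (∀ i, s i ∈ (σ.crossedProduct (⊤ : Subgroup Γ)).commutant) ∧
      ∀ ξ, (∀ i, inner ℂ (s i (ell2Unit Γ Ω)) ξ = 0) → ξ = 0 := by
  obtain ⟨D, hD1, hD2, hD3⟩ := hQ.cyclic.exists_countable_dense_subset
  have hDne : D.Nonempty := hD3.nonempty
  have := hD2.to_subtype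
  have := hDne.to_subtype
  obtain ⟨f, hf⟩ := exists_surjective_nat (Γ × D)
  have key : ∀ i, ∃ s ∈ (σ.crossedProduct (⊤ : Subgroup Γ)).commutant,
      s (ell2Unit Γ Ω) = ell2Single (f i).1 ((f i).2 : H) := by
    intro i
    obtain ⟨x, hx, hxv⟩ := hD1 (f i).2.2
    obtain ⟨t, ht, h1, -⟩ := σ.exists_right_translation hQ (Λ := ⊤) (f i).1
    obtain ⟨u, hu, h2, -⟩ := hQ.exists_right_mul hx
    refine ⟨ell2Const Γ u * t, mul_mem (σ.ell2Const_mem_commutant hu) ht, ?_⟩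
    rw [mul_apply_eq_comp, h1, ell2Const_single, h2, hxv]
  choose s hs1 hs2 using key
  refine ⟨s, hs1, fun ξ hξ => ?_⟩
  ext g
  have h0 : ∀ v : H, inner ℂ v (ξ g) = 0 := by
    intro v
    refine hD3.induction (P := fun v => (inner ℂ v (ξ g) : ℂ) = 0) ?_
      (isClosed_eq (by fun_prop) (by fun_prop)) v
    intro v hv
    obtain ⟨i, hi⟩ := hf (g, ⟨v, hv⟩)
    have := hξ i
    rwa [hs2, inner_ell2Single_left, hi] at this
  exact inner_self_eq_zero.1 (h0 (ξ g))

end TracePreservingAction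

end CrossedProduct

/-! ### The action on continuous functions. -/

section Translates

variable {X Γ : Type*} [TopologicalSpace X] [Group Γ] [MulAction Γ X] [ContinuousConstSMul Γ X]

/-- The translate `f(g ·)` of a function. -/
def ContinuousMap.translate (f : C(X, ℝ)) (g : Γ) : C(X, ℝ) :=
  f.comp ⟨fun x => g • x, continuous_const_smul g⟩

@[simp] theorem ContinuousMap.translate_apply (f : C(X, ℝ)) (g : Γ) (x : X) :
    f.translate g x = f (g • x) := rfl

end Translates

/-! ### States on C(X) and singular measures. -/

section SingularActions

open MeasureTheory

variable {X : Type*} [TopologicalSpace X] [CompactSpace X] [T2Space X] [MeasurableSpace X]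
  [BorelSpace X]

/-- The Riesz representation theorem for states on `C(X, ℝ)`. -/
theorem exists_regular_probability_of_state (L : C(X, ℝ) →ₗ[ℝ] ℝ)
    (hpos : ∀ f : C(X, ℝ), (∀ x, 0 ≤ f x) → 0 ≤ L f) (h1 : L 1 = 1) :
    ∃ μ : Measure X, IsProbabilityMeasure μ ∧ μ.Regular ∧ ∀ f : C(X, ℝ), ∫ x, f x ∂μ = L f := by
  let L' : CompactlySupportedContinuousMap X ℝ →ₚ[ℝ] ℝ := PositiveLinearMap.mk₀
    { toFun := fun f => L (f : C(X, ℝ))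
      map_add' := fun f g => by rw [← map_add]; rfl
      map_smul' := fun c f => by rw [← map_smul]; rfl }
    (fun f hf => hpos _ hf)
  have hL' : ∀ f : C(X, ℝ), ∫ x, f x ∂(RealRMK.rieszMeasure L') = L f := fun f => by
    have := RealRMK.integral_rieszMeasure L' (CompactlySupportedContinuousMap.continuousMapEquiv f)
    exact this
  refine ⟨RealRMK.rieszMeasure L', ⟨?_⟩, inferInstance, hL'⟩
  have := hL' 1
  rw [h1] at this
  simp only [ContinuousMap.one_apply, integral_const, smul_eq_mul, mul_one] at this
  rw [measureReal_def] at this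
  rwa [← ENNReal.toReal_eq_one_iff]

/-- Inside a ν-null set of full μ-measure choose a compact K carrying almost all of μ, then an open
U ⊇ K with small ν-measure; a Urysohn function for K inside U works. -/
theorem exists_continuous_separating_of_mutuallySingular {μ ν : Measure X} [IsFiniteMeasure μ]
    [IsFiniteMeasure ν] [μ.Regular] [ν.Regular] (h : ν ⟂ₘ μ) {ε : ℝ} (hε : 0 < ε) :
    ∃ f : C(X, ℝ), (∀ x, 0 ≤ f x ∧ f x ≤ 1) ∧ ∫ x, (1 - f x) ∂μ < ε ∧ ∫ x, f x ∂ν < ε := by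
  obtain ⟨s, hs, hνs, hμs⟩ := h
  have hε' : ENNReal.ofReal (ε / 2) ≠ 0 := by simpa using hε
  obtain ⟨K, hKs, hK, hμK⟩ := hs.exists_isCompact_lt_add (μ := μ) (measure_ne_top _ _) hε'
  have hμK' : μ Kᶜ ≤ ENNReal.ofReal (ε / 2) := by
    have h1 : μ (s \ K) ≤ ENNReal.ofReal (ε / 2) := by
      rw [measure_sdiff hKs hK.measurableSet.nullMeasurableSet (measure_ne_top _ _)]
      rw [tsub_le_iff_right, add_comm]
      exact hμK.le
    have h2 : Kᶜ ⊆ (s \ K) ∪ sᶜ := by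
      intro x hx
      by_cases hxs : x ∈ s
      · exact Or.inl ⟨hxs, hx⟩
      · exact Or.inr hxs
    calc μ Kᶜ ≤ μ (s \ K) + μ sᶜ := (measure_mono h2).trans (measure_union_le _ _)
      _ ≤ _ := by rw [hμs, add_zero]; exact h1
  have hνK : ν K = 0 := measure_mono_null hKs hνs
  obtain ⟨U, hKU, hU, hνU⟩ := K.exists_isOpen_lt_add (μ := ν) (by simp [hνK]) hε'
  rw [hνK, zero_add] at hνU
  obtain ⟨f, hf0, hf1, hf⟩ := exists_continuous_zero_one_of_isClosed hU.isClosed_compl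
    hK.isClosed (Set.disjoint_compl_left_iff_subset.2 hKU)
  have hint : ∀ (ρ : Measure X) [IsFiniteMeasure ρ] (F : C(X, ℝ)) (t : Set X), MeasurableSet t →
      (∀ x, F x ≤ 1) → (∀ x ∉ t, F x = 0) → ρ t ≤ ENNReal.ofReal (ε / 2) → ∫ x, F x ∂ρ < ε := by
    intro ρ _ F t ht hF1 hFt hρ
    calc ∫ x, F x ∂ρ ≤ ∫ x, t.indicator (fun _ => (1 : ℝ)) x ∂ρ := by
          refine integral_mono ?_ ?_ ?_
          · exact F.continuous.integrable_of_hasCompactSupport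
              (HasCompactSupport.of_compactSpace _)
          · exact (integrable_const (1 : ℝ)).indicator ht
          · intro x
            by_cases hx : x ∈ t
            · simpa [hx] using hF1 x
            · simp [hx, hFt x hx]
      _ = (ρ t).toReal := by
          rw [integral_indicator ht]; simp [measureReal_def]
      _ ≤ ε / 2 := ENNReal.toReal_le_of_le_ofReal (by positivity) hρ
      _ < ε := by linarith
  refine ⟨f, hf, ?_, ?_⟩
  · refine hint μ (1 - f) Kᶜ hK.measurableSet.compl ?_ ?_ hμK'
    · intro x; simpa using (hf x).1
    · intro x hx
      have := hf1 (not_not.1 hx)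
      simpa [sub_eq_zero] using this.symm
  · refine hint ν f U hU.measurableSet (fun x => (hf x).2) ?_ hνU.le
    intro x hx
    exact hf0 hx

/-- Every `Λ`-invariant state on `C(X)` is, up to `ε`, supported where its translate by `g` is
not. -/
theorem IsSingularSubgroup.exists_separating {Γ : Type*} [Group Γ] [MulAction Γ X]
    [ContinuousConstSMul Γ X] {Λ : Subgroup Γ} (hΛ : IsSingularSubgroup Λ X)
    (L : C(X, ℝ) →ₗ[ℝ] ℝ) (hpos : ∀ f : C(X, ℝ), (∀ x, 0 ≤ f x) → 0 ≤ L f) (h1 : L 1 = 1)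
    (hinv : ∀ h ∈ Λ, ∀ f : C(X, ℝ), L (f.translate h) = L f) {g : Γ} (hg : g ∉ Λ)
    {ε : ℝ} (hε : 0 < ε) :
    ∃ f : C(X, ℝ), (∀ x, 0 ≤ f x ∧ f x ≤ 1) ∧ L (1 - f) < ε ∧ L (f.translate g) < ε := by
  obtain ⟨μ, hμ, hreg, hμL⟩ := exists_regular_probability_of_state L hpos h1
  have hmeas : ∀ k : Γ, Measurable fun x : X => k • x := fun k =>
    (continuous_const_smul k).measurable
  have hmapreg : ∀ k : Γ, (μ.map fun x => k • x).Regular := fun k =>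
    Measure.Regular.map (Homeomorph.smul k)
  have hmapint : ∀ (k : Γ) (f : C(X, ℝ)), ∫ x, f x ∂(μ.map fun x => k • x) = L (f.translate k) := by
    intro k f
    rw [integral_map (hmeas k).aemeasurable f.continuous.aestronglyMeasurable]
    exact hμL (f.translate k)
  have hinv' : ∀ h ∈ Λ, μ.map (fun x => h • x) = μ := by
    intro h hh
    have := hmapreg h
    refine Measure.ext_of_integral_eq_on_compactlySupported fun f => ?_
    exact (hmapint h f).trans ((hinv h hh f).trans (hμL f).symm)
  have hsing := hΛ.singular μ hμ hreg hinv' g hg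
  have := hmapreg g
  have : IsFiniteMeasure (μ.map fun x => g • x) := inferInstance
  obtain ⟨f, hf, h2, h3⟩ := exists_continuous_separating_of_mutuallySingular hsing hε
  refine ⟨f, hf, ?_, ?_⟩
  · rw [← hμL]; exact h2
  · rw [← hmapint]; exact h3

end SingularActions

/-! ### Central states of intermediate algebras vanish off Λ. -/

section CrossedProduct

/-- An `A`-central state on `B(K)` can be chosen to restrict to the trace of a larger algebra. -/
theorem IsAmenableVN.exists_central_state {K : Type*} [NormedAddCommGroup K]
    [InnerProductSpace ℂ K] [CompleteSpace K] {A M : VonNeumannAlgebra K} {Ω : K}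
    (hA : IsAmenableVN A Ω) (hAM : A ≤ M) (hM : IsTracialVector M Ω) (s : ℕ → K →L[ℂ] K)
    (hs : ∀ i, s i ∈ M.commutant) (htot : ∀ ξ, (∀ i, inner ℂ (s i Ω) ξ = 0) → ξ = 0) :
    ∃ φ : (K →L[ℂ] K) →ₗ[ℂ] ℂ, IsOperatorState φ ∧ (∀ x ∈ M, φ x = inner ℂ Ω (x Ω)) ∧
      ∀ x ∈ A, ∀ T, φ (x * T) = φ (T * x) := by
  obtain ⟨φ, h1, h2, h3, h4⟩ := hA
  have hφ : IsOperatorState φ := ⟨h1, h2⟩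
  obtain ⟨Ψ, k1, k2, k3, k4⟩ := exists_bimodule_map A M hAM Ω hM s hs htot
  refine ⟨φ ∘ₗ Ψ, ⟨fun T => ?_, by simp [k2, h2]⟩, fun x hx => ?_, fun x hx T => ?_⟩
  · obtain ⟨S, hS⟩ := CStarAlgebra.nonneg_iff_eq_star_mul_self.1 (k1 T)
    rw [LinearMap.comp_apply, hS]
    exact h1 S
  · rw [LinearMap.comp_apply, h3 _ (k4 x hx).1]
    simpa using (k4 x hx).2 1 (one_mem A)
  · rw [LinearMap.comp_apply, LinearMap.comp_apply, (k3 x hx T).1, (k3 x hx T).2, h4 x hx]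

variable {Γ H : Type*} [NormedAddCommGroup H] [InnerProductSpace ℂ H] [CompleteSpace H] [Group Γ]
  {Q : VonNeumannAlgebra H} {Ω : H}

section Multiplication

variable {X : Type*} [TopologicalSpace X] [CompactSpace X] [MulAction Γ X]

/-- The operator of multiplication by the function `g ↦ f(g x₀)` on `ℓ²(Γ, H)`. -/
noncomputable def orbitMultiplication (Γ H : Type*) [NormedAddCommGroup H] [InnerProductSpace ℂ H]
    [Group Γ] [MulAction Γ X] (x₀ : X) (f : C(X, ℝ)) :
    lp (fun _ : Γ => H) 2 →L[ℂ] lp (fun _ : Γ => H) 2 :=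
  ell2Diagonal (fun g => ((f (g • x₀) : ℝ) : ℂ) • (1 : H →L[ℂ] H)) ‖f‖ (fun g => by
    rw [norm_smul, Complex.norm_real]
    calc ‖f (g • x₀)‖ * ‖(1 : H →L[ℂ] H)‖ ≤ ‖f‖ * 1 :=
          mul_le_mul (f.norm_coe_le_norm _) ContinuousLinearMap.norm_id_le (norm_nonneg _)
            (norm_nonneg _)
      _ = ‖f‖ := mul_one _)

@[simp] theorem orbitMultiplication_apply (x₀ : X) (f : C(X, ℝ)) (ξ : lp (fun _ : Γ => H) 2)
    (g : Γ) : orbitMultiplication Γ H x₀ f ξ g = ((f (g • x₀) : ℝ) : ℂ) • ξ g := rfl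

theorem orbitMultiplication_mul (x₀ : X) (f f' : C(X, ℝ)) :
    orbitMultiplication Γ H x₀ (f * f') =
      orbitMultiplication Γ H x₀ f * orbitMultiplication Γ H x₀ f' := by
  ext ξ g
  simp [mul_smul]

theorem star_orbitMultiplication (x₀ : X) (f : C(X, ℝ)) :
    star (orbitMultiplication Γ H x₀ f) = orbitMultiplication Γ H x₀ f := by
  ext1 ξ
  refine ext_inner_right ℂ fun η => ?_
  rw [inner_star_apply, lp.inner_eq_tsum, lp.inner_eq_tsum]
  congr 1; ext g
  rw [orbitMultiplication_apply, orbitMultiplication_apply, inner_smul_left, inner_smul_right,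
    Complex.conj_ofReal]

/-- `f ↦ Re φ(f)` as a functional on `C(X, ℝ)`. -/
noncomputable def orbitFunctional (x₀ : X)
    (φ : (lp (fun _ : Γ => H) 2 →L[ℂ] lp (fun _ : Γ => H) 2) →ₗ[ℂ] ℂ) : C(X, ℝ) →ₗ[ℝ] ℝ where
  toFun f := (φ (orbitMultiplication Γ H x₀ f)).re
  map_add' f f' := by
    rw [← Complex.add_re, ← map_add]
    congr 2
    ext ξ g
    simp [add_smul]
  map_smul' c f := by
    have : orbitMultiplication Γ H x₀ (c • f) = (c : ℂ) • orbitMultiplication Γ H x₀ f := by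
      ext ξ g
      change ((c * f (g • x₀) : ℝ) : ℂ) • ξ g = (c : ℂ) • ((f (g • x₀) : ℝ) : ℂ) • ξ g
      rw [smul_smul, Complex.ofReal_mul]
    rw [this, map_smul]
    simp

theorem orbitFunctional_apply (x₀ : X)
    (φ : (lp (fun _ : Γ => H) 2 →L[ℂ] lp (fun _ : Γ => H) 2) →ₗ[ℂ] ℂ) (f : C(X, ℝ)) :
    orbitFunctional x₀ φ f = (φ (orbitMultiplication Γ H x₀ f)).re := rfl

/-- Evaluation along the orbit of x₀ makes C(X) act covariantly, without any measure on X being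
chosen; invariance of φ under conjugation by λ_h thus becomes invariance of a state on C(X). -/
theorem orbitMultiplication_mul_translation [ContinuousConstSMul Γ X] (x₀ : X) (f : C(X, ℝ))
    (g : Γ) : orbitMultiplication Γ H x₀ f * ell2Translation H g =
      ell2Translation H g * orbitMultiplication Γ H x₀ (f.translate g) := by
  ext ξ k
  simp only [mul_apply_eq_comp, orbitMultiplication_apply, ell2Translation_apply,
    ContinuousMap.translate_apply, smul_smul, mul_inv_cancel_left]

theorem orbitMultiplication_mul_rep (σ : TracePreservingAction Γ Q Ω) (x₀ : X) (f : C(X, ℝ))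
    (x : Q.toStarSubalgebra) : orbitMultiplication Γ H x₀ f * σ.rep x =
      σ.rep x * orbitMultiplication Γ H x₀ f := by
  ext ξ k
  simp [TracePreservingAction.rep_apply]

@[simp] theorem orbitMultiplication_one (x₀ : X) :
    orbitMultiplication Γ H x₀ (1 : C(X, ℝ)) = 1 := by
  ext ξ k; simp

end Multiplication

namespace TracePreservingAction

variable (σ : TracePreservingAction Γ Q Ω) {Λ : Subgroup Γ}

/-- The restriction of vectors to a subset of `Γ` commutes with `Q ⋊ Λ` if the subset is
invariant. -/
theorem apply_unit_eq_zero {x : lp (fun _ : Γ => H) 2 →L[ℂ] lp (fun _ : Γ => H) 2}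
    (hx : x ∈ σ.crossedProduct Λ) {g : Γ} (hg : g ∉ Λ) : x (ell2Unit Γ Ω) g = 0 := by
  classical
  let p : lp (fun _ : Γ => H) 2 →L[ℂ] lp (fun _ : Γ => H) 2 :=
    ell2Diagonal (fun g => if g ∈ Λ then (1 : H →L[ℂ] H) else 0) 1 (fun g => by
      split_ifs
      · exact ContinuousLinearMap.norm_id_le
      · simp)
  have hp : ∀ ξ k, p ξ k = if k ∈ Λ then ξ k else 0 := by
    intro ξ k
    simp only [p, ell2Diagonal_apply]
    split_ifs <;> simp
  have hpc : p ∈ (σ.crossedProduct Λ).commutant := by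
    refine σ.mem_commutant ?_ ?_
    · intro y
      ext ξ k
      simp only [mul_apply_eq_comp, hp, rep_apply]
      split_ifs <;> simp
    · intro h hh
      ext ξ k
      simp only [mul_apply_eq_comp, hp, ell2Translation_apply,
        Subgroup.mul_mem_cancel_left Λ (inv_mem hh)]
  rw [VonNeumannAlgebra.mem_commutant_iff] at hpc
  have h1 : p (ell2Unit Γ Ω) = ell2Unit Γ Ω := by
    ext k
    rw [hp, ell2Unit_eq, ell2Single_apply]
    by_cases hk : k = 1
    · simp [hk, one_mem]
    · simp [hk]
  have h2 := congrArg (fun f => f (ell2Unit Γ Ω)) (hpc x hx)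
  simp only [mul_apply_eq_comp, h1] at h2
  rw [h2, hp, if_neg hg]

/-- For fixed g, the vectors π(q)λ_g applied to the unit vector run through δ_g ⊗ QΩ, and QΩ is
dense in H. -/
theorem inner_generator (hQ : IsTracialStandardForm Q Ω) {ξ : lp (fun _ : Γ => H) 2} {g : Γ}
    (h : ∀ q : Q.toStarSubalgebra,
      inner ℂ ((σ.rep q * ell2Translation H g) (ell2Unit Γ Ω)) ξ = 0) : ξ g = 0 := by
  refine hQ.eq_zero_of_inner fun x hx => ?_
  have := h (σ.aut g ⟨x, hx⟩)
  rw [mul_apply_eq_comp, ell2Unit_eq, ell2Translation_single, mul_one, rep_single,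
    inner_ell2Single_left] at this
  have h2 : σ.aut g⁻¹ (σ.aut g ⟨x, hx⟩) = ⟨x, hx⟩ := by
    rw [← StarAlgEquiv.mul_apply, ← map_mul]; simp
  rwa [h2] at this

/-- Elements of `Q ⋊ Γ` which are supported on `Λ` belong to `Q ⋊ Λ`. -/
theorem mem_of_support [Countable Γ] [TopologicalSpace.SeparableSpace H]
    (hQ : IsTracialStandardForm Q Ω) {x : lp (fun _ : Γ => H) 2 →L[ℂ] lp (fun _ : Γ => H) 2}
    (hx : x ∈ σ.crossedProduct ⊤) (h : ∀ g ∉ Λ, x (ell2Unit Γ Ω) g = 0) :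
    x ∈ σ.crossedProduct Λ := by
  obtain ⟨s, hs, htot⟩ := σ.exists_total_commutant hQ
  obtain ⟨Ψ, -, -, -, k4⟩ := exists_bimodule_map (σ.crossedProduct Λ) (σ.crossedProduct ⊤)
    (σ.crossedProduct_mono le_top) (ell2Unit Γ Ω) (σ.isTracialVector_crossedProduct hQ) s hs htot
  obtain ⟨hΨ, hΨ'⟩ := k4 x hx
  -- Off Λ both vectors vanish. On Λ the difference is orthogonal to the generators, because Ψ
  -- preserves inner products with vectors coming from Q ⋊ Λ.
  have h0 : Ψ x (ell2Unit Γ Ω) - x (ell2Unit Γ Ω) = 0 := by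
    ext g
    by_cases hg : g ∈ Λ
    · refine σ.inner_generator hQ fun q => ?_
      rw [inner_sub_right, hΨ' _ (mul_mem (σ.rep_mem q) (σ.translation_mem hg)), sub_self]
    · rw [lp.coeFn_sub, Pi.sub_apply, h g hg, σ.apply_unit_eq_zero hΨ hg, sub_self]
      rfl
  have h1 : Ψ x = x := by
    rw [← sub_eq_zero]
    have hm : Ψ x - x ∈ σ.crossedProduct ⊤ := sub_mem (σ.crossedProduct_mono le_top hΨ) hx
    -- The unit vector is separating for M, since the commutant of M maps it to a total set.
    have h2 : star (Ψ x - x) = 0 := by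
      ext1 v
      refine htot _ fun i => ?_
      have h3 := VonNeumannAlgebra.mem_commutant_iff.1 (hs i) _ hm
      rw [inner_apply_star, ← mul_apply_eq_comp, h3, mul_apply_eq_comp, sub_apply, h0, map_zero,
        inner_zero_left]
    rwa [star_eq_zero] at h2
  rw [← h1]
  exact hΨ

/-- The main estimate: a central state of an intermediate amenable algebra annihilates the
generators outside of `Λ`. -/
theorem central_state_eq_zero {X : Type*} [TopologicalSpace X] [CompactSpace X] [T2Space X]
    [Nonempty X] [MeasurableSpace X] [BorelSpace X] [MulAction Γ X] [ContinuousConstSMul Γ X]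
    (hΛ : IsSingularSubgroup Λ X) {A : VonNeumannAlgebra (lp (fun _ : Γ => H) 2)}
    (hA : σ.crossedProduct Λ ≤ A)
    {φ : (lp (fun _ : Γ => H) 2 →L[ℂ] lp (fun _ : Γ => H) 2) →ₗ[ℂ] ℂ} (hφ : IsOperatorState φ)
    (hc : ∀ x ∈ A, ∀ T, φ (x * T) = φ (T * x)) {g : Γ} (hg : g ∉ Λ) (q : Q.toStarSubalgebra)
    {x : lp (fun _ : Γ => H) 2 →L[ℂ] lp (fun _ : Γ => H) 2} (hx : x ∈ A) :
    φ (σ.rep q * ell2Translation H g * x) = 0 := by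
  obtain ⟨x₀⟩ := ‹Nonempty X›
  set L := orbitFunctional x₀ φ with hL
  set y := σ.rep q * ell2Translation H g with hy
  have hpos : ∀ f : C(X, ℝ), (∀ x, 0 ≤ f x) → 0 ≤ L f := by
    intro f hf
    have h1 : f = ⟨fun x => Real.sqrt (f x), by fun_prop⟩ *
        ⟨fun x => Real.sqrt (f x), by fun_prop⟩ := by
      ext x
      simp [Real.mul_self_sqrt (hf x)]
    rw [hL, orbitFunctional_apply, h1, orbitMultiplication_mul]
    nth_rewrite 1 [← star_orbitMultiplication]
    exact (hφ.nonneg _).1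
  have h1 : L 1 = 1 := by
    rw [hL, orbitFunctional_apply, orbitMultiplication_one, hφ.map_one, Complex.one_re]
  have hinv : ∀ h ∈ Λ, ∀ f : C(X, ℝ), L (f.translate h) = L f := by
    intro h hh f
    rw [hL, orbitFunctional_apply, orbitFunctional_apply]
    have h2 : ell2Translation H h⁻¹ * (orbitMultiplication Γ H x₀ f * ell2Translation H h) =
        orbitMultiplication Γ H x₀ (f.translate h) := by
      rw [orbitMultiplication_mul_translation, ← mul_assoc, ← ell2Translation_mul, inv_mul_cancel,
        ell2Translation_one, one_mul]
    rw [← h2, hc _ (hA (σ.translation_mem (inv_mem hh))), mul_assoc, ← ell2Translation_mul,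
      mul_inv_cancel, ell2Translation_one, mul_one]
  have hsq : ∀ f : C(X, ℝ), (∀ x, 0 ≤ f x ∧ f x ≤ 1) →
      (φ (orbitMultiplication Γ H x₀ f * orbitMultiplication Γ H x₀ f)).re ≤ L f := by
    intro f hf
    rw [← orbitMultiplication_mul, ← orbitFunctional_apply, ← sub_nonneg, ← hL, ← map_sub]
    refine hpos _ fun x => ?_
    have := hf x
    simp only [ContinuousMap.sub_apply, ContinuousMap.mul_apply]
    nlinarith
  set C := (φ (star (y * x) * (y * x))).re + (φ (x * y * star (x * y))).re with hC
  have hC1 : 0 ≤ (φ (star (y * x) * (y * x))).re := (hφ.nonneg _).1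
  have hC2 : 0 ≤ (φ (x * y * star (x * y))).re := by
    simpa using (hφ.nonneg (star (x * y))).1
  -- C does not depend on ε: the separating function enters Cauchy-Schwarz only through φ((1 - f)²)
  -- ≤ φ(1 - f) and its analogue for the translate, each below ε. The factor 2 from squaring a sum
  -- would suffice in place of 4.
  have hbound : ∀ ε > 0, ‖φ (y * x)‖ ^ 2 ≤ 4 * C * ε := by
    intro ε hε
    obtain ⟨f, hf, hf1, hf2⟩ := hΛ.exists_separating L hpos h1 hinv hg hε
    set a := orbitMultiplication Γ H x₀ f with ha
    set b := orbitMultiplication Γ H x₀ (f.translate g) with hb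
    have hay : a * y = y * b := by
      rw [hy, ← mul_assoc, ha, orbitMultiplication_mul_rep, mul_assoc,
        orbitMultiplication_mul_translation, mul_assoc]
    have ha' : orbitMultiplication Γ H x₀ (1 - f) = 1 - a := by
      ext ξ k; simp [ha, sub_smul]
    -- This is where x ∈ `A` is used: φ(a y x) = φ(y b x) = φ(x y b), which puts the small factor b
    -- at an end, as Cauchy-Schwarz requires.
    have hsplit : φ (y * x) = φ ((1 - a) * (y * x)) + φ (x * y * b) := by
      have : φ (x * y * b) = φ (a * (y * x)) := by
        rw [mul_assoc, hc x hx, ← hay, mul_assoc]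
      rw [this, ← map_add]
      congr 1
      rw [sub_mul, one_mul, sub_add_cancel]
    have e1 : ‖φ ((1 - a) * (y * x))‖ ^ 2 ≤ ε * (φ (star (y * x) * (y * x))).re := by
      refine (hφ.norm_mul_sq_le _ _).trans ?_
      refine mul_le_mul_of_nonneg_right ?_ hC1
      rw [← ha', star_orbitMultiplication]
      refine (hsq (1 - f) fun x => ?_).trans hf1.le
      have := hf x
      simp only [ContinuousMap.sub_apply, ContinuousMap.one_apply]
      constructor <;> linarith
    have e2 : ‖φ (x * y * b)‖ ^ 2 ≤ (φ (x * y * star (x * y))).re * ε := by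
      refine (hφ.norm_mul_sq_le _ _).trans ?_
      refine mul_le_mul_of_nonneg_left ?_ hC2
      rw [hb, star_orbitMultiplication]
      exact (hsq (f.translate g) fun x => hf (g • x)).trans hf2.le
    have e3 : ‖φ (y * x)‖ ≤ ‖φ ((1 - a) * (y * x))‖ + ‖φ (x * y * b)‖ := by
      rw [hsplit]; exact norm_add_le _ _
    have e4 : ‖φ (y * x)‖ ^ 2 ≤ (‖φ ((1 - a) * (y * x))‖ + ‖φ (x * y * b)‖) ^ 2 := by gcongr
    nlinarith [sq_nonneg (‖φ ((1 - a) * (y * x))‖ - ‖φ (x * y * b)‖), mul_nonneg hε.le hC1,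
      mul_nonneg hε.le hC2]
  have hlim : ‖φ (y * x)‖ ^ 2 ≤ 0 := by
    refine le_of_forall_pos_le_add fun δ hδ => ?_
    have hC0 : 0 ≤ C := add_nonneg hC1 hC2
    refine (hbound (δ / (4 * C + 1)) (by positivity)).trans ?_
    rw [zero_add, mul_div_assoc', div_le_iff₀ (by positivity)]
    nlinarith
  have := sq_nonneg ‖φ (y * x)‖
  have h0 : ‖φ (y * x)‖ ^ 2 = 0 := le_antisymm hlim this
  simpa using h0

/-- Since φ is the trace on all of M, the vanishing of φ(π(q)λ_g x) is an orthogonality statement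
about the vector of x; it forces that vector to be supported on Λ. -/
theorem le_of_amenable [Countable Γ] [TopologicalSpace.SeparableSpace H]
    {X : Type*} [TopologicalSpace X] [CompactSpace X] [T2Space X]
    [Nonempty X] [MeasurableSpace X] [BorelSpace X] [MulAction Γ X] [ContinuousConstSMul Γ X]
    (hQ : IsTracialStandardForm Q Ω)
    (hΛ : IsSingularSubgroup Λ X) {A : VonNeumannAlgebra (lp (fun _ : Γ => H) 2)}
    (hA : σ.crossedProduct Λ ≤ A) (hAM : A ≤ σ.crossedProduct ⊤)
    (hamen : IsAmenableVN A (ell2Unit Γ Ω)) : A ≤ σ.crossedProduct Λ := by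
  obtain ⟨s, hs, htot⟩ := σ.exists_total_commutant hQ
  obtain ⟨φ, hφ, hφM, hc⟩ := hamen.exists_central_state hAM (σ.isTracialVector_crossedProduct hQ)
    s hs htot
  intro x hx
  refine σ.mem_of_support hQ (hAM hx) fun g hg => ?_
  refine σ.inner_generator hQ fun q => ?_
  have hg' : g⁻¹ ∉ Λ := fun h => hg (by simpa using inv_mem h)
  have h1 := σ.central_state_eq_zero hΛ hA hφ hc hg' (σ.aut g⁻¹ (star q)) hx
  -- By covariance the adjoint of a generator at g is a generator at g⁻¹, which also lies outside Λ.
  have h2 : σ.rep (σ.aut g⁻¹ (star q)) * ell2Translation H g⁻¹ =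
      star (σ.rep q * ell2Translation H g) := by
    rw [star_mul, star_ell2Translation, star_rep, rep_mul_translation, inv_inv,
      ← StarAlgEquiv.mul_apply, ← map_mul]
    simp
  rw [hφM _ (mul_mem (mul_mem (σ.rep_mem _) (σ.translation_mem trivial)) (hAM hx)), h2,
    mul_apply_eq_comp, inner_apply_star] at h1
  exact h1

end TracePreservingAction

end CrossedProduct

/-! ### Amenability of Q ⋊ Λ. -/

section CrossedProduct

/-- The average of a bounded function with respect to a mean. -/
theorem IsAmenableGroup.exists_mean {G : Type*} [Group G] (hG : IsAmenableGroup G) {V : Type*}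
    [AddCommGroup V] [Module ℝ V] (F : V →ₗ[ℝ] (G → ℝ)) (hF : ∀ v, ∃ C, ∀ g, |F v g| ≤ C) :
    ∃ R : V →ₗ[ℝ] ℝ, (∀ v, (∀ g, 0 ≤ F v g) → 0 ≤ R v) ∧
      (∀ v c, (∀ g, F v g = c) → R v = c) ∧
      ∀ v w (k : G), (∀ g, F v g = F w (k⁻¹ * g)) → R v = R w := by
  obtain ⟨m, h1, h2, h3⟩ := hG
  have hmem : ∀ v, Memℓp (E := fun _ : G => ℝ) (F v) ∞ := fun v => by
    obtain ⟨C, hC⟩ := hF v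
    exact memℓp_infty ⟨C, by rintro _ ⟨g, rfl⟩; exact hC g⟩
  let I : V →ₗ[ℝ] lp (fun _ : G => ℝ) ∞ :=
    { toFun := fun v => ⟨F v, hmem v⟩
      map_add' := fun v w => by ext g; simp only [map_add]; rfl
      map_smul' := fun c v => by ext g; simp }
  refine ⟨m ∘ₗ I, fun v hv => h1 _ hv, fun v c hv => ?_, fun v w k hvw => h3 k _ _ hvw⟩
  have hone : Memℓp (E := fun _ : G => ℝ) (fun _ => (1 : ℝ)) ∞ :=
    memℓp_infty ⟨1, by rintro _ ⟨g, rfl⟩; simp⟩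
  have h4 : I v = c • (⟨fun _ => 1, hone⟩ : lp (fun _ : G => ℝ) ∞) := by
    ext g
    simpa [I] using hv g
  rw [LinearMap.comp_apply, h4, map_smul, h2 _ (fun _ => rfl), smul_eq_mul, mul_one]

variable {Γ H : Type*} [NormedAddCommGroup H] [InnerProductSpace ℂ H] [CompleteSpace H] [Group Γ]
  {Q : VonNeumannAlgebra H} {Ω : H}

theorem norm_ell2Translation_le (h : Γ) : ‖ell2Translation H h‖ ≤ 1 :=
  LinearMap.mkContinuous_norm_le _ zero_le_one _

theorem adjoint_evalCLM_apply (v : H) :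
    ContinuousLinearMap.adjoint (lp.evalCLM ℂ (fun _ : Γ => H) 2 1) v = ell2Single 1 v := by
  refine ext_inner_right ℂ fun η => ?_
  rw [ContinuousLinearMap.adjoint_inner_left, inner_ell2Single_left]
  rfl

/-- The matrix coefficient of an operator on `ℓ²(Γ, H)` at the identity. -/
noncomputable def ell2Corner (Γ H : Type*) [NormedAddCommGroup H] [InnerProductSpace ℂ H]
    [CompleteSpace H] [Group Γ] :
    (lp (fun _ : Γ => H) 2 →L[ℂ] lp (fun _ : Γ => H) 2) →ₗ[ℂ] (H →L[ℂ] H) where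
  toFun T := (lp.evalCLM ℂ (fun _ : Γ => H) 2 1).comp
    (T.comp (ContinuousLinearMap.adjoint (lp.evalCLM ℂ (fun _ : Γ => H) 2 1)))
  map_add' S T := by ext v; simp
  map_smul' c T := by ext v; simp

theorem ell2Corner_apply (T : lp (fun _ : Γ => H) 2 →L[ℂ] lp (fun _ : Γ => H) 2) (v : H) :
    ell2Corner Γ H T v = T (ell2Single 1 v) 1 := by
  rw [← adjoint_evalCLM_apply]; rfl

theorem ell2Corner_nonneg (T : lp (fun _ : Γ => H) 2 →L[ℂ] lp (fun _ : Γ => H) 2) :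
    0 ≤ ell2Corner Γ H (star T * T) := by
  rw [ContinuousLinearMap.nonneg_iff_isPositive]
  have : ell2Corner Γ H (star T * T) = ContinuousLinearMap.adjoint
      (T.comp (ContinuousLinearMap.adjoint (lp.evalCLM ℂ (fun _ : Γ => H) 2 1))) ∘SL
      (T.comp (ContinuousLinearMap.adjoint (lp.evalCLM ℂ (fun _ : Γ => H) 2 1))) := by
    rw [ContinuousLinearMap.adjoint_comp, ContinuousLinearMap.adjoint_adjoint]
    rfl
  rw [this]
  exact ContinuousLinearMap.isPositive_adjoint_comp_self _

namespace TracePreservingAction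

variable (σ : TracePreservingAction Γ Q Ω) {Λ : Subgroup Γ}

theorem ell2Corner_rep_mul (x : Q.toStarSubalgebra)
    (T : lp (fun _ : Γ => H) 2 →L[ℂ] lp (fun _ : Γ => H) 2) :
    ell2Corner Γ H (σ.rep x * T) = x * ell2Corner Γ H T := by
  ext v
  simp [ell2Corner_apply, rep_apply]

theorem ell2Corner_mul_rep (x : Q.toStarSubalgebra)
    (T : lp (fun _ : Γ => H) 2 →L[ℂ] lp (fun _ : Γ => H) 2) :
    ell2Corner Γ H (T * σ.rep x) = ell2Corner Γ H T * x := by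
  ext v
  simp [ell2Corner_apply, rep_single]

/-- For t in the commutant of Q, the operator acting by t in every coordinate commutes with x;
reading this off at the identity coordinate shows that the corner commutes with t. -/
theorem ell2Corner_mem {x : lp (fun _ : Γ => H) 2 →L[ℂ] lp (fun _ : Γ => H) 2}
    (hx : x ∈ σ.crossedProduct Λ) : ell2Corner Γ H x ∈ Q := by
  rw [← Q.commutant_commutant, VonNeumannAlgebra.mem_commutant_iff]
  intro t ht
  have h1 := VonNeumannAlgebra.mem_commutant_iff.1 (σ.ell2Const_mem_commutant (Λ := Λ) ht) x hx
  ext v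
  have h2 := congrArg (fun f => f (ell2Single 1 v) 1) h1
  simp only [mul_apply_eq_comp, ell2Const_single, ell2Const_apply] at h2
  simp [ell2Corner_apply, h2]

/-- A state on `B(ℓ²(Γ, H))` which is central for the generators of `Q ⋊ Λ` and restricts to the
trace of `Q ⋊ Γ` is central for `Q ⋊ Λ`. -/
theorem central_of_generators (hQ : IsTracialStandardForm Q Ω)
    {φ : (lp (fun _ : Γ => H) 2 →L[ℂ] lp (fun _ : Γ => H) 2) →ₗ[ℂ] ℂ} (hφ : IsOperatorState φ)
    (hM : ∀ x ∈ σ.crossedProduct (⊤ : Subgroup Γ),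
      φ x = inner ℂ (ell2Unit Γ Ω) (x (ell2Unit Γ Ω)))
    (h1 : ∀ q T, φ (σ.rep q * T) = φ (T * σ.rep q))
    (h2 : ∀ h ∈ Λ, ∀ T, φ (ell2Translation H h * T) = φ (T * ell2Translation H h)) :
    ∀ x ∈ σ.crossedProduct Λ, ∀ T, φ (x * T) = φ (T * x) := by
  set Ω' := ell2Unit Γ Ω with hΩ'
  have htr := σ.isTracialVector_crossedProduct hQ
  set G : Set (lp (fun _ : Γ => H) 2 →L[ℂ] lp (fun _ : Γ => H) 2) :=
    {y | ∃ (q : Q.toStarSubalgebra) (h : Γ), h ∈ Λ ∧ y = σ.rep q * ell2Translation H h} with hG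
  have hspan : ∀ y ∈ Submodule.span ℂ G, y ∈ σ.crossedProduct (⊤ : Subgroup Γ) ∧
      ∀ T, φ (y * T) = φ (T * y) := by
    intro y hy
    refine Submodule.span_induction (p := fun y _ => y ∈ σ.crossedProduct (⊤ : Subgroup Γ) ∧
      ∀ T, φ (y * T) = φ (T * y)) ?_ ?_ ?_ ?_ hy
    · rintro _ ⟨q, h, hh, rfl⟩
      refine ⟨mul_mem (σ.rep_mem q) (σ.translation_mem trivial), fun T => ?_⟩
      rw [mul_assoc, h1, mul_assoc, h2 h hh, mul_assoc]
    · exact ⟨zero_mem _, by simp⟩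
    · rintro y z - - ⟨hy, hy'⟩ ⟨hz, hz'⟩
      exact ⟨add_mem hy hz, fun T => by rw [add_mul, mul_add, map_add, map_add, hy', hz']⟩
    · rintro c y - ⟨hy, hy'⟩
      exact ⟨(σ.crossedProduct (⊤ : Subgroup Γ)).toStarSubalgebra.smul_mem hy c, fun T => by
        rw [smul_mul_assoc, mul_smul_comm, map_smul, map_smul, hy']⟩
  intro x hx T
  have hxM := σ.crossedProduct_mono (le_top (a := Λ)) hx
  set V : Submodule ℂ (lp (fun _ : Γ => H) 2) := (Submodule.span ℂ G).map
    ((ContinuousLinearMap.apply ℂ (lp (fun _ : Γ => H) 2) Ω' :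
      (lp (fun _ : Γ => H) 2 →L[ℂ] lp (fun _ : Γ => H) 2) →L[ℂ] lp (fun _ : Γ => H) 2) :
      (lp (fun _ : Γ => H) 2 →L[ℂ] lp (fun _ : Γ => H) 2) →ₗ[ℂ] lp (fun _ : Γ => H) 2) with hV
  -- The vector of x is supported on Λ, and the generators with h ∈ Λ are total in those
  -- coordinates.
  have hcl : x Ω' ∈ closure (V : Set (lp (fun _ : Γ => H) 2)) := by
    rw [← Submodule.topologicalClosure_coe, SetLike.mem_coe,
      ← Submodule.orthogonal_orthogonal_eq_closure, Submodule.mem_orthogonal]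
    intro ξ hξ
    rw [Submodule.mem_orthogonal] at hξ
    rw [lp.inner_eq_tsum]
    refine (tsum_congr fun g => ?_).trans tsum_zero
    by_cases hg : g ∈ Λ
    · rw [σ.inner_generator hQ (g := g) fun q =>
        hξ _ ⟨_, Submodule.subset_span ⟨q, g, hg, rfl⟩, rfl⟩, inner_zero_left]
    · rw [hΩ', σ.apply_unit_eq_zero hx hg, inner_zero_right]
  rw [← sub_eq_zero]
  set C := (φ (star T * T)).re + (φ (T * star T)).re with hC
  have hC1 : 0 ≤ (φ (star T * T)).re := (hφ.nonneg _).1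
  have hC2 : 0 ≤ (φ (T * star T)).re := by simpa using (hφ.nonneg (star T)).1
  -- Replacing x by w = x - y does not change the commutator term. By Cauchy-Schwarz, φ(wT) and
  -- φ(Tw) are controlled by φ(ww*) and φ(w*w), both equal to ‖wΩ'‖² because φ is the trace on M; no
  -- operator-norm control of y is needed.
  have hb : ∀ ε > 0, ‖φ (x * T) - φ (T * x)‖ ^ 2 ≤ 4 * C * ε ^ 2 := by
    intro ε hε
    obtain ⟨_, ⟨y, hy, rfl⟩, hd⟩ := Metric.mem_closure_iff.1 hcl ε hε
    obtain ⟨hyM, hyc⟩ := hspan y hy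
    change dist (x Ω') (y Ω') < ε at hd
    rw [dist_eq_norm, ← sub_apply] at hd
    set w := x - y with hw
    have hwM : w ∈ σ.crossedProduct (⊤ : Subgroup Γ) := sub_mem hxM hyM
    have e0 : φ (x * T) - φ (T * x) = φ (w * T) - φ (T * w) := by
      rw [hw, sub_mul, mul_sub, map_sub, map_sub, hyc]; ring
    have n1 : ∀ u ∈ σ.crossedProduct (⊤ : Subgroup Γ), (φ (star u * u)).re = ‖u Ω'‖ ^ 2 := by
      intro u hu
      rw [hM _ (mul_mem (star_mem hu) hu), mul_apply_eq_comp, inner_apply_star,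
        inner_self_eq_norm_sq_to_K]
      norm_cast
    have n2 : (φ (w * star w)).re = ‖w Ω'‖ ^ 2 := by
      have := n1 _ (star_mem hwM)
      rwa [star_star, htr.norm_star hwM] at this
    have e1 := hφ.norm_mul_sq_le w T
    have e2 := hφ.norm_mul_sq_le T w
    rw [n2] at e1
    rw [n1 _ hwM] at e2
    have e3 : ‖w Ω'‖ ^ 2 ≤ ε ^ 2 := by gcongr
    have e4 : ‖φ (w * T) - φ (T * w)‖ ^ 2 ≤ (‖φ (w * T)‖ + ‖φ (T * w)‖) ^ 2 := by
      gcongr; exact norm_sub_le _ _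
    rw [e0]
    nlinarith [sq_nonneg (‖φ (w * T)‖ - ‖φ (T * w)‖), mul_le_mul_of_nonneg_right e3 hC1,
      mul_le_mul_of_nonneg_right e3 hC2, mul_nonneg (sq_nonneg ε) hC1,
      mul_nonneg (sq_nonneg ε) hC2]
  have hlim : ‖φ (x * T) - φ (T * x)‖ ^ 2 ≤ 0 := by
    refine le_of_forall_pos_le_add fun δ hδ => ?_
    have hC0 : 0 ≤ C := add_nonneg hC1 hC2
    refine (hb (Real.sqrt (δ / (4 * C + 1))) (by positivity)).trans ?_
    rw [zero_add, Real.sq_sqrt (by positivity), mul_div_assoc', div_le_iff₀ (by positivity)]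
    nlinarith
  have h0 := le_antisymm hlim (sq_nonneg _)
  simpa using h0

/-- The corner followed by the central state of Q is already central for π(Q) and equal to the trace
on M. Averaging its conjugates by λ_h over Λ keeps both properties and adds centrality for the
translations. -/
theorem isAmenableVN_crossedProduct (hQ : IsTracialStandardForm Q Ω) (hQa : IsAmenableVN Q Ω)
    (hΛ : IsAmenableGroup Λ) : IsAmenableVN (σ.crossedProduct Λ) (ell2Unit Γ Ω) := by
  obtain ⟨φ₀, p1, p2, p3, p4⟩ := hQa
  have htr := σ.isTracialVector_crossedProduct hQ
  set ψ := φ₀ ∘ₗ ell2Corner Γ H with hψd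
  have hψ : IsOperatorState ψ := by
    refine ⟨fun T => ?_, ?_⟩
    · obtain ⟨S, hS⟩ := CStarAlgebra.nonneg_iff_eq_star_mul_self.1 (ell2Corner_nonneg T)
      rw [hψd, LinearMap.comp_apply, hS]
      exact p1 S
    · have : ell2Corner Γ H 1 = 1 := by ext v; simp [ell2Corner_apply]
      rw [hψd, LinearMap.comp_apply, this, p2]
  have hψrep : ∀ x T, ψ (σ.rep x * T) = ψ (T * σ.rep x) := by
    intro x T
    rw [hψd, LinearMap.comp_apply, LinearMap.comp_apply, σ.ell2Corner_rep_mul,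
      σ.ell2Corner_mul_rep, p4 _ x.2]
  have hψM : ∀ x ∈ σ.crossedProduct (⊤ : Subgroup Γ),
      ψ x = inner ℂ (ell2Unit Γ Ω) (x (ell2Unit Γ Ω)) := by
    intro x hx
    rw [hψd, LinearMap.comp_apply, p3 _ (σ.ell2Corner_mem hx), ell2Corner_apply, inner_unit]
    rfl
  let F : (lp (fun _ : Γ => H) 2 →L[ℂ] lp (fun _ : Γ => H) 2) →ₗ[ℝ] (Λ → ℝ) :=
    { toFun := fun T h =>
        (ψ (ell2Translation H (h : Γ)⁻¹ * T * ell2Translation H (h : Γ))).re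
      map_add' := fun S T => by ext h; simp [mul_add, add_mul]
      map_smul' := fun c T => by
        ext h
        have : c • T = (c : ℂ) • T := rfl
        rw [this, mul_smul_comm, smul_mul_assoc, map_smul]
        simp }
  have hFa : ∀ T h, F T h =
      (ψ (ell2Translation H (h : Γ)⁻¹ * T * ell2Translation H (h : Γ))).re := fun _ _ => rfl
  obtain ⟨R, r1, r2, r3⟩ := hΛ.exists_mean F (fun T => ⟨‖T‖, fun h => by
    refine (Complex.abs_re_le_norm _).trans ((hψ.norm_le _).trans ?_)
    refine (norm_mul_le _ _).trans ?_
    have e1 := norm_ell2Translation_le (H := H) (h : Γ)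
    have e2 := norm_ell2Translation_le (H := H) (h : Γ)⁻¹
    have e3 := norm_mul_le (ell2Translation H (h : Γ)⁻¹) T
    calc _ ≤ ‖T‖ * 1 := by
          gcongr
          refine e3.trans ?_
          calc _ ≤ 1 * ‖T‖ := by gcongr
            _ = ‖T‖ := one_mul _
      _ = ‖T‖ := mul_one _⟩)
  -- The mean is real, so only real parts are averaged; the complex functional is recovered as R(T)
  -- - i R(iT).
  set φ : (lp (fun _ : Γ => H) 2 →L[ℂ] lp (fun _ : Γ => H) 2) →ₗ[ℂ] ℂ :=
    Module.Dual.extendRCLike (𝕜 := ℂ) R with hφd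
  have hφa : ∀ T, φ T = (R T : ℂ) - Complex.I * (R (Complex.I • T) : ℂ) := fun T => rfl
  have hre : ∀ T, (φ T).re = R T := fun T => by rw [hφa]; simp
  have him : ∀ T, (φ T).im = - R (Complex.I • T) := fun T => by rw [hφa]; simp
  have hFI : ∀ T h, F (Complex.I • T) h =
      -(ψ (ell2Translation H (h : Γ)⁻¹ * T * ell2Translation H (h : Γ))).im := by
    intro T h
    rw [hFa, mul_smul_comm, smul_mul_assoc, map_smul]
    simp
  have hconst : ∀ T c, (∀ h : Λ,
      ψ (ell2Translation H (h : Γ)⁻¹ * T * ell2Translation H (h : Γ)) = c) → φ T = c := by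
    intro T c h
    apply Complex.ext
    · rw [hre, r2 T c.re fun k => by rw [hFa, h]]
    · rw [him, r2 (Complex.I • T) (-c.im) fun k => by rw [hFI, h], neg_neg]
  have hconj : ∀ T (h : Γ), ell2Translation H h⁻¹ * (star T * T) * ell2Translation H h =
      star (T * ell2Translation H h) * (T * ell2Translation H h) := by
    intro T h
    rw [star_mul, star_ell2Translation]
    simp only [mul_assoc]
  have hφ : IsOperatorState φ := by
    refine ⟨fun T => ⟨?_, ?_⟩, ?_⟩
    · rw [hre]
      refine r1 _ fun h => ?_
      rw [hFa, hconj]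
      exact (hψ.nonneg _).1
    · rw [him, r2 _ 0 fun h => ?_, neg_zero]
      rw [hFI, hconj, (hψ.nonneg _).2, neg_zero]
    · refine hconst 1 1 fun h => ?_
      rw [mul_one, ← ell2Translation_mul, inv_mul_cancel, ell2Translation_one, hψ.map_one]
  have hφM : ∀ x ∈ σ.crossedProduct (⊤ : Subgroup Γ),
      φ x = inner ℂ (ell2Unit Γ Ω) (x (ell2Unit Γ Ω)) := by
    intro x hx
    refine hconst _ _ fun h => ?_
    have m1 : ∀ k : Γ, ell2Translation H k ∈ σ.crossedProduct (⊤ : Subgroup Γ) := fun k =>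
      σ.translation_mem trivial
    rw [hψM _ (mul_mem (mul_mem (m1 _) hx) (m1 _)), mul_assoc,
      htr _ (m1 _) _ (mul_mem hx (m1 _)), mul_assoc, ← ell2Translation_mul, mul_inv_cancel,
      ell2Translation_one, mul_one]
  have hcomm : ∀ S T : lp (fun _ : Γ => H) 2 →L[ℂ] lp (fun _ : Γ => H) 2,
      (∀ T, R (S * T) = R (T * S)) → φ (S * T) = φ (T * S) := by
    intro S T h
    rw [hφa, hφa, h, ← mul_smul_comm, h, smul_mul_assoc]
  refine ⟨φ, hφ.nonneg, hφ.map_one, fun x hx => hφM x (σ.crossedProduct_mono le_top hx), ?_⟩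
  refine σ.central_of_generators hQ hφ hφM (fun x T => ?_) (fun k hk T => ?_)
  -- Conjugation by λ_h turns π(x) into π(σ_{h⁻¹}(x)), for which ψ is already central; the equality
  -- holds for each h, so translation by 1 is enough.
  · refine hcomm _ _ fun T => r3 _ _ 1 fun h => ?_
    rw [inv_one, one_mul, hFa, hFa]
    have e1 := σ.rep_mul_translation (σ.aut (h : Γ)⁻¹ x) (h : Γ)⁻¹
    rw [inv_inv, ← StarAlgEquiv.mul_apply, ← map_mul, mul_inv_cancel, map_one,
      StarAlgEquiv.one_apply] at e1
    have e2 := σ.rep_mul_translation x (h : Γ)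
    rw [← mul_assoc, ← e1, mul_assoc, mul_assoc, hψrep, mul_assoc, mul_assoc, mul_assoc,
      mul_assoc, e2]
  -- Moving λ_k to the other side of T shifts the averaging variable from h to k⁻¹h.
  · refine hcomm _ _ fun T => r3 _ _ ⟨k, hk⟩ fun h => ?_
    rw [hFa, hFa]
    simp only [Subgroup.coe_mul, Subgroup.coe_inv, mul_inv_rev, inv_inv]
    rw [← mul_assoc, ← ell2Translation_mul, ← mul_assoc, mul_assoc (_ * T),
      ← ell2Translation_mul, mul_inv_cancel_left]

end TracePreservingAction

end CrossedProduct

/-! ### Maximal amenability, and the group case as Q = ℂ. -/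

section CrossedProduct

variable {Γ H : Type*} [NormedAddCommGroup H] [InnerProductSpace ℂ H] [CompleteSpace H] [Group Γ]
  [Countable Γ] [TopologicalSpace.SeparableSpace H] {Q : VonNeumannAlgebra H} {Ω : H}

theorem TracePreservingAction.isMaximalAmenableIn_crossedProduct
    (σ : TracePreservingAction Γ Q Ω) {Λ : Subgroup Γ}
    {X : Type*} [TopologicalSpace X] [CompactSpace X] [T2Space X]
    [Nonempty X] [MeasurableSpace X] [BorelSpace X] [MulAction Γ X] [ContinuousConstSMul Γ X]
    (hΛ : IsSingularSubgroup Λ X) (hQ : IsTracialStandardForm Q Ω) (hQa : IsAmenableVN Q Ω) :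
    IsMaximalAmenableIn (σ.crossedProduct Λ) (σ.crossedProduct ⊤) (ell2Unit Γ Ω) where
  le := σ.crossedProduct_mono le_top
  amenable := σ.isAmenableVN_crossedProduct hQ hQa hΛ.amenable
  maximal _ hA hAM hamen := le_antisymm (σ.le_of_amenable hQ hΛ hA hAM hamen) hA

theorem ContinuousLinearMap.eq_smul_one (T : ℂ →L[ℂ] ℂ) : T = T 1 • (1 : ℂ →L[ℂ] ℂ) := by
  ext; simp

/-- The von Neumann algebra `ℂ`. -/
noncomputable def complexVN : VonNeumannAlgebra ℂ := vonNeumannGenerated ∅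

theorem mem_complexVN (T : ℂ →L[ℂ] ℂ) : T ∈ complexVN := by
  refine (mem_vonNeumannGenerated_iff (by simp)).2 fun t _ => ?_
  rw [T.eq_smul_one, mul_smul_comm, smul_mul_assoc, one_mul, mul_one]

theorem isTracialStandardForm_complexVN : IsTracialStandardForm complexVN 1 where
  norm_eq_one := norm_one
  trace x _ y _ := by
    rw [x.eq_smul_one, mul_smul_comm, smul_mul_assoc, one_mul, mul_one]
  faithful x _ h := by
    rw [mul_apply_eq_comp, inner_apply_star, inner_self_eq_zero] at h
    rw [x.eq_smul_one, h]
    exact zero_smul ℂ _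
  cyclic := by
    refine dense_univ.mono fun v _ => ⟨v • (1 : ℂ →L[ℂ] ℂ), mem_complexVN _, by simp⟩

theorem isAmenableVN_complexVN : IsAmenableVN complexVN 1 := by
  refine ⟨(ContinuousLinearMap.apply ℂ ℂ (1 : ℂ) : (ℂ →L[ℂ] ℂ) →L[ℂ] ℂ), fun T => ?_, by simp,
    fun x _ => by simp, fun x _ T => ?_⟩
  · have : (star T * T) 1 = inner ℂ (T 1) (T 1) := by
      rw [← inner_apply_star]; simp
    change 0 ≤ ((star T * T) 1).re ∧ ((star T * T) 1).im = 0
    rw [this, inner_self_eq_norm_sq_to_K]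
    have h2 : ((‖T 1‖ : ℝ) : ℂ) ^ 2 = ((‖T 1‖ ^ 2 : ℝ) : ℂ) := by push_cast; rfl
    refine ⟨?_, ?_⟩
    · exact (congrArg Complex.re h2).symm ▸ (by rw [Complex.ofReal_re]; positivity)
    · exact (congrArg Complex.im h2).trans (Complex.ofReal_im _)
  · rw [x.eq_smul_one, mul_smul_comm, smul_mul_assoc, one_mul, mul_one]

/-- The trivial action on `ℂ`. -/
noncomputable def trivialAction (Γ : Type*) [Group Γ] : TracePreservingAction Γ complexVN 1 where
  aut := 1
  trace_aut _ _ := rfl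

/-- For Q = ℂ with trivial action π takes scalar values, which add nothing to the generators. -/
theorem crossedProduct_trivialAction (Λ : Subgroup Γ) :
    (trivialAction Γ).crossedProduct Λ = groupVN Λ := by
  have hS : ∀ s ∈ {T | ∃ h ∈ Λ, T = ell2Translation ℂ h},
      star s ∈ {T | ∃ h ∈ Λ, T = ell2Translation ℂ h} := by
    rintro _ ⟨h, hh, rfl⟩
    exact ⟨h⁻¹, inv_mem hh, star_ell2Translation h⟩
  refine le_antisymm (fun x hx => ?_)
    (vonNeumannGenerated_mono hS ((trivialAction Γ).star_mem_generators Λ) Set.subset_union_right)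
  refine (mem_vonNeumannGenerated_iff hS).2 fun t ht => ?_
  refine (mem_vonNeumannGenerated_iff ((trivialAction Γ).star_mem_generators Λ)).1 hx t ?_
  rintro s (⟨y, rfl⟩ | hs)
  · have : (trivialAction Γ).rep y = (y : ℂ →L[ℂ] ℂ) 1 • 1 := by
      ext ξ g
      change (y : ℂ →L[ℂ] ℂ) (ξ g) = (y : ℂ →L[ℂ] ℂ) 1 * ξ g
      conv_lhs => rw [(y : ℂ →L[ℂ] ℂ).eq_smul_one]
      simp
    rw [this, mul_smul_comm, smul_mul_assoc, one_mul, mul_one]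
  · exact ht s hs

theorem isMaximalAmenableIn_groupVN {Λ : Subgroup Γ}
    {X : Type*} [TopologicalSpace X] [CompactSpace X] [T2Space X]
    [Nonempty X] [MeasurableSpace X] [BorelSpace X] [MulAction Γ X] [ContinuousConstSMul Γ X]
    (hΛ : IsSingularSubgroup Λ X) :
    IsMaximalAmenableIn (groupVN Λ) (groupVN (⊤ : Subgroup Γ)) (ell2Unit Γ (1 : ℂ)) := by
  rw [← crossedProduct_trivialAction, ← crossedProduct_trivialAction]
  exact (trivialAction Γ).isMaximalAmenableIn_crossedProduct hΛ isTracialStandardForm_complexVN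
    isAmenableVN_complexVN

end CrossedProduct

/-! ### Class averages and maximal hyperfiniteness. -/

section Relations

open MeasureTheory Filter Topology

/-- A pointwise limit, along an ultrafilter, of pointwise bounded linear functionals. -/
theorem exists_ultralimit {V : Type*} [AddCommGroup V] [Module ℝ V] (F : ℕ → V →ₗ[ℝ] ℝ)
    (hF : ∀ v, ∃ C, ∀ n, |F n v| ≤ C) :
    ∃ L : V →ₗ[ℝ] ℝ, ∀ v, Tendsto (fun n => F n v) (hyperfilter ℕ) (𝓝 (L v)) := by
  have h : ∀ v, ∃ a : ℝ, Tendsto (fun n => F n v) (hyperfilter ℕ) (𝓝 a) := by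
    intro v
    obtain ⟨C, hC⟩ := hF v
    obtain ⟨a, -, ha⟩ := (isCompact_Icc (a := -C) (b := C)).ultrafilter_le_nhds
      ((hyperfilter ℕ).map fun n => F n v)
      (by
        rw [le_principal_iff]
        exact Filter.mem_map.2 (Eventually.of_forall fun n => abs_le.1 (hC n)))
    exact ⟨a, ha⟩
  choose L hL using h
  refine ⟨⟨⟨L, fun v w => ?_⟩, fun c v => ?_⟩, hL⟩
  · refine tendsto_nhds_unique (hL (v + w)) ?_
    simp only [map_add]
    exact (hL v).add (hL w)
  · refine tendsto_nhds_unique (hL (c • v)) ?_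
    simp only [map_smul]
    exact (hL v).const_smul c

variable {Γ Y X : Type*} [Group Γ] [MulAction Γ Y] [TopologicalSpace X] [CompactSpace X]
  [MulAction Γ X] [ContinuousConstSMul Γ X]

open Classical in
/-- The average of `f (g⁻¹ x₀)` over all `g` such that `g y` is `E`-equivalent to `y`. -/
noncomputable def classAverage (E : Setoid Y) (x₀ : X) (f : C(X, ℝ)) (y : Y) : ℝ :=
  (∑' g : Γ, if E y (g • y) then f (g⁻¹ • x₀) else 0) / ∑' g : Γ, if E y (g • y) then (1 : ℝ) else 0

theorem exists_classAverage_eq (E : Setoid Y) (x₀ : X) {y : Y}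
    (hfin : {g : Γ | E y (g • y)}.Finite) :
    ∃ s : Finset Γ, s.Nonempty ∧ ∀ f : C(X, ℝ),
      classAverage (Γ := Γ) E x₀ f y = (∑ g ∈ s, f (g⁻¹ • x₀)) / s.card := by
  classical
  refine ⟨hfin.toFinset, ⟨1, by simp⟩, fun f => ?_⟩
  rw [classAverage, tsum_eq_sum (s := hfin.toFinset), tsum_eq_sum (s := hfin.toFinset)]
  · congr 1
    · exact Finset.sum_congr rfl fun g hg => if_pos (by simpa using hg)
    · rw [Finset.sum_congr rfl fun g hg => if_pos (by simpa using hg)]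
      simp
  · intro g hg; exact if_neg (by simpa using hg)
  · intro g hg; exact if_neg (by simpa using hg)

/-- When y and h y are equivalent, k ↦ k h matches the index set at h y with the one at y. The
inverse in f(g⁻¹ x₀) turns this right translation into the left translate of f. -/
theorem classAverage_smul (E : Setoid Y) (x₀ : X) (f : C(X, ℝ)) {y : Y} {h : Γ}
    (hy : E y (h • y)) :
    classAverage (Γ := Γ) E x₀ f (h • y) = classAverage (Γ := Γ) E x₀ (f.translate h) y := by
  classical
  have key : ∀ k : Γ, E (h • y) (k • h • y) ↔ E y ((k * h) • y) := fun k => by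
    rw [mul_smul]
    exact ⟨fun h1 => E.trans hy h1, fun h1 => E.trans (E.symm hy) h1⟩
  rw [classAverage, classAverage]
  congr 1
  · rw [← (Equiv.mulRight h).tsum_eq
      (fun g : Γ => if E y (g • y) then f.translate h (g⁻¹ • x₀) else 0)]
    refine tsum_congr fun k => ?_
    have e : f.translate h ((k * h)⁻¹ • x₀) = f (k⁻¹ • x₀) := by
      rw [ContinuousMap.translate_apply, smul_smul, mul_inv_rev, mul_inv_cancel_left]
    rw [Equiv.coe_mulRight, e]
    by_cases hk : E y ((k * h) • y)
    · rw [if_pos ((key k).2 hk), if_pos hk]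
    · rw [if_neg fun h' => hk ((key k).1 h'), if_neg hk]
  · rw [← (Equiv.mulRight h).tsum_eq (fun g : Γ => if E y (g • y) then (1 : ℝ) else 0)]
    refine tsum_congr fun k => ?_
    rw [Equiv.coe_mulRight]
    by_cases hk : E y ((k * h) • y)
    · rw [if_pos ((key k).2 hk), if_pos hk]
    · rw [if_neg fun h' => hk ((key k).1 h'), if_neg hk]

variable [Countable Γ] [MeasurableSpace Y] [MeasurableConstSMul Γ Y]

theorem IsMeasurableRel.measurableSet_smul {E : Setoid Y} (hE : IsMeasurableRel E) (g : Γ) :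
    MeasurableSet {y | E y (g • y)} := by
  have : Measurable fun y : Y => (y, g • y) := measurable_id.prodMk (measurable_const_smul g)
  exact this hE

/-- Series over all of Γ make this hold without any finiteness; where infinitely many g qualify, the
divergent denominator is 0 and so is the quotient. -/
theorem measurable_classAverage {E : Setoid Y} (hE : IsMeasurableRel E) (x₀ : X) (f : C(X, ℝ)) :
    Measurable (classAverage (Γ := Γ) E x₀ f : Y → ℝ) := by
  refine Measurable.div (Measurable.tsum fun g => ?_) (Measurable.tsum fun g => ?_)
  · exact Measurable.ite (hE.measurableSet_smul g) measurable_const measurable_const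
  · exact Measurable.ite (hE.measurableSet_smul g) measurable_const measurable_const

variable {ν : Measure Y} [IsProbabilityMeasure ν] [SMulInvariantMeasure Γ Y ν]

section Averages

variable {E : Setoid Y}

theorem abs_classAverage_le {y : Y} (hfin : {g : Γ | E y (g • y)}.Finite) (x₀ : X) (f : C(X, ℝ)) :
    |classAverage (Γ := Γ) E x₀ f y| ≤ ‖f‖ := by
  obtain ⟨s, hs, h⟩ := exists_classAverage_eq E x₀ hfin
  have hpos : (0 : ℝ) < s.card := by exact_mod_cast hs.card_pos
  rw [h, abs_div, Nat.abs_cast, div_le_iff₀ hpos]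
  refine (Finset.abs_sum_le_sum_abs _ _).trans ?_
  refine (Finset.sum_le_card_nsmul s _ ‖f‖ fun g _ => f.norm_coe_le_norm _).trans ?_
  rw [nsmul_eq_mul, mul_comm]

theorem classAverage_nonneg {y : Y} (hfin : {g : Γ | E y (g • y)}.Finite) (x₀ : X) {f : C(X, ℝ)}
    (hf : ∀ x, 0 ≤ f x) : 0 ≤ classAverage (Γ := Γ) E x₀ f y := by
  obtain ⟨s, hs, h⟩ := exists_classAverage_eq E x₀ hfin
  rw [h]
  exact div_nonneg (Finset.sum_nonneg fun g _ => hf _) (Nat.cast_nonneg _)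

theorem integrable_classAverage (hE : IsMeasurableRel E)
    (hfin : ∀ᵐ y ∂ν, {g : Γ | E y (g • y)}.Finite) (x₀ : X) (f : C(X, ℝ)) :
    Integrable (classAverage (Γ := Γ) E x₀ f) ν := by
  refine Integrable.of_bound (measurable_classAverage hE x₀ f).aestronglyMeasurable ‖f‖ ?_
  filter_upwards [hfin] with y hy
  exact abs_classAverage_le hy x₀ f

variable (hE : IsMeasurableRel E) (hfin : ∀ᵐ y ∂ν, {g : Γ | E y (g • y)}.Finite) (x₀ : X)

/-- The integral of the averages of `f`, as a functional of `f`. -/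
noncomputable def averageFunctional : C(X, ℝ) →ₗ[ℝ] ℝ where
  toFun f := ∫ y, classAverage (Γ := Γ) E x₀ f y ∂ν
  map_add' f f' := by
    rw [← integral_add (integrable_classAverage hE hfin x₀ f)
      (integrable_classAverage hE hfin x₀ f')]
    refine integral_congr_ae ?_
    filter_upwards [hfin] with y hy
    obtain ⟨s, hs, h⟩ := exists_classAverage_eq E x₀ hy
    simp only [h, ContinuousMap.add_apply, Finset.sum_add_distrib, add_div]
  map_smul' c f := by
    rw [smul_eq_mul, ← integral_const_mul]
    refine integral_congr_ae ?_
    filter_upwards [hfin] with y hy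
    obtain ⟨s, hs, h⟩ := exists_classAverage_eq E x₀ hy
    simp only [h, ContinuousMap.smul_apply, smul_eq_mul, ← Finset.mul_sum, mul_div_assoc,
      RingHom.id_apply]

theorem averageFunctional_apply (f : C(X, ℝ)) :
    averageFunctional hE hfin x₀ f = ∫ y, classAverage (Γ := Γ) E x₀ f y ∂ν := rfl

theorem averageFunctional_nonneg {f : C(X, ℝ)} (hf : ∀ x, 0 ≤ f x) :
    0 ≤ averageFunctional hE hfin x₀ f := by
  refine integral_nonneg_of_ae ?_
  filter_upwards [hfin] with y hy
  exact classAverage_nonneg hy x₀ hf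

theorem averageFunctional_one : averageFunctional hE hfin x₀ 1 = 1 := by
  rw [averageFunctional_apply, integral_congr_ae (g := fun _ => (1 : ℝ))]
  · simp
  · filter_upwards [hfin] with y hy
    obtain ⟨s, hs, h⟩ := exists_classAverage_eq E x₀ hy
    have hpos : (s.card : ℝ) ≠ 0 := by exact_mod_cast hs.card_pos.ne'
    rw [h]
    simp [hpos]

theorem abs_averageFunctional_le (f : C(X, ℝ)) : |averageFunctional hE hfin x₀ f| ≤ ‖f‖ := by
  rw [averageFunctional_apply, ← Real.norm_eq_abs]
  refine (norm_integral_le_of_norm_le_const (C := ‖f‖) ?_).trans (by simp)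
  filter_upwards [hfin] with y hy
  exact abs_classAverage_le hy x₀ f

theorem integral_smul_eq (F : Y → ℝ) (g : Γ) : ∫ y, F (g • y) ∂ν = ∫ y, F y ∂ν :=
  (measurePreserving_smul g ν).integral_comp (measurableEmbedding_const_smul g) F

/-- By invariance of ν the average of f may be taken at g y. It equals the average of the translate
at y whenever y and g y are equivalent; elsewhere each is at most ‖f‖ almost everywhere. -/
theorem abs_averageFunctional_translate_sub_le (f : C(X, ℝ)) (g : Γ) :
    |averageFunctional hE hfin x₀ (f.translate g) - averageFunctional hE hfin x₀ f| ≤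
      2 * ‖f‖ * ν.real {y | E y (g • y)}ᶜ := by
  have hint := integrable_classAverage hE hfin x₀ f
  have hint' := integrable_classAverage hE hfin x₀ (f.translate g)
  have hints : Integrable (fun y => classAverage (Γ := Γ) E x₀ f (g • y)) ν :=
    (measurePreserving_smul g ν).integrable_comp_of_integrable hint
  have hfin' : ∀ᵐ y ∂ν, {k : Γ | E (g • y) (k • g • y)}.Finite :=
    (measurePreserving_smul g ν).quasiMeasurePreserving.ae hfin
  have hms := (hE.measurableSet_smul g).compl
  have hn : ‖f.translate g‖ ≤ ‖f‖ :=
    (ContinuousMap.norm_le _ (norm_nonneg f)).2 fun x => f.norm_coe_le_norm _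
  rw [averageFunctional_apply, averageFunctional_apply,
    ← integral_smul_eq (classAverage (Γ := Γ) E x₀ f) g, ← integral_sub hint' hints,
    ← Real.norm_eq_abs]
  have heq : ∫ y, (classAverage (Γ := Γ) E x₀ (f.translate g) y -
      classAverage (Γ := Γ) E x₀ f (g • y)) ∂ν = ∫ y in {y | E y (g • y)}ᶜ,
        (classAverage (Γ := Γ) E x₀ (f.translate g) y -
      classAverage (Γ := Γ) E x₀ f (g • y)) ∂ν := by
    rw [← integral_indicator hms]
    congr 1
    ext y
    by_cases hy : E y (g • y)
    · rw [Set.indicator_of_notMem (by simpa using hy), classAverage_smul E x₀ f hy, sub_self]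
    · rw [Set.indicator_of_mem (by simpa using hy)]
  rw [heq]
  refine norm_setIntegral_le_of_norm_le_const_ae' (measure_lt_top _ _) ?_
  filter_upwards [hfin, hfin'] with y hy hy' _
  rw [Real.norm_eq_abs]
  refine (abs_sub _ _).trans ?_
  have h1 := abs_classAverage_le hy x₀ (f.translate g)
  have h2 := abs_classAverage_le hy' x₀ f
  linarith

/-- Where y and g y are equivalent, the average of f(g·) at y and that of 1 - f at g y add up to
exactly 1. -/
theorem measureReal_le_averageFunctional {f : C(X, ℝ)} (hf : ∀ x, 0 ≤ f x ∧ f x ≤ 1) (g : Γ) :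
    ν.real {y | E y (g • y)} ≤
      averageFunctional hE hfin x₀ (f.translate g) + averageFunctional hE hfin x₀ (1 - f) := by
  set B := {y | E y (g • y)} with hB
  have hBm : MeasurableSet B := hE.measurableSet_smul g
  have hfin' : ∀ᵐ y ∂ν, {k : Γ | E (g • y) (k • g • y)}.Finite :=
    (measurePreserving_smul g ν).quasiMeasurePreserving.ae hfin
  have hi1 := integrable_classAverage hE hfin x₀ (f.translate g)
  have hi2 : Integrable (fun y => classAverage (Γ := Γ) E x₀ (1 - f) (g • y)) ν :=
    (measurePreserving_smul g ν).integrable_comp_of_integrable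
      (integrable_classAverage hE hfin x₀ (1 - f))
  have h1 : ν.real B = ∫ y, B.indicator (fun _ => (1 : ℝ)) y ∂ν := by
    rw [integral_indicator hBm]; simp
  rw [h1, averageFunctional_apply, averageFunctional_apply,
    ← integral_smul_eq (classAverage (Γ := Γ) E x₀ (1 - f)) g, ← integral_add hi1 hi2]
  refine integral_mono_ae ((integrable_const (1 : ℝ)).indicator hBm) (hi1.add hi2) ?_
  filter_upwards [hfin, hfin'] with y hy hy'
  by_cases hyB : E y (g • y)
  · have hyB' : y ∈ B := hyB
    rw [Set.indicator_of_mem hyB']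
    rw [classAverage_smul E x₀ _ hyB]
    obtain ⟨s, hs, h⟩ := exists_classAverage_eq E x₀ hy
    have hpos : (s.card : ℝ) ≠ 0 := by exact_mod_cast hs.card_pos.ne'
    rw [h, h, ← add_div, ← Finset.sum_add_distrib]
    simp [hpos]
  · have hyB' : y ∉ B := hyB
    rw [Set.indicator_of_notMem hyB']
    refine add_nonneg (classAverage_nonneg hy x₀ fun x => (hf _).1)
      (classAverage_nonneg hy' x₀ fun x => ?_)
    simpa using (hf x).2

end Averages

variable [T2Space X] [Nonempty X] [MeasurableSpace X] [BorelSpace X] {Λ : Subgroup Γ}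

/-- A hyperfinite relation which contains the orbits of a singular subgroup is not larger. -/
theorem IsSingularSubgroup.measure_eq_zero (hΛ : IsSingularSubgroup Λ X) {F : ℕ → Setoid Y}
    (hF : ∀ n, IsMeasurableRel (F n)) (hmono : ∀ n x y, F n x y → F (n + 1) x y)
    (hfin : ∀ n, ∀ᵐ y ∂ν, {g : Γ | F n y (g • y)}.Finite)
    (hS : ∀ h ∈ Λ, ∀ᵐ y ∂ν, ∃ n, F n y (h • y)) {g : Γ} (hg : g ∉ Λ) :
    ∀ᵐ y ∂ν, ∀ n, ¬ F n y (g • y) := by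
  obtain ⟨x₀⟩ := ‹Nonempty X›
  obtain ⟨L, hL⟩ := exists_ultralimit (fun n => averageFunctional (hF n) (hfin n) x₀)
    (fun f => ⟨‖f‖, fun n => abs_averageFunctional_le _ _ _ f⟩)
  have hmonotone : ∀ (k : Γ), Monotone fun n => {y | F n y (k • y)} := fun k =>
    monotone_nat_of_le_succ fun n y hy => hmono n _ _ hy
  have hpos : ∀ f : C(X, ℝ), (∀ x, 0 ≤ f x) → 0 ≤ L f := fun f hf =>
    ge_of_tendsto' (hL f) fun n => averageFunctional_nonneg _ _ _ hf
  have h1 : L 1 = 1 := by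
    refine tendsto_nhds_unique (hL 1) ?_
    simp only [averageFunctional_one]
    exact tendsto_const_nhds
  have hinv : ∀ h ∈ Λ, ∀ f : C(X, ℝ), L (f.translate h) = L f := by
    intro h hh f
    have hz : Tendsto (fun n => 2 * ‖f‖ * ν.real {y | F n y (h • y)}ᶜ) atTop (𝓝 0) := by
      have e1 : Tendsto (fun n => ν {y | F n y (h • y)}ᶜ) atTop
          (𝓝 (ν (⋂ n, {y | F n y (h • y)}ᶜ))) :=
        tendsto_measure_iInter_atTop
          (fun n => ((hF n).measurableSet_smul h).compl.nullMeasurableSet)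
          (fun n m hnm => Set.compl_subset_compl.2 (hmonotone h hnm)) ⟨0, measure_ne_top _ _⟩
      have e2 : ν (⋂ n, {y | F n y (h • y)}ᶜ) = 0 := by
        have := hS h hh
        rw [ae_iff] at this
        refine measure_mono_null (fun y hy => ?_) this
        simpa using hy
      rw [e2] at e1
      have e3 := (ENNReal.tendsto_toReal ENNReal.zero_ne_top).comp e1
      have e4 := e3.const_mul (2 * ‖f‖)
      simpa [Function.comp_def, measureReal_def] using e4
    have hd : Tendsto (fun n => averageFunctional (hF n) (hfin n) x₀ (f.translate h) -
        averageFunctional (hF n) (hfin n) x₀ f) (hyperfilter ℕ) (𝓝 0) :=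
      (squeeze_zero_norm (fun n => abs_averageFunctional_translate_sub_le _ _ x₀ f h) hz).mono_left
        Nat.hyperfilter_le_atTop
    have := tendsto_nhds_unique ((hL (f.translate h)).sub (hL f)) hd
    linarith
  -- The function f separates only the limit `L`; some n ≥ m has both averages below ε as well, and
  -- F_n contains F_m.
  have hle : ∀ m, ∀ ε > 0, ν.real {y | F m y (g • y)} ≤ 2 * ε := by
    intro m ε hε
    obtain ⟨f, hf, hf1, hf2⟩ := hΛ.exists_separating L hpos h1 hinv hg hε
    have e1 := (hL (1 - f)).eventually (gt_mem_nhds hf1)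
    have e2 := (hL (f.translate g)).eventually (gt_mem_nhds hf2)
    have e3 : ∀ᶠ n in (hyperfilter ℕ : Filter ℕ), m ≤ n :=
      Nat.hyperfilter_le_atTop (eventually_ge_atTop m)
    obtain ⟨n, hn1, hn2, hn3⟩ := (e1.and (e2.and e3)).exists
    have e4 := measureReal_le_averageFunctional (hF n) (hfin n) x₀ hf g
    have e5 : ν.real {y | F m y (g • y)} ≤ ν.real {y | F n y (g • y)} :=
      measureReal_mono (hmonotone g hn3)
    linarith
  rw [ae_all_iff]
  intro m
  rw [ae_iff]
  simp only [not_not]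
  have h0 : ν.real {y | F m y (g • y)} ≤ 0 := by
    refine le_of_forall_pos_le_add fun δ hδ => ?_
    have := hle m (δ / 2) (by positivity)
    linarith
  have h2 := le_antisymm h0 measureReal_nonneg
  rwa [measureReal_eq_zero_iff] at h2

/-- Freeness turns finite classes into finite sets of group elements, so the averages are defined. A
pair in T has the form (x, g x), and g ∉ Λ is excluded almost everywhere, for all of the countably
many g at once. -/
theorem IsSingularSubgroup.maximal_hyperfinite (hΛ : IsSingularSubgroup Λ X)
    (hfree : ∀ g : Γ, g ≠ 1 → ∀ᵐ y ∂ν, g • y ≠ y) (T : Setoid Y)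
    (hST : ∀ᵐ x ∂ν, ∀ y, MulAction.orbitRel Λ Y x y → T x y)
    (hTR : ∀ᵐ x ∂ν, ∀ y, T x y → MulAction.orbitRel Γ Y x y) (hT : IsHyperfiniteRel T ν) :
    ∀ᵐ x ∂ν, ∀ y, T x y ↔ MulAction.orbitRel Λ Y x y := by
  obtain ⟨F, hF, hFf, hmono, hFT⟩ := hT
  have hfree' : ∀ᵐ y ∂ν, ∀ g : Γ, g ≠ 1 → g • y ≠ y := by
    rw [ae_all_iff]
    intro g
    by_cases hg : g = 1
    · simp [hg]
    · filter_upwards [hfree g hg] with y hy _ using hy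
  have hfin : ∀ n, ∀ᵐ y ∂ν, {g : Γ | F n y (g • y)}.Finite := by
    intro n
    filter_upwards [hfree'] with y hy
    refine Set.Finite.preimage (f := fun g : Γ => g • y) ?_ (hFf n y)
    intro g _ k _ hgk
    by_contra hne
    refine hy (k⁻¹ * g) (fun h => hne (inv_mul_eq_one.1 h).symm) ?_
    simp only at hgk
    rw [mul_smul, hgk, inv_smul_smul]
  have hS : ∀ h ∈ Λ, ∀ᵐ y ∂ν, ∃ n, F n y (h • y) := by
    intro h hh
    filter_upwards [hST, hFT] with y hy hy'
    exact (hy' _).1 (hy _ (Setoid.symm' _ ⟨⟨h, hh⟩, rfl⟩))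
  have hall : ∀ᵐ y ∂ν, ∀ g : Γ, g ∉ Λ → ∀ n, ¬ F n y (g • y) := by
    rw [ae_all_iff]
    intro g
    by_cases hg : g ∈ Λ
    · simp [hg]
    · filter_upwards [hΛ.measure_eq_zero hF hmono hfin hS hg] with y hy _ using hy
  filter_upwards [hST, hTR, hFT, hall] with x h1 h2 h3 h4 y
  refine ⟨fun hxy => ?_, h1 y⟩
  obtain ⟨g, hg⟩ := h2 y hxy
  simp only at hg
  have hy : y = g⁻¹ • x := by rw [← hg, inv_smul_smul]
  obtain ⟨n, hn⟩ := (h3 y).1 hxy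
  by_contra hcon
  have hgΛ : g⁻¹ ∉ Λ := by
    intro hgm
    refine hcon ⟨⟨g, by simpa using inv_mem hgm⟩, hg⟩
  rw [hy] at hn
  exact h4 _ hgΛ n hn

end Relations

/-! ### From invariant means to Følner sets. -/

section Folner

variable {G : Type*} [Group G]

/-- Reiter's condition: an amenable group has almost invariant finitely supported probability
vectors. -/
theorem IsAmenableGroup.exists_almost_invariant (hG : IsAmenableGroup G) (S : Finset G) {ε : ℝ}
    (hε : 0 < ε) :
    ∃ p : G →₀ ℝ, (∀ x, 0 ≤ p x) ∧ (p.sum fun _ a => a) = 1 ∧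
      ∀ k ∈ S, ∀ t : Finset G, ∑ x ∈ t, |p (k * x) - p x| < ε := by
  classical
  let δ : G → lp (fun _ : G => ℝ) 1 := fun x => lp.single 1 x 1
  have hδ : ∀ x y, δ x y = if y = x then 1 else 0 := fun x y => by
    simp [δ, Pi.single_apply]
  have hδn : ∀ x, ‖δ x‖ = 1 := fun x => by
    simp only [δ]
    rw [lp.norm_single (E := fun _ : G => ℝ) (p := 1) (by norm_num)]
    simp
  let d : G → (S → lp (fun _ : G => ℝ) 1) := fun x k => δ ((k : G)⁻¹ * x) - δ x
  let D : (G →₀ ℝ) →ₗ[ℝ] (S → lp (fun _ : G => ℝ) 1) := Finsupp.linearCombination ℝ d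
  have hD : ∀ p k x, D p k x = p ((k : G) * x) - p x := by
    intro p k x
    induction p using Finsupp.induction_linear with
    | zero => simp
    | add f g hf hg =>
      rw [map_add, Pi.add_apply, lp.coeFn_add, Pi.add_apply, hf, hg, Finsupp.add_apply,
        Finsupp.add_apply]
      ring
    | single y a =>
      simp only [D, Finsupp.linearCombination_single, Pi.smul_apply, lp.coeFn_smul, d,
        lp.coeFn_sub, Pi.sub_apply, hδ, Finsupp.single_apply, smul_eq_mul]
      have h1 : (x = (k : G)⁻¹ * y) ↔ (y = k * x) := by
        rw [eq_inv_mul_iff_mul_eq, eq_comm]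
      have h2 : x = y ↔ y = x := eq_comm
      simp only [h1, h2]
      split_ifs <;> simp
  by_contra hcon
  push Not at hcon
  let C : Set (G →₀ ℝ) := {p | (∀ x, 0 ≤ p x) ∧ (p.sum fun _ a => a) = 1}
  have hsum : ∀ p : G →₀ ℝ, (p.sum fun _ a => a) =
      Finsupp.linearCombination ℝ (fun _ : G => (1 : ℝ)) p := fun p => by
    simp [Finsupp.linearCombination_apply]
  have hC : Convex ℝ C := by
    intro p hp q hq a b ha hb hab
    refine ⟨fun x => ?_, ?_⟩
    · simp only [Finsupp.add_apply, Finsupp.smul_apply, smul_eq_mul]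
      exact add_nonneg (mul_nonneg ha (hp.1 x)) (mul_nonneg hb (hq.1 x))
    · have h1 := hp.2
      have h2 := hq.2
      rw [hsum] at h1 h2 ⊢
      rw [map_add, map_smul, map_smul, h1, h2]
      simpa using hab
  -- Without almost invariant vectors, the convex set of difference families stays away from 0 in
  -- ℓ¹(G)^S, so Hahn–Banach applies.
  have hdisj : Disjoint (Metric.ball (0 : S → lp (fun _ : G => ℝ) 1) ε) (D '' C) := by
    rw [Set.disjoint_left]
    rintro _ hb ⟨p, hp, rfl⟩
    obtain ⟨k, hk, t, ht⟩ := hcon p hp.1 hp.2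
    rw [mem_ball_zero_iff] at hb
    have h1 : ‖D p ⟨k, hk⟩‖ < ε := (norm_le_pi_norm _ _).trans_lt hb
    have h2 : ∑ x ∈ t, |p (k * x) - p x| ≤ ‖D p ⟨k, hk⟩‖ := by
      have := lp.sum_rpow_le_norm_rpow (p := 1) (by norm_num) (D p ⟨k, hk⟩) t
      simpa [hD] using this
    linarith
  obtain ⟨Φ, u, h1, h2⟩ := geometric_hahn_banach_open (convex_ball _ _) Metric.isOpen_ball
    (hC.linear_image D) hdisj
  have hu : 0 < u := by simpa using h1 0 (Metric.mem_ball_self hε)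
  let f : S → G → ℝ := fun k x => Φ (Pi.single k (δ x))
  have hf : ∀ k x, |f k x| ≤ ‖Φ‖ := fun k x => by
    refine (Φ.le_opNorm _).trans ?_
    have : ‖(Pi.single k (δ x) : S → lp (fun _ : G => ℝ) 1)‖ ≤ 1 := by
      rw [pi_norm_le_iff_of_nonneg zero_le_one]
      intro j
      by_cases hj : j = k
      · subst hj; simp [hδn]
      · simp [Pi.single_eq_of_ne hj]
    simpa using mul_le_mul_of_nonneg_left this (norm_nonneg Φ)
  have hle : ∀ x, u ≤ ∑ k : S, (f k ((k : G)⁻¹ * x) - f k x) := by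
    intro x
    have h3 := h2 (D (Finsupp.single x 1)) ⟨Finsupp.single x 1, ⟨fun y => by
      rw [Finsupp.single_apply]; split_ifs <;> simp, by simp⟩, rfl⟩
    have h4 : D (Finsupp.single x 1) =
        ∑ k : S, (Pi.single k (δ ((k : G)⁻¹ * x)) - Pi.single k (δ x)) := by
      simp only [D, Finsupp.linearCombination_single, one_smul]
      ext1 j
      rw [Finset.sum_apply, Finset.sum_eq_single j]
      · simp [d]
      · intro k _ hk
        simp [Pi.single_eq_of_ne (Ne.symm hk)]
      · simp
    rw [h4, map_sum] at h3
    simpa [f, map_sub] using h3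
  let I : lp (fun _ : G => ℝ) ∞ →ₗ[ℝ] (G → ℝ) :=
    { toFun := fun v => v
      map_add' := fun _ _ => rfl
      map_smul' := fun _ _ => rfl }
  obtain ⟨R, r1, r2, r3⟩ := hG.exists_mean I (fun v => ⟨‖v‖, fun g =>
    lp.norm_apply_le_norm ENNReal.top_ne_zero v g⟩)
  have hmem : ∀ (k : S) (h : G), Memℓp (E := fun _ : G => ℝ) (fun x => f k (h * x)) ∞ :=
    fun k h => memℓp_infty ⟨‖Φ‖, by rintro _ ⟨x, rfl⟩; exact hf _ _⟩
  let w : S → G → lp (fun _ : G => ℝ) ∞ := fun k h => ⟨fun x => f k (h * x), hmem k h⟩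
  have hw : ∀ k h, R (w k h) = R (w k 1) := fun k h =>
    r3 _ _ h⁻¹ fun g => by
      change f k (h * g) = f k (1 * (h⁻¹⁻¹ * g))
      rw [inv_inv, one_mul]
  have hone : Memℓp (E := fun _ : G => ℝ) (fun _ => u) ∞ :=
    memℓp_infty ⟨|u|, by rintro _ ⟨g, rfl⟩; simp⟩
  -- The separating functional yields bounded functions f_k whose summed translation differences are
  -- everywhere at least u > 0; the invariant mean sends these differences to 0, a contradiction.
  have hfin := r1 (∑ k : S, (w k (k : G)⁻¹ - w k 1) - ⟨fun _ => u, hone⟩) (fun g => by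
    have h5 : I (∑ k : S, (w k (k : G)⁻¹ - w k 1) - ⟨fun _ => u, hone⟩) g =
        ∑ k : S, (f k ((k : G)⁻¹ * g) - f k g) - u := by
      rw [map_sub, map_sum, Pi.sub_apply, Finset.sum_apply]
      refine congrArg₂ _ (Finset.sum_congr rfl fun k _ => ?_) rfl
      change f k ((k : G)⁻¹ * g) - f k (1 * g) = _
      rw [one_mul]
    rw [h5]
    exact sub_nonneg.2 (hle g))
  rw [map_sub, map_sum, r2 ⟨fun _ => u, hone⟩ u fun _ => rfl] at hfin
  simp only [map_sub, hw, sub_self, Finset.sum_const_zero] at hfin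
  linarith

open MeasureTheory in
/-- The Følner condition. -/
theorem IsAmenableGroup.exists_folner [DecidableEq G] (hG : IsAmenableGroup G) (S : Finset G)
    {ε : ℝ} (hε : 0 < ε) :
    ∃ F : Finset G, F.Nonempty ∧
      ∑ k ∈ S, ((F.filter fun x => k * x ∉ F).card : ℝ) ≤ ε * F.card := by
  obtain ⟨p, hp0, hp1, hpS⟩ := hG.exists_almost_invariant S
    (ε := ε / (S.card + 1)) (by positivity)
  set s := p.support with hs
  -- Layer cake: the first sum counts the level set {p > t} when t ≥ 0, and the second bounds its
  -- S-boundary. Their integrals are 1 and less than ε, so h is positive at some t, whose level set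
  -- is the Følner set.
  let h : ℝ → ℝ := fun t => ε * ∑ x ∈ s, (Set.Ico 0 (p x)).indicator (fun _ => (1 : ℝ)) t -
    ∑ k ∈ S, ∑ x ∈ s, (Set.Ico (p (k * x)) (p x)).indicator (fun _ => (1 : ℝ)) t
  have hint : ∀ a b : ℝ, Integrable ((Set.Ico a b).indicator fun _ => (1 : ℝ)) := fun a b =>
    (integrable_indicator_iff measurableSet_Ico).2 (by simp [IntegrableOn])
  have hval : ∀ a b : ℝ, ∫ t, (Set.Ico a b).indicator (fun _ => (1 : ℝ)) t = max (b - a) 0 := by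
    intro a b
    rw [integral_indicator measurableSet_Ico]
    simp [Real.volume_real_Ico]
  have hpos : 0 < ∫ t, h t := by
    rw [integral_sub ((integrable_finsetSum _ fun x _ => hint _ _).const_mul _)
      (integrable_finsetSum _ fun k _ => integrable_finsetSum _ fun x _ => hint _ _),
      integral_const_mul, integral_finsetSum _ (fun x _ => hint _ _),
      integral_finsetSum _ (fun k _ => integrable_finsetSum _ fun x _ => hint _ _)]
    have e1 : ∑ x ∈ s, ∫ t, (Set.Ico 0 (p x)).indicator (fun _ => (1 : ℝ)) t = 1 := by
      refine Eq.trans (Finset.sum_congr rfl fun x _ => ?_) hp1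
      rw [hval, sub_zero, max_eq_left (hp0 x)]
    have e2 : ∀ k ∈ S, ∫ t, ∑ x ∈ s, (Set.Ico (p (k * x)) (p x)).indicator (fun _ => (1 : ℝ)) t ≤
        ε / (S.card + 1) := by
      intro k hk
      rw [integral_finsetSum _ (fun x _ => hint _ _)]
      refine le_trans (Finset.sum_le_sum fun x _ => ?_) (hpS k hk s).le
      rw [hval, abs_sub_comm]
      exact max_le (le_abs_self _) (abs_nonneg _)
    have e3 := Finset.sum_le_card_nsmul S _ _ e2
    rw [nsmul_eq_mul] at e3
    have e4 : (S.card : ℝ) * (ε / (S.card + 1)) < ε := by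
      rw [mul_div_assoc', div_lt_iff₀ (by positivity)]
      nlinarith
    rw [e1]
    linarith
  obtain ⟨t, ht⟩ : ∃ t, 0 < h t := by
    by_contra hcon
    push Not at hcon
    exact absurd (integral_nonpos hcon) (not_le.2 hpos)
  set F := s.filter fun x => t ∈ Set.Ico 0 (p x) with hF
  have hcard : ∑ x ∈ s, (Set.Ico 0 (p x)).indicator (fun _ => (1 : ℝ)) t = F.card := by
    rw [hF, Finset.card_filter]
    push_cast
    exact Finset.sum_congr rfl fun x _ => by simp [Set.indicator_apply]
  have hbd : ∀ k ∈ S, ((F.filter fun x => k * x ∉ F).card : ℝ) ≤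
      ∑ x ∈ s, (Set.Ico (p (k * x)) (p x)).indicator (fun _ => (1 : ℝ)) t := by
    intro k _
    have e1 : ((F.filter fun x => k * x ∉ F).card : ℝ) =
        ∑ x ∈ F.filter (fun x => k * x ∉ F),
          (Set.Ico (p (k * x)) (p x)).indicator (fun _ => (1 : ℝ)) t := by
      rw [Finset.card_eq_sum_ones]
      push_cast
      refine Finset.sum_congr rfl fun x hx => ?_
      rw [Finset.mem_filter] at hx
      obtain ⟨hxF, hkx⟩ := hx
      rw [hF, Finset.mem_filter] at hxF hkx
      rw [Set.indicator_of_mem]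
      refine ⟨?_, hxF.2.2⟩
      by_contra hlt
      push Not at hlt
      refine hkx ⟨?_, hxF.2.1, hlt⟩
      rw [hs, Finsupp.mem_support_iff]
      exact (hxF.2.1.trans_lt hlt).ne'
    rw [e1]
    refine Finset.sum_le_sum_of_subset_of_nonneg ?_ fun x _ _ =>
      Set.indicator_nonneg (fun _ _ => zero_le_one) _
    exact (Finset.filter_subset _ _).trans (Finset.filter_subset _ _)
  have htotal := Finset.sum_le_sum hbd
  have hlt : ∑ k ∈ S, ((F.filter fun x => k * x ∉ F).card : ℝ) < ε * F.card := by
    have : 0 < ε * F.card - ∑ k ∈ S, ∑ x ∈ s,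
        (Set.Ico (p (k * x)) (p x)).indicator (fun _ => (1 : ℝ)) t := by
      rw [← hcard]; exact ht
    linarith
  refine ⟨F, ?_, hlt.le⟩
  rw [Finset.nonempty_iff_ne_empty]
  intro hemp
  rw [hemp] at hlt
  simp at hlt

end Folner

/-! ### Exhaustion and partial tilings. -/

section Tilings

open MeasureTheory Filter Topology

/-- A countable exhaustion principle: if increasing sequences have upper bounds, then a bounded
monotone functional is eventually constant above some element. -/
theorem exists_forall_rel_le {P : Type*} {r : P → P → Prop} (hrefl : ∀ p, r p p)
    (htrans : ∀ p q s, r p q → r q s → r p s) {m : P → ℝ} {C : ℝ} (hC : ∀ p, m p ≤ C)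
    (hm : ∀ p q, r p q → m p ≤ m q)
    (hseq : ∀ s : ℕ → P, (∀ n, r (s n) (s (n + 1))) → ∃ q, ∀ n, r (s n) q) (p₀ : P) :
    ∃ p, ∀ q, r p q → m q ≤ m p := by
  have hbdd : ∀ p, BddAbove (m '' {q | r p q}) := fun p =>
    ⟨C, by rintro _ ⟨q, -, rfl⟩; exact hC q⟩
  -- The element q reaches at least halfway from m p to the supremum above p; along the iteration
  -- the right-hand side tends to 2L - L = L.
  have hstep : ∀ p, ∃ q, r p q ∧ ∀ q', r p q' → m q' ≤ 2 * m q - m p := by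
    intro p
    by_cases h : m p < sSup (m '' {q | r p q})
    · obtain ⟨_, ⟨q, hq, rfl⟩, hlt⟩ := exists_lt_of_lt_csSup
        (s := m '' {q | r p q}) ⟨m p, p, hrefl p, rfl⟩
        (show (m p + sSup (m '' {q | r p q})) / 2 < sSup (m '' {q | r p q}) by linarith)
      refine ⟨q, hq, fun q' hq' => ?_⟩
      have := le_csSup (hbdd p) (Set.mem_image_of_mem m hq')
      linarith
    · refine ⟨p, hrefl p, fun q' hq' => ?_⟩
      have := le_csSup (hbdd p) (Set.mem_image_of_mem m hq')
      linarith
  choose step h1 h2 using hstep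
  let s : ℕ → P := fun n => step^[n] p₀
  have hs : ∀ n, s (n + 1) = step (s n) := fun n => Function.iterate_succ_apply' _ _ _
  have hr : ∀ n, r (s n) (s (n + 1)) := fun n => by rw [hs]; exact h1 _
  obtain ⟨q, hq⟩ := hseq s hr
  refine ⟨q, fun q' hq' => ?_⟩
  have hmono : Monotone fun n => m (s n) := monotone_nat_of_le_succ fun n => hm _ _ (hr n)
  have hlim := tendsto_atTop_ciSup hmono ⟨C, by rintro _ ⟨n, rfl⟩; exact hC _⟩
  set L := ⨆ n, m (s n)
  have hL : L ≤ m q := le_of_tendsto' hlim fun n => hm _ _ (hq n)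
  have h3 : Tendsto (fun n => 2 * m (s (n + 1)) - m (s n)) atTop (𝓝 (2 * L - L)) :=
    ((hlim.comp (tendsto_add_atTop_nat 1)).const_mul 2).sub hlim
  have h4 : m q' ≤ 2 * L - L := ge_of_tendsto' h3 fun n => by
    rw [hs]
    exact h2 _ _ (htrans _ _ _ (hq n) hq')
  linarith

variable {G Y : Type*} [Group G] [MulAction G Y] [MeasurableSpace Y]

/-- A measurable subrelation `rel` of the orbit relation with finite classes which is trivial
outside of `carrier` and whose `S`-boundary is small compared with `carrier`. -/
structure PartialTiling (ν : Measure Y) (S : Finset G) (ε : ℝ) where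
  rel : Setoid Y
  carrier : Set Y
  measurable_rel : IsMeasurableRel rel
  measurable_carrier : MeasurableSet carrier
  finite_class : ∀ x, {y | rel x y}.Finite
  le_orbitRel : ∀ x y, rel x y → MulAction.orbitRel G Y x y
  eq_or_mem : ∀ x y, rel x y → x = y ∨ (x ∈ carrier ∧ y ∈ carrier)
  boundary_le : ∑ k ∈ S, ν.real {y | ¬rel y (k • y) ∧ (y ∈ carrier ∨ k • y ∈ carrier)} ≤
    ε * ν.real carrier

namespace PartialTiling

variable {ν : Measure Y} {S : Finset G} {ε : ℝ}

/-- The tiling with empty carrier. -/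
def empty [StandardBorelSpace Y] (ν : Measure Y) (S : Finset G) (ε : ℝ) : PartialTiling ν S ε where
  rel := ⊥
  carrier := ∅
  measurable_rel := measurableSet_eq_fun measurable_fst measurable_snd
  measurable_carrier := MeasurableSet.empty
  finite_class x := (Set.finite_singleton x).subset fun y (h : x = y) => h.symm
  le_orbitRel x y h := by
    obtain rfl : x = y := h
    exact (MulAction.orbitRel G Y).refl x
  eq_or_mem x y h := Or.inl h
  boundary_le := by simp

/-- `p'` extends `p` without changing the classes inside the carrier of `p`. -/
def Extends (p p' : PartialTiling ν S ε) : Prop :=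
  p.carrier ⊆ p'.carrier ∧ ∀ x ∈ p.carrier, ∀ y, p.rel x y ↔ p'.rel x y

theorem Extends.refl (p : PartialTiling ν S ε) : p.Extends p :=
  ⟨subset_rfl, fun _ _ _ => Iff.rfl⟩

theorem Extends.trans {p q s : PartialTiling ν S ε} (h₁ : p.Extends q) (h₂ : q.Extends s) :
    p.Extends s :=
  ⟨h₁.1.trans h₂.1, fun x hx y => (h₁.2 x hx y).trans (h₂.2 x (h₁.1 hx) y)⟩

theorem Extends.rel_of_rel {p q : PartialTiling ν S ε} (h : p.Extends q) {x y : Y}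
    (hxy : p.rel x y) : q.rel x y := by
  rcases p.eq_or_mem x y hxy with rfl | hx
  · exact q.rel.refl x
  · exact (h.2 x hx.1 y).1 hxy

/-- Every increasing sequence of partial tilings has an upper bound. -/
theorem exists_extends_of_monotone [IsFiniteMeasure ν] (hε : 0 ≤ ε) (s : ℕ → PartialTiling ν S ε)
    (hs : ∀ n, (s n).Extends (s (n + 1))) : ∃ q : PartialTiling ν S ε, ∀ n, (s n).Extends q := by
  have hle : ∀ {n m}, n ≤ m → (s n).Extends (s m) := fun {n m} h => by
    induction m, h using Nat.le_induction with
    | base => exact Extends.refl _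
    | succ m _ ih => exact ih.trans (hs m)
  let E : Setoid Y :=
    { r := fun x y => ∃ n, (s n).rel x y
      iseqv :=
        { refl := fun x => ⟨0, (s 0).rel.refl x⟩
          symm := fun ⟨n, h⟩ => ⟨n, (s n).rel.symm h⟩
          trans := fun ⟨n, h⟩ ⟨m, h'⟩ => ⟨max n m, (s _).rel.trans
            ((hle (le_max_left n m)).rel_of_rel h) ((hle (le_max_right n m)).rel_of_rel h')⟩ } }
  have hE : ∀ n, ∀ x ∈ (s n).carrier, ∀ y, (s n).rel x y ↔ E x y := by
    intro n x hx y
    refine ⟨fun h => ⟨n, h⟩, fun ⟨m, h⟩ => ?_⟩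
    refine ((hle (le_max_left n m)).2 x hx y).2 ?_
    exact (hle (le_max_right n m)).rel_of_rel h
  have hmono : Monotone fun n => (s n).carrier := fun n m h => (hle h).1
  refine ⟨⟨E, ⋃ n, (s n).carrier, ?_, MeasurableSet.iUnion fun n => (s n).measurable_carrier,
    ?_, ?_, ?_, ?_⟩, fun n => ⟨Set.subset_iUnion_of_subset n subset_rfl, hE n⟩⟩
  · have : {p : Y × Y | E p.1 p.2} = ⋃ n, {p : Y × Y | (s n).rel p.1 p.2} := by
      ext p
      rw [Set.mem_iUnion]
      exact Iff.rfl
    rw [IsMeasurableRel, this]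
    exact MeasurableSet.iUnion fun n => (s n).measurable_rel
  · intro x
    by_cases hx : ∃ n, x ∈ (s n).carrier
    · obtain ⟨n, hn⟩ := hx
      exact ((s n).finite_class x).subset fun y hy => (hE n x hn y).2 hy
    · refine (Set.finite_singleton x).subset ?_
      rintro y ⟨n, hn⟩
      rcases (s n).eq_or_mem x y hn with rfl | h
      · rfl
      · exact absurd ⟨n, h.1⟩ hx
  · rintro x y ⟨n, hn⟩
    exact (s n).le_orbitRel x y hn
  · rintro x y ⟨n, hn⟩
    rcases (s n).eq_or_mem x y hn with h | h
    · exact Or.inl h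
    · exact Or.inr ⟨Set.mem_iUnion.2 ⟨n, h.1⟩, Set.mem_iUnion.2 ⟨n, h.2⟩⟩
  · let D : G → ℕ → Set Y := fun k n =>
      {y | ¬(s n).rel y (k • y) ∧ (y ∈ (s n).carrier ∨ k • y ∈ (s n).carrier)}
    have hnot : ∀ (k : G) n y, (y ∈ (s n).carrier ∨ k • y ∈ (s n).carrier) →
        ((s n).rel y (k • y) ↔ E y (k • y)) := by
      rintro k n y (h | h)
      · exact hE n y h _
      · rw [Setoid.comm', hE n _ h, Setoid.comm']
    -- Once a pair touches the carrier its equivalence never changes again, so the boundary sets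
    -- increase and continuity of ν passes their estimate to the limit.
    have hDmono : ∀ k, Monotone (D k) := by
      rintro k n m h y ⟨h1, h2⟩
      have h2' : y ∈ (s m).carrier ∨ k • y ∈ (s m).carrier :=
        h2.imp (fun h' => hmono h h') fun h' => hmono h h'
      exact ⟨by rwa [hnot k m y h2', ← hnot k n y h2], h2'⟩
    have hD : ∀ k, {y | ¬E y (k • y) ∧ (y ∈ ⋃ n, (s n).carrier ∨ k • y ∈ ⋃ n, (s n).carrier)} ⊆
        ⋃ n, D k n := by
      rintro k y ⟨h1, h2⟩
      have : ∃ n, y ∈ (s n).carrier ∨ k • y ∈ (s n).carrier := by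
        rcases h2 with h2 | h2
        · obtain ⟨n, hn⟩ := Set.mem_iUnion.1 h2; exact ⟨n, Or.inl hn⟩
        · obtain ⟨n, hn⟩ := Set.mem_iUnion.1 h2; exact ⟨n, Or.inr hn⟩
      obtain ⟨n, hn⟩ := this
      exact Set.mem_iUnion.2 ⟨n, by rwa [hnot k n y hn], hn⟩
    refine (Finset.sum_le_sum fun k _ => measureReal_mono (hD k)).trans ?_
    have hlim : Tendsto (fun n => ∑ k ∈ S, ν.real (D k n)) atTop
        (𝓝 (∑ k ∈ S, ν.real (⋃ n, D k n))) :=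
      tendsto_finsetSum _ fun k _ =>
        (ENNReal.tendsto_toReal (measure_ne_top _ _)).comp
          (tendsto_measure_iUnion_atTop (hDmono k))
    refine le_of_tendsto' hlim fun n => (s n).boundary_le.trans ?_
    exact mul_le_mul_of_nonneg_left
      (measureReal_mono (Set.subset_iUnion_of_subset n subset_rfl)) hε

/-- Adding the tiles `F • b`, `b ∈ B`, to a partial tiling, when these are pairwise disjoint. -/
theorem exists_extends_of_tiles [StandardBorelSpace Y] [MeasurableConstSMul G Y]
    [IsFiniteMeasure ν] [SMulInvariantMeasure G Y ν] [DecidableEq G] (p : PartialTiling ν S ε)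
    (hε : 0 ≤ ε) {δ c : ℝ} (hδ : 2 * δ ≤ ε * c) (F : Finset G)
    (hF : ∑ k ∈ S, ((F.filter fun x => k * x ∉ F).card : ℝ) ≤ δ * F.card)
    (hF' : ∑ k ∈ S, ((F.filter fun x => k⁻¹ * x ∉ F).card : ℝ) ≤ δ * F.card)
    {B : Set Y} (hB : MeasurableSet B)
    (hdisj : ∀ f ∈ F, ∀ f' ∈ F, ∀ b ∈ B, ∀ b' ∈ B, f • b = f' • b' → f = f')
    (hc : c * F.card * ν.real B ≤ ∑ f ∈ F, ν.real {b | b ∈ B ∧ f • b ∉ p.carrier}) :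
    ∃ q : PartialTiling ν S ε, p.Extends q ∧
      ν.real p.carrier + c * F.card * ν.real B ≤ ν.real q.carrier := by
  -- The new tiles are truncated: only their part outside the old carrier is added, so old classes
  -- remain untouched.
  let N : Set Y := ⋃ f ∈ F, {y | y ∉ p.carrier ∧ f⁻¹ • y ∈ B}
  have hNm : ∀ f : G, MeasurableSet {y | y ∉ p.carrier ∧ f⁻¹ • y ∈ B} := fun f =>
    p.measurable_carrier.compl.inter (measurable_const_smul f⁻¹ hB)
  have hN : MeasurableSet N := Finset.measurableSet_biUnion F fun f _ => hNm f
  have hmemN : ∀ y, y ∈ N ↔ ∃ f ∈ F, y ∉ p.carrier ∧ f⁻¹ • y ∈ B := fun y => by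
    simp only [N, Set.mem_iUnion, exists_prop]; exact Iff.rfl
  have hpN : Disjoint p.carrier N := Set.disjoint_left.2 fun y hy hy' => by
    obtain ⟨f, _, h, _⟩ := (hmemN y).1 hy'
    exact h hy
  have hNreal : ν.real N = ∑ f ∈ F, ν.real {b | b ∈ B ∧ f • b ∉ p.carrier} := by
    rw [measureReal_biUnion_finset]
    · refine Finset.sum_congr rfl fun f _ => ?_
      rw [measureReal_def, measureReal_def, ← measure_preimage_smul ν f]
      congr 2
      ext y
      simp [and_comm]
    · intro f hf f' hf' hne
      refine Set.disjoint_left.2 fun y hy hy' => hne ?_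
      exact hdisj f hf f' hf' _ hy.2 _ hy'.2 (by simp)
    · exact fun f _ => hNm f
  let R : Y → Y → Prop := fun x y => x ∉ p.carrier ∧ y ∉ p.carrier ∧
    ∃ f ∈ F, ∃ f' ∈ F, f⁻¹ • x ∈ B ∧ f⁻¹ • x = f'⁻¹ • y
  have hRsymm : ∀ {x y}, R x y → R y x := by
    rintro x y ⟨hx, hy, f, hf, f', hf', hB, he⟩
    exact ⟨hy, hx, f', hf', f, hf, he ▸ hB, he.symm⟩
  let E : Setoid Y :=
    { r := fun x y => p.rel x y ∨ R x y
      iseqv :=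
        { refl := fun x => Or.inl (p.rel.refl x)
          symm := fun h => h.imp p.rel.symm hRsymm
          trans := by
            rintro x y z (h | h) (h' | h')
            · exact Or.inl (p.rel.trans h h')
            · rcases p.eq_or_mem x y h with rfl | h1
              · exact Or.inr h'
              · exact absurd h1.2 h'.1
            · rcases p.eq_or_mem y z h' with rfl | h1
              · exact Or.inr h
              · exact absurd h1.1 h.2.1
            · obtain ⟨hx, hy, f, hf, f', hf', hB, he⟩ := h
              obtain ⟨_, hz, k, hk, k', hk', hB', he'⟩ := h'
              obtain rfl : f' = k := hdisj f' hf' k hk _ (he ▸ hB) _ hB' (by simp)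
              exact Or.inr ⟨hx, hz, f, hf, k', hk', hB, he.trans he'⟩ } }
  have hRN : ∀ {x y}, R x y → x ∈ N := fun {x y} ⟨hx, _, f, hf, _, _, hB, _⟩ =>
    (hmemN x).2 ⟨f, hf, hx, hB⟩
  have hRmeas : MeasurableSet {z : Y × Y | R z.1 z.2} := by
    have : {z : Y × Y | R z.1 z.2} = (Prod.fst ⁻¹' p.carrierᶜ ∩ Prod.snd ⁻¹' p.carrierᶜ) ∩
        ⋃ f ∈ F, ⋃ f' ∈ F, ({z : Y × Y | f⁻¹ • z.1 ∈ B} ∩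
          {z : Y × Y | f⁻¹ • z.1 = f'⁻¹ • z.2}) := by
      ext z
      simp only [Set.mem_inter_iff, Set.mem_iUnion, exists_prop, Set.mem_preimage, and_assoc]
      exact Iff.rfl
    rw [this]
    refine ((measurable_fst p.measurable_carrier.compl).inter
      (measurable_snd p.measurable_carrier.compl)).inter ?_
    refine Finset.measurableSet_biUnion F fun f _ => Finset.measurableSet_biUnion F fun f' _ => ?_
    exact (((measurable_const_smul f⁻¹).comp measurable_fst) hB).inter
      (measurableSet_eq_fun ((measurable_const_smul f⁻¹).comp measurable_fst)
        ((measurable_const_smul f'⁻¹).comp measurable_snd))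
  -- A pair touching the old carrier is already counted there. Otherwise k leaves a tile (k f ∉ F)
  -- or enters one (k⁻¹ f ∉ F), and each such f costs ν(B). Over S this is at most 2δ|F|ν(B) ≤ ε
  -- c|F|ν(B) ≤ ε ν(N).
  have hbd : ∀ k : G, ν.real {y | ¬E y (k • y) ∧ (y ∈ p.carrier ∪ N ∨ k • y ∈ p.carrier ∪ N)} ≤
      ν.real {y | ¬p.rel y (k • y) ∧ (y ∈ p.carrier ∨ k • y ∈ p.carrier)} +
      (((F.filter fun x => k * x ∉ F).card : ℝ) * ν.real B +
        ((F.filter fun x => k⁻¹ * x ∉ F).card : ℝ) * ν.real B) := by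
    intro k
    have hsub : {y | ¬E y (k • y) ∧ (y ∈ p.carrier ∪ N ∨ k • y ∈ p.carrier ∪ N)} ⊆
        {y | ¬p.rel y (k • y) ∧ (y ∈ p.carrier ∨ k • y ∈ p.carrier)} ∪
        ((⋃ f ∈ F.filter fun x => k * x ∉ F, (fun y => f⁻¹ • y) ⁻¹' B) ∪
          ⋃ f ∈ F.filter fun x => k⁻¹ * x ∉ F, (fun y => (f⁻¹ * k) • y) ⁻¹' B) := by
      rintro y ⟨h1, h2⟩
      have h1' : ¬p.rel y (k • y) := fun h => h1 (Or.inl h)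
      have h1'' : ¬R y (k • y) := fun h => h1 (Or.inr h)
      by_cases h3 : y ∈ p.carrier ∨ k • y ∈ p.carrier
      · exact Or.inl ⟨h1', h3⟩
      · push Not at h3
        refine Or.inr ?_
        rcases h2 with (h2 | h2) | (h2 | h2)
        · exact absurd h2 h3.1
        · obtain ⟨f, hf, -, hfB⟩ := (hmemN _).1 h2
          refine Or.inl (Set.mem_iUnion₂.2 ⟨f, Finset.mem_filter.2 ⟨hf, fun hk => ?_⟩, hfB⟩)
          exact h1'' ⟨h3.1, h3.2, f, hf, k * f, hk, hfB, by simp [smul_smul]⟩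
        · exact absurd h2 h3.2
        · obtain ⟨f, hf, -, hfB⟩ := (hmemN _).1 h2
          refine Or.inr (Set.mem_iUnion₂.2 ⟨f, Finset.mem_filter.2 ⟨hf, fun hk => ?_⟩, ?_⟩)
          · refine h1'' (hRsymm ⟨h3.2, h3.1, f, hf, k⁻¹ * f, hk, hfB, by simp [smul_smul]⟩)
          · simpa [smul_smul] using hfB
    have hpre : ∀ (h : G), ν.real ((fun y => h • y) ⁻¹' B) = ν.real B := fun h => by
      rw [measureReal_def, measureReal_def, measure_preimage_smul]
    refine (measureReal_mono hsub).trans ((measureReal_union_le _ _).trans ?_)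
    refine add_le_add le_rfl ((measureReal_union_le _ _).trans (add_le_add ?_ ?_))
    · refine (measureReal_biUnion_finset_le _ _).trans (le_of_eq ?_)
      simp only [hpre, Finset.sum_const, nsmul_eq_mul]
    · refine (measureReal_biUnion_finset_le _ _).trans (le_of_eq ?_)
      simp only [hpre, Finset.sum_const, nsmul_eq_mul]
  refine ⟨⟨E, p.carrier ∪ N, ?_, p.measurable_carrier.union hN, ?_, ?_, ?_, ?_⟩, ⟨?_, ?_⟩, ?_⟩
  · exact p.measurable_rel.union hRmeas
  · intro x
    refine ((p.finite_class x).union (Set.Finite.biUnion F.finite_toSet fun f _ =>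
      F.finite_toSet.image fun f' => (f' * f⁻¹) • x)).subset ?_
    rintro y (h | ⟨_, _, f, hf, f', hf', _, he⟩)
    · exact Or.inl h
    · exact Or.inr (Set.mem_iUnion₂.2 ⟨f, hf, f', hf', by simp [mul_smul, he]⟩)
  · rintro x y (h | ⟨_, _, f, hf, f', hf', _, he⟩)
    · exact p.le_orbitRel x y h
    · exact MulAction.orbitRel_apply.2 ⟨f * f'⁻¹, by simp [mul_smul, ← he]⟩
  · rintro x y (h | h)
    · exact (p.eq_or_mem x y h).imp_right fun h' => ⟨Or.inl h'.1, Or.inl h'.2⟩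
    · exact Or.inr ⟨Or.inr (hRN h), Or.inr (hRN (hRsymm h))⟩
  · refine (Finset.sum_le_sum fun k _ => hbd k).trans ?_
    rw [Finset.sum_add_distrib, Finset.sum_add_distrib, ← Finset.sum_mul, ← Finset.sum_mul,
      measureReal_union hpN hN (measure_ne_top _ _) (measure_ne_top _ _), mul_add]
    have h1 := mul_le_mul_of_nonneg_right hF (measureReal_nonneg (μ := ν) (s := B))
    have h2 := mul_le_mul_of_nonneg_right hF' (measureReal_nonneg (μ := ν) (s := B))
    have h3 := mul_le_mul_of_nonneg_left (hc.trans_eq hNreal.symm) hε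
    have h4 := mul_le_mul_of_nonneg_right hδ
      (mul_nonneg (Nat.cast_nonneg (α := ℝ) F.card) (measureReal_nonneg (μ := ν) (s := B)))
    have h5 := p.boundary_le
    nlinarith
  · exact Set.subset_union_left
  · intro x hx y
    exact ⟨Or.inl, fun h => h.resolve_right fun h' => h'.1 hx⟩
  · change _ ≤ ν.real (p.carrier ∪ N)
    rw [measureReal_union hpN hN (measure_ne_top _ _) (measure_ne_top _ _), hNreal]
    exact add_le_add le_rfl hc

end PartialTiling

end Tilings

/-! ### The Ornstein–Weiss theorem for free actions. -/

section Hyperfinite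

open MeasureTheory Filter Topology

variable {G Y : Type*} [Group G] [MulAction G Y] [MeasurableSpace Y] [StandardBorelSpace Y]
  [MeasurableConstSMul G Y] {ν : Measure Y}

/-- If almost no point is fixed by `g`, every set of positive measure contains a set of positive
measure that is disjoint from its translate by `g`. -/
theorem exists_subset_forall_smul_notMem {g : G} (hg : ∀ᵐ y ∂ν, g • y ≠ y) {B : Set Y}
    (hB : MeasurableSet B) (hpos : ν B ≠ 0) :
    ∃ B' ⊆ B, MeasurableSet B' ∧ ν B' ≠ 0 ∧ ∀ b ∈ B', g • b ∉ B' := by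
  obtain ⟨ψ, hψ, hinj⟩ := MeasurableSpace.measurable_injection_nat_bool_of_countablySeparated Y
  -- The set D i consists of points of B whose n-th separating bit is flipped by g, so g moves it
  -- off itself. If all of them were null, g would fix almost every point of B.
  let D : ℕ × Bool → Set Y := fun i =>
    B ∩ ({b | ψ b i.1 = i.2} ∩ {b | ψ (g • b) i.1 = !i.2})
  have hD : ∀ i, MeasurableSet (D i) := fun i => by
    have h1 : Measurable fun b => ψ b i.1 := (measurable_pi_apply i.1).comp hψ
    exact hB.inter ((h1 (measurableSet_singleton i.2)).inter
      ((h1.comp (measurable_const_smul g)) (measurableSet_singleton (!i.2))))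
  by_contra hcon
  push Not at hcon
  have hzero : ∀ i, ν (D i) = 0 := by
    intro i
    by_contra hne
    obtain ⟨b, hb, hgb⟩ := hcon (D i) Set.inter_subset_left (hD i) hne
    have h1 : ψ (g • b) i.1 = !i.2 := hb.2.2
    have h2 : ψ (g • b) i.1 = i.2 := hgb.2.1
    rw [h1] at h2
    simp at h2
  refine hpos (measure_mono_null ?_ (measure_union_null (ae_iff.1 hg) (measure_iUnion_null hzero)))
  intro b hb
  by_cases h : g • b = b
  · exact Or.inl (not_not.2 h)
  · obtain ⟨n, hn⟩ := Function.ne_iff.1 (hinj.ne h)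
    exact Or.inr (Set.mem_iUnion.2 ⟨(n, ψ b n), hb, rfl, Bool.eq_not_of_ne hn⟩)

theorem exists_subset_forall_finset_smul_notMem (s : Finset G)
    (hs : ∀ g ∈ s, ∀ᵐ y ∂ν, g • y ≠ y) {B : Set Y}
    (hB : MeasurableSet B) (hpos : ν B ≠ 0) :
    ∃ B' ⊆ B, MeasurableSet B' ∧ ν B' ≠ 0 ∧ ∀ g ∈ s, ∀ b ∈ B', g • b ∉ B' := by
  classical
  induction s using Finset.induction_on with
  | empty => exact ⟨B, subset_rfl, hB, hpos, by simp⟩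
  | insert g s _ ih =>
    obtain ⟨B₁, h1, h2, h3, h4⟩ := ih fun g' hg' => hs g' (Finset.mem_insert_of_mem hg')
    obtain ⟨B₂, k1, k2, k3, k4⟩ :=
      exists_subset_forall_smul_notMem (hs g (Finset.mem_insert_self g s)) h2 h3
    refine ⟨B₂, k1.trans h1, k2, k3, fun g' hg' b hb hgb => ?_⟩
    rcases Finset.mem_insert.1 hg' with rfl | hg'
    · exact k4 b hb hgb
    · exact h4 g' hg' b (k1 hb) (k1 hgb)

variable [IsProbabilityMeasure ν] [SMulInvariantMeasure G Y ν]

/-- A partial tiling that does not cover almost everything has a strictly larger extension. -/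
theorem PartialTiling.exists_lt (hG : IsAmenableGroup G)
    (hfree : ∀ g : G, g ≠ 1 → ∀ᵐ y ∂ν, g • y ≠ y) {S : Finset G} {ε : ℝ} (hε : 0 < ε)
    (p : PartialTiling ν S ε) (hp : ν p.carrierᶜ ≠ 0) :
    ∃ q : PartialTiling ν S ε, p.Extends q ∧ ν.real p.carrier < ν.real q.carrier := by
  classical
  set c := ν.real p.carrierᶜ with hc
  have hc0 : 0 < c := ENNReal.toReal_pos hp (measure_ne_top _ _)
  -- Inverses are included because tiles have an entering and a leaving boundary; the half makes the
  -- two together at most ε c |F|.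
  obtain ⟨F, hFne, hF⟩ := hG.exists_folner (S ∪ S.image (·⁻¹)) (ε := ε * c / 2) (by positivity)
  have hFS : ∀ T ⊆ S ∪ S.image (·⁻¹), ∑ k ∈ T, ((F.filter fun x => k * x ∉ F).card : ℝ) ≤
      ε * c / 2 * F.card := fun T hT =>
    (Finset.sum_le_sum_of_subset_of_nonneg hT fun _ _ _ => Nat.cast_nonneg _).trans hF
  have hFinv : ∑ k ∈ S, ((F.filter fun x => k⁻¹ * x ∉ F).card : ℝ) ≤ ε * c / 2 * F.card := by
    have := hFS _ Finset.subset_union_right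
    rwa [Finset.sum_image fun a _ b _ h => inv_injective h] at this
  have hcard : (0 : ℝ) < F.card := Nat.cast_pos.2 hFne.card_pos
  let Z : G → Set Y := fun f => {b | f • b ∉ p.carrier}
  have hZ : ∀ f, MeasurableSet (Z f) := fun f =>
    measurable_const_smul f p.measurable_carrier.compl
  have hZν : ∀ f, ν.real (Z f) = c := fun f => by
    rw [hc, measureReal_def, measureReal_def, ← measure_preimage_smul ν f p.carrierᶜ]
    rfl
  let φ : Y → ℝ := fun b => ∑ f ∈ F, (Z f).indicator (fun _ => (1 : ℝ)) b
  have hind : ∀ f (B : Set Y), MeasurableSet B →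
      ∫ b in B, (Z f).indicator (fun _ => (1 : ℝ)) b ∂ν =
        ν.real {b | b ∈ B ∧ f • b ∉ p.carrier} := by
    intro f B hB
    rw [integral_indicator (hZ f), setIntegral_const, smul_eq_mul, mul_one,
      measureReal_restrict_apply (hZ f)]
    congr 1
    ext b
    exact and_comm
  have hint : ∀ f, Integrable ((Z f).indicator fun _ => (1 : ℝ)) ν := fun f =>
    (integrable_const 1).indicator (hZ f)
  have hφ : Integrable φ ν := integrable_finsetSum _ fun f _ => hint f
  have hφm : Measurable φ := Finset.measurable_sum _ fun f _ => measurable_const.indicator (hZ f)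
  have hφint : ∫ b, φ b ∂ν = F.card * c := by
    rw [integral_finsetSum _ fun f _ => hint f]
    have : ∀ f ∈ F, ∫ b, (Z f).indicator (fun _ => (1 : ℝ)) b ∂ν = c := fun f _ => by
      rw [← setIntegral_univ, hind f _ MeasurableSet.univ, ← hZν f]
      simp [Z]
    rw [Finset.sum_congr rfl this, Finset.sum_const, nsmul_eq_mul]
  -- The number φ(b) of uncovered points of the tile at b has mean |F| c, hence is at least its mean
  -- on a set of positive measure. A subset of it serves as base, thinned so that its translates by
  -- the nontrivial f⁻¹f' miss it and the tiles are disjoint.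
  have hB : ν {b | F.card * c ≤ φ b} ≠ 0 := by
    have := measure_integral_le_pos hφ
    rw [hφint] at this
    exact this.ne'
  have hBm : MeasurableSet {b | F.card * c ≤ φ b} := measurableSet_le measurable_const hφm
  obtain ⟨B, h1, h2, h3, h4⟩ := exists_subset_forall_finset_smul_notMem
    ((F ×ˢ F).image (fun x => x.1⁻¹ * x.2) |>.erase 1)
    (fun g hg => hfree g (Finset.ne_of_mem_erase hg)) hBm hB
  have hBpos : 0 < ν.real B := ENNReal.toReal_pos h3 (measure_ne_top _ _)
  obtain ⟨q, hq, hq'⟩ := p.exists_extends_of_tiles hε.le (δ := ε * c / 2) (c := c) (by linarith) F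
    (hFS S Finset.subset_union_left) hFinv h2 (by
      intro f hf f' hf' b hb b' hb' he
      by_contra hne
      refine h4 (f'⁻¹ * f) (Finset.mem_erase.2 ⟨?_, Finset.mem_image.2
        ⟨(f', f), Finset.mem_product.2 ⟨hf', hf⟩, rfl⟩⟩) b hb ?_
      · rw [Ne, inv_mul_eq_one]
        exact fun h => hne h.symm
      · rw [mul_smul, he, inv_smul_smul]
        exact hb') (by
      have e1 : ∑ f ∈ F, ν.real {b | b ∈ B ∧ f • b ∉ p.carrier} = ∫ b in B, φ b ∂ν := by
        rw [integral_finsetSum _ fun f _ => (hint f).integrableOn]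
        exact Finset.sum_congr rfl fun f _ => (hind f B h2).symm
      rw [e1]
      have e2 := setIntegral_mono_on (μ := ν) (s := B) (f := fun _ => F.card * c)
        (integrable_const _).integrableOn hφ.integrableOn h2 fun b hb => h1 hb
      rw [setIntegral_const, smul_eq_mul] at e2
      linarith)
  refine ⟨q, hq, lt_of_lt_of_le ?_ hq'⟩
  have : 0 < c * F.card * ν.real B := by positivity
  linarith

/-- The Ornstein–Weiss lemma: finite subrelations which are almost invariant. -/
theorem exists_finite_subrelation (hG : IsAmenableGroup G)
    (hfree : ∀ g : G, g ≠ 1 → ∀ᵐ y ∂ν, g • y ≠ y) (S : Finset G) {ε : ℝ} (hε : 0 < ε) :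
    ∃ E : Setoid Y, IsMeasurableRel E ∧ (∀ x, {y | E x y}.Finite) ∧
      (∀ x y, E x y → MulAction.orbitRel G Y x y) ∧
      ∑ k ∈ S, ν.real {y | ¬E y (k • y)} ≤ ε := by
  obtain ⟨p, hp⟩ := exists_forall_rel_le (r := PartialTiling.Extends (ν := ν) (S := S) (ε := ε))
    PartialTiling.Extends.refl (fun _ _ _ => PartialTiling.Extends.trans)
    (m := fun p => ν.real p.carrier) (C := 1) (fun p => measureReal_le_one)
    (fun p q h => measureReal_mono h.1) (PartialTiling.exists_extends_of_monotone hε.le)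
    (PartialTiling.empty ν S ε)
  have hfull : ν p.carrierᶜ = 0 := by
    by_contra hne
    obtain ⟨q, h1, h2⟩ := p.exists_lt hG hfree hε hne
    exact absurd (hp q h1) (not_le.2 h2)
  refine ⟨p.rel, p.measurable_rel, p.finite_class, p.le_orbitRel, ?_⟩
  have h1 : ∀ k ∈ S, ν.real {y | ¬p.rel y (k • y)} ≤
      ν.real {y | ¬p.rel y (k • y) ∧ (y ∈ p.carrier ∨ k • y ∈ p.carrier)} := by
    intro k _
    refine ENNReal.toReal_mono (measure_ne_top _ _) (measure_mono_ae ?_)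
    filter_upwards [measure_eq_zero_iff_ae_notMem.1 hfull] with y hy h
    exact ⟨h, Or.inl (not_not.1 hy)⟩
  refine (Finset.sum_le_sum h1).trans (p.boundary_le.trans ?_)
  exact mul_le_of_le_one_right hε.le measureReal_le_one

/-- Essentially free orbit relations of countable amenable groups are hyperfinite. -/
theorem isHyperfiniteRel_orbitRel [Countable G] (hG : IsAmenableGroup G)
    (hfree : ∀ g : G, g ≠ 1 → ∀ᵐ y ∂ν, g • y ≠ y) :
    IsHyperfiniteRel (MulAction.orbitRel G Y) ν := by
  classical
  obtain ⟨e, he⟩ := exists_surjective_nat G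
  choose E h1 h2 h3 h4 using fun n : ℕ => exists_finite_subrelation (ν := ν) hG hfree
    ((Finset.range (n + 1)).image e) (ε := (1 / 2) ^ n) (by positivity)
  -- The E_n need not increase, but the intersections of their tails do. As the errors are summable,
  -- Borel–Cantelli puts almost every pair (x, g x) in such a tail.
  let F : ℕ → Setoid Y := fun n =>
    { r := fun x y => ∀ k, n ≤ k → E k x y
      iseqv :=
        { refl := fun x k _ => (E k).refl x
          symm := fun h k hk => (E k).symm (h k hk)
          trans := fun h h' k hk => (E k).trans (h k hk) (h' k hk) } }
  have hF : ∀ n x y, F n x y ↔ ∀ k, n ≤ k → E k x y := fun _ _ _ => Iff.rfl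
  have hFn : ∀ n, ∀ x y, F n x y → E n x y := fun n x y h => (hF n x y).1 h n le_rfl
  refine ⟨F, fun n => ?_, fun n x => (h2 n x).subset fun y hy => hFn n x y hy, ?_, ?_⟩
  · have : {p : Y × Y | F n p.1 p.2} = ⋂ k, ⋂ (_ : n ≤ k), {p : Y × Y | E k p.1 p.2} := by
      ext p
      simp only [Set.mem_iInter]
      exact hF n _ _
    rw [IsMeasurableRel, this]
    exact MeasurableSet.iInter fun k => MeasurableSet.iInter fun _ => h1 k
  · intro n x y h
    exact (hF _ _ _).2 fun k hk => (hF _ _ _).1 h k ((Nat.le_succ n).trans hk)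
  · have key : ∀ g : G, ∀ᵐ x ∂ν, ∃ n, F n x (g • x) := by
      intro g
      obtain ⟨j, rfl⟩ := he g
      -- The shift by j is needed because `e j` is only controlled from stage j on.
      have hsum : ∑' n, ν {y | ¬E (n + j) y (e j • y)} ≠ ∞ := by
        have hle : ∀ n, ν {y | ¬E (n + j) y (e j • y)} ≤ ENNReal.ofReal ((1 / 2) ^ n) := by
          intro n
          rw [← ofReal_measureReal]
          refine ENNReal.ofReal_le_ofReal ?_
          have hmem : e j ∈ (Finset.range (n + j + 1)).image e :=
            Finset.mem_image_of_mem _ (Finset.mem_range.2 (by omega))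
          refine (Finset.single_le_sum (f := fun k => ν.real {y | ¬E (n + j) y (k • y)})
            (fun _ _ => measureReal_nonneg) hmem).trans ((h4 (n + j)).trans ?_)
          exact pow_le_pow_of_le_one (by norm_num) (by norm_num) (Nat.le_add_right n j)
        refine ne_top_of_le_ne_top ?_ (ENNReal.tsum_le_tsum hle)
        rw [← ENNReal.ofReal_tsum_of_nonneg (fun _ => by positivity)
          (summable_geometric_of_lt_one (by norm_num) (by norm_num))]
        exact ENNReal.ofReal_ne_top
      filter_upwards [ae_eventually_notMem hsum] with x hx
      obtain ⟨N, hN⟩ := eventually_atTop.1 hx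
      refine ⟨N + j, (hF _ _ _).2 fun k hk => ?_⟩
      have := hN (k - j) (by omega)
      rw [Nat.sub_add_cancel (by omega)] at this
      exact not_not.1 this
    filter_upwards [ae_all_iff.2 key] with x hx y
    constructor
    · intro h
      obtain ⟨g, rfl⟩ := MulAction.orbitRel_apply.1 ((MulAction.orbitRel G Y).symm h)
      exact hx g
    · rintro ⟨n, hn⟩
      exact h3 n x y (hFn n x y hn)

theorem isMeasurableRel_orbitRel [Countable G] : IsMeasurableRel (MulAction.orbitRel G Y) := by
  have : {p : Y × Y | MulAction.orbitRel G Y p.1 p.2} = ⋃ g : G, {p | g • p.2 = p.1} := by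
    ext p
    simp only [Set.mem_iUnion]
    exact Iff.rfl
  rw [IsMeasurableRel, this]
  exact MeasurableSet.iUnion fun g =>
    measurableSet_eq_fun ((measurable_const_smul g).comp measurable_snd) measurable_fst

end Hyperfinite

/-! ### Assembly of the three statements. -/

section Main

open MeasureTheory

theorem IsSingularSubgroup.isMaximalHyperfiniteIn_orbitRel {Γ X Y : Type*} [Group Γ] [Countable Γ]
    {Λ : Subgroup Γ} [TopologicalSpace X] [CompactSpace X] [T2Space X] [Nonempty X]
    [MeasurableSpace X] [BorelSpace X] [MulAction Γ X] [ContinuousConstSMul Γ X]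
    (hΛ : IsSingularSubgroup Λ X) [MeasurableSpace Y] [StandardBorelSpace Y] {ν : Measure Y}
    [IsProbabilityMeasure ν] [MulAction Γ Y] [MeasurableConstSMul Γ Y] [SMulInvariantMeasure Γ Y ν]
    (hfree : ∀ g : Γ, g ≠ 1 → ∀ᵐ y ∂ν, g • y ≠ y) :
    IsMaximalHyperfiniteIn (MulAction.orbitRel Λ Y) (MulAction.orbitRel Γ Y) ν where
  measurable := isMeasurableRel_orbitRel
  le := Filter.Eventually.of_forall fun x y ⟨g, hg⟩ => ⟨(g : Γ), hg⟩
  hyperfinite := by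
    have : SMulInvariantMeasure Λ Y ν := ⟨fun g s hs =>
      SMulInvariantMeasure.measure_preimage_smul (g : Γ) hs⟩
    exact isHyperfiniteRel_orbitRel hΛ.1 fun g hg => hfree g fun h => hg (Subtype.ext h)
  maximal T _ hST hTR hT := hΛ.maximal_hyperfinite hfree T hST hTR hT

end Main

theorem theoremA {Γ : Type*} [Group Γ] [Countable Γ] (Λ : Subgroup Γ)
    (X : Type*) [TopologicalSpace X] [CompactSpace X] [T2Space X] [Nonempty X]
    [MeasurableSpace X] [BorelSpace X] [MulAction Γ X] [ContinuousConstSMul Γ X]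
    (hΛ : IsSingularSubgroup Λ X) :
    (∀ (H : Type*) [NormedAddCommGroup H] [InnerProductSpace ℂ H] [CompleteSpace H]
      [TopologicalSpace.SeparableSpace H] (Q : VonNeumannAlgebra H) (Ω : H),
      IsTracialStandardForm Q Ω → IsAmenableVN Q Ω →
      ∀ σ : TracePreservingAction Γ Q Ω,
        IsMaximalAmenableIn (σ.crossedProduct Λ) (σ.crossedProduct ⊤) (ell2Unit Γ Ω)) ∧
    IsMaximalAmenableIn (groupVN Λ) (groupVN (⊤ : Subgroup Γ)) (ell2Unit Γ (1 : ℂ)) ∧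
    (∀ (Y : Type*) [MeasurableSpace Y] [StandardBorelSpace Y] (ν : MeasureTheory.Measure Y)
      [MeasureTheory.IsProbabilityMeasure ν] [MulAction Γ Y] [MeasurableConstSMul Γ Y]
      [MeasureTheory.SMulInvariantMeasure Γ Y ν],
      (∀ g : Γ, g ≠ 1 → ∀ᵐ y ∂ν, g • y ≠ y) →
        IsMaximalHyperfiniteIn (MulAction.orbitRel Λ Y) (MulAction.orbitRel Γ Y) ν) :=
  ⟨fun _ _ _ _ _ _ _ hQ hQa σ => σ.isMaximalAmenableIn_crossedProduct hΛ hQ hQa,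
    isMaximalAmenableIn_groupVN hΛ,
    fun _ _ _ _ _ _ _ _ hfree => hΛ.isMaximalHyperfiniteIn_orbitRel hfree⟩
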